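/- Let $r>1$ be odd and $A_r=e^{\pi i/r}$. Let $\langle\,\cdot\,\rangle$ be the Kauffman bracket of framed links in $S^3$ at $A=A_r$ (crossing $=A\,(\text{$A$-smoothing})+A^{-1}(\text{$B$-smoothing})$, each circle contributes $-A^2-A^{-2}$, and $\langle\emptyset\rangle=1$). A component labelled $n$ stands for $n$ parallel strands with the $n$-th Jones–Wenzl idempotent inserted; $\Delta_n$ is the value of the $0$-framed unknot labelled $n$, $e_i$ is the core of the solid torus labelled $i$, and $\Omega_r=\sum_{i=0}^{(r-3)/2}\Delta_i e_i$. Choose $\eta,\kappa\in\mathbb C$ with $\eta^2\langle\Omega_r\rangle=1$ and $\kappa^6=A_r^{-6-r(r+1)/2}$. For a labelled framed link $K$ in the closed oriented 3-manifold described by surgery on a framed link $L\subset S^3$, put $$I_r(M,K)=\kappa^{3(b_-(L)-b_+(L))}\,\langle L(\eta\,\Omega_r)\cup K\rangle,$$ where $b_\pm(L)$ are the numbers of positive and negative eigenvalues of the linking matrix of $L$, and $I_r(M)=I_r(M,\emptyset)$. Let $M$ be the quaternionic manifold $S^3/Q_8$, described by surgery on the following two-component link $L=L_0\cup L_1$ (a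 $(2,4)$ torus link with both framings $0$). The component $L_0$ is the closure of the 2-braid with one negative crossing, with one additional positive kink, so that its framing is $0$. The component $L_1$ is a $0$-framed unknot that encircles the two strands of this braid. Let $(0,0,c)$ be the $0$-framed unknot labelled $c$ that runs once parallel to the closed braid, does not cross it, and is encircled by $L_1$ together with the two strands of the braid. Then $$(1-A_r^4)\,I_r(M)=\sum_{k=1}^{r-1}(-1)^kA_r^{2k^2+2k},$$ $$I_r(M,(0,0,1))=-\frac{A_r^{-2}}{A_r^2+1},$$ $$A_r^4\,I_r(M,(0,0,2))=1-I_r(M).$$ -/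

import Mathlib

noncomputable section

namespace KauffmanSkein

/-! ### Crossingless diagrams

A planar diagram is read from bottom to top as a word of elementary pieces, positions being counted
from the left, starting with `0`. -/

/-- Elementary pieces of crossingless diagrams: `cup i` creates two neighbouring strands at the
positions `i` and `i + 1` (a local minimum), `cap i` joins the strands at these positions
(a local maximum). -/
inductive Piece : Type
  | cup (i : ℕ)
  | cap (i : ℕ)

/-- The ends of the arcs of a partial diagram are recorded, from left to right, as a list in which
the two ends of an arc carry the same number. `joinEnds i l` joins the ends at `i` and `i + 1`; it
returns the number (`0` or `1`) of circles that this closes, and the new list. -/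
def joinEnds (i : ℕ) (l : List ℕ) : ℕ × List ℕ :=
  match l.drop i with
  | a :: b :: t =>
      if a = b then (1, l.take i ++ t)
      else (0, (l.take i ++ t).map fun x => if x = b then a else x)
  | _ => (0, l)

/-- The number of circles that a crossingless word closes, if the arcs below it are recorded
by `l` and the numbers from `k` on are unused. -/
def circles : List Piece → List ℕ → ℕ → ℕ
  | [], _, _ => 0
  | .cup i :: w, l, k => circles w (l.take i ++ k :: k :: l.drop i) (k + 1)
  | .cap i :: w, l, k => (joinEnds i l).1 + circles w (joinEnds i l).2 k

/-- Formal complex linear combinations of crossingless words; the product stacks the right factor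
on top of the left factor. -/
abbrev Skein : Type := MonoidAlgebra ℂ (FreeMonoid Piece)

/-- The crossingless word with a single piece. -/
def piece (p : Piece) : Skein := MonoidAlgebra.of ℂ (FreeMonoid Piece) (FreeMonoid.of p)

/-- The value in the skein module of the three-sphere of a combination of closed crossingless
diagrams: the empty link has value `1` and each circle contributes `-A⁻² - A²`. -/
def bracket (A : ℂ) (x : Skein) : ℂ :=
  x.coeff.sum fun w a => a * (-A ^ (-2 : ℤ) - A ^ 2) ^ circles w.toList [] 0

/-- A local maximum below a local minimum, at the positions `i` and `i + 1`. -/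
def hook (i : ℕ) : Skein := piece (.cap i) * piece (.cup i)

/-- A crossing of the strands at `i` and `i + 1`, expanded by the skein relation. If `s = true`,
the overcrossing strand goes from bottom left to top right, otherwise from bottom right to top
left. -/
def crossing (A : ℂ) (i : ℕ) (s : Bool) : Skein :=
  if s then A • 1 + A⁻¹ • hook i else A⁻¹ • 1 + A • hook i

/-- `n` nested minima whose leftmost end is at position `k`. -/
def cups (k n : ℕ) : Skein := ((List.range n).map fun t => piece (.cup (k + t))).prod

/-- `n` nested maxima whose leftmost end is at position `k`. -/
def caps (k n : ℕ) : Skein := ((List.range n).reverse.map fun t => piece (.cap (k + t))).prod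

/-- A band of `a` parallel strands, starting at position `k`, crosses the `b` parallel strands on
its right. -/
def crossings (A : ℂ) (k a b : ℕ) (s : Bool) : Skein :=
  ((List.range a).reverse.map fun p =>
    ((List.range b).map fun t => crossing A (k + p + t) s).prod).prod

/-- The closure in the plane of an element on `n` strands. -/
def planeClosure (A : ℂ) (n : ℕ) (x : Skein) : ℂ := bracket A (cups 0 n * x * caps 0 n)

/-- The Jones-Wenzl idempotent on `n` strands, moved to the right by `k` positions.
In the recursion, the ratio is that of the closures of the two preceding idempotents. -/
def jonesWenzl (A : ℂ) : ℕ → ℕ → Skein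
  | 0, _ => 1
  | 1, _ => 1
  | n + 2, k =>
      jonesWenzl A (n + 1) k -
        (planeClosure A n (jonesWenzl A n 0) / planeClosure A (n + 1) (jonesWenzl A (n + 1) 0)) •
          (jonesWenzl A (n + 1) k * hook (k + n) * jonesWenzl A (n + 1) k)

/-- `Δ_n`, the value of the unknot (without twist) labelled `n`. -/
def delta (A : ℂ) (n : ℕ) : ℂ := planeClosure A n (jonesWenzl A n 0)

/-! ### Framed link diagrams -/

/-- Elementary pieces of diagrams of oriented links with components `ι`. In `cup i c d`, the new
arc belongs to the component `c`, and its left end points upwards if and only if `d = true`.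
`cross i s` is a crossing of the strands at `i` and `i + 1`, with `s` as in `crossing`. `box i`
marks the strand at `i` as the place for the idempotent of its component. -/
inductive Move (ι : Type) : Type
  | cup (i : ℕ) (c : ι) (d : Bool)
  | cap (i : ℕ)
  | cross (i : ℕ) (s : Bool)
  | box (i : ℕ)

variable {ι κ : Type}

/-- The strands at some height of a diagram, from left to right, each with its component and with
`true` if it is oriented upwards. -/
abbrev Strands (ι : Type) : Type := List (ι × Bool)

/-- The strands above a move, or `none` if the move is impossible. -/
def step [DecidableEq ι] : Move ι → Strands ι → Option (Strands ι)
  | .cup i c d, l =>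
      if i ≤ l.length then some (l.take i ++ (c, d) :: (c, !d) :: l.drop i) else none
  | .cap i, l =>
      match l.drop i with
      | a :: b :: t => if a.1 = b.1 ∧ a.2 ≠ b.2 then some (l.take i ++ t) else none
      | _ => none
  | .cross i _, l =>
      match l.drop i with
      | a :: b :: t => some (l.take i ++ b :: a :: t)
      | _ => none
  | .box i, l => if i < l.length then some l else none

/-- The moves of a word, each with the strands below it. -/
def history [DecidableEq ι] : List (Move ι) → Strands ι → List (Move ι × Strands ι)
  | [], _ => []
  | m :: w, l => (m, l) :: history w ((step m l).getD [])

/-- The number of closed curves of a word (compare `circles`). -/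
def curves : List (Move ι) → List ℕ → ℕ → ℕ
  | [], _, _ => 0
  | .cup i _ _ :: w, l, k => curves w (l.take i ++ k :: k :: l.drop i) (k + 1)
  | .cap i :: w, l, k => (joinEnds i l).1 + curves w (joinEnds i l).2 k
  | .cross i _ :: w, l, k =>
      match l.drop i with
      | a :: b :: t => curves w (l.take i ++ b :: a :: t) k
      | _ => curves w l k
  | .box _ :: w, l, k => curves w l k

/-- The components of the marked strands. -/
def boxes [DecidableEq ι] (w : List (Move ι)) : List ι :=
  (history w []).filterMap fun x =>
    match x.1 with
    | .box i => (x.2[i]?).map Prod.fst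
    | _ => none

/-- A diagram of an oriented link in the three-sphere with components `ι`, framed by the
plane. Every component is one closed curve and has exactly one marked place. -/
structure LinkDiagram (ι : Type) [Fintype ι] [DecidableEq ι] where
  word : List (Move ι)
  closed : word.foldlM (fun l m => step m l) [] = some []
  marked : ∀ c, (boxes word).count c = 1
  curves_eq : curves word [] 0 = Fintype.card ι

/-- The number of strands if each strand of the component `c` is replaced by `n c` parallel
ones. -/
def width (n : ι → ℕ) (l : Strands ι) : ℕ := (l.map fun a => n a.1).sum

/-- A move, if the component `c` is labelled by `n c`, i.e. replaced by `n c` parallel strands with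
the idempotent inserted at the marked place. The second argument is the list of strands below. -/
def labelledMove (A : ℂ) (n : ι → ℕ) : Move ι → Strands ι → Skein
  | .cup i c _, l => cups (width n (l.take i)) (n c)
  | .cap i, l =>
      match l.drop i with
      | a :: _ => caps (width n (l.take i)) (n a.1)
      | _ => 1
  | .cross i s, l =>
      match l.drop i with
      | a :: b :: _ => crossings A (width n (l.take i)) (n a.1) (n b.1) s
      | _ => 1
  | .box i, l =>
      match l.drop i with
      | a :: _ => jonesWenzl A (n a.1) (width n (l.take i))
      | _ => 1

/-- The Kauffman bracket of the framed link with diagram `D` whose component `c` is labelled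
by `n c`. -/
def labelledBracket [Fintype ι] [DecidableEq ι] (A : ℂ) (D : LinkDiagram ι) (n : ι → ℕ) : ℂ :=
  bracket A ((history D.word []).map fun x => labelledMove A n x.1 x.2).prod

/-- The crossings of a diagram: the two components, and the sign. -/
def signedCrossings [Fintype ι] [DecidableEq ι] (D : LinkDiagram ι) : List (ι × ι × ℝ) :=
  (history D.word []).filterMap fun x =>
    match x.1 with
    | .cross i s =>
        match x.2.drop i with
        | a :: b :: _ => some (a.1, b.1, if s = (a.2 == b.2) then 1 else -1)
        | _ => none
    | _ => none

/-- The linking matrix of the sublink with components `ι`: linking numbers (half of the sum of the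
signs of the crossings between two components) off the diagonal, and framings (the sum of the signs
of the self-crossings) on the diagonal. -/
def linkingMatrix [Fintype ι] [DecidableEq ι] [Fintype κ] [DecidableEq κ]
    (D : LinkDiagram (ι ⊕ κ)) : Matrix ι ι ℝ :=
  Matrix.of fun a b => ((signedCrossings D).map fun x =>
    x.2.2 / 2 * ((if x.1 = .inl a ∧ x.2.1 = .inl b then 1 else 0) +
      (if x.1 = .inl b ∧ x.2.1 = .inl a then 1 else 0))).sum

/-- The number of positive eigenvalues of the linking matrix, with multiplicity. -/
def bPos [Fintype ι] [DecidableEq ι] [Fintype κ] [DecidableEq κ] (D : LinkDiagram (ι ⊕ κ)) : ℕ :=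
  (linkingMatrix D).charpoly.roots.countP fun x => 0 < x

/-- The number of negative eigenvalues of the linking matrix, with multiplicity. -/
def bNeg [Fintype ι] [DecidableEq ι] [Fintype κ] [DecidableEq κ] (D : LinkDiagram (ι ⊕ κ)) : ℕ :=
  (linkingMatrix D).charpoly.roots.countP fun x => x < 0

/-! ### The quantum invariant -/

/-- `A_r = exp(π i / r)`. -/
def rootA (r : ℕ) : ℂ := Complex.exp (Real.pi * Complex.I / r)

/-- The labels `0, …, ⌊(r - 3) / 2⌋` (for `r ≥ 3`). -/
def labels (r : ℕ) : Finset ℕ := Finset.range ((r - 3) / 2 + 1)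

/-- The value of the unknot (without twist) labelled by `Ω_r = ∑ Δ_i e_i`. -/
def omegaValue (r : ℕ) : ℂ := ∑ i ∈ labels r, delta (rootA r) i * delta (rootA r) i

/-- `I_r(M, K) = k^{3 (b₋ - b₊)} ⟨L(η Ω_r) ∪ K⟩`, where `D` is a diagram of `L ∪ K`, the components
`ι` form the framed link `L` that describes `M` by surgery, and the components `κ` form the
framed link `K` in `M`, labelled by `c`. -/
def quantumInvariant [Fintype ι] [DecidableEq ι] [Fintype κ] [DecidableEq κ]
    (r : ℕ) (η k : ℂ) (D : LinkDiagram (ι ⊕ κ)) (c : κ → ℕ) : ℂ :=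
  k ^ (3 * ((bNeg D : ℤ) - (bPos D : ℤ))) *
    ∑ n ∈ Fintype.piFinset fun _ : ι => labels r,
      (∏ a, η * delta (rootA r) (n a)) * labelledBracket (rootA r) D (Sum.elim n c)

/-! ### The quaternionic manifold

The surgery description of `S³ / Q₈` is the `(2, 4)` torus link with both framings `0`: the
component `0` is the closure of a 2-braid with one crossing, with an additional kink that makes its
framing `0`, and the component `1`, without twist, encircles the two strands of this braid. The
fundamental group of the surgered manifold is `⟨x, y | x² = y² = (x y)²⟩`. -/

/-- The surgery link of the quaternionic manifold `M`. -/
def quaternionic : LinkDiagram (Fin 2 ⊕ Fin 0) where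
  word :=
    [.cup 0 (.inl 0) true, .box 0, .cup 1 (.inl 0) true,
      .cross 0 false,
      .cup 1 (.inl 0) true, .cross 0 true, .cap 1,
      .cup 0 (.inl 1) false, .box 0,
      .cross 1 true, .cross 2 true, .cross 2 true, .cross 1 true, .cap 0,
      .cap 1, .cap 0]
  closed := by decide
  marked := by decide
  curves_eq := by decide

/-- The surgery link of `M` together with the loop of the graphs `(0, 0, c)`: an unknot without
twist, which is parallel to the closed 2-braid, does not cross it, and is encircled by the
component `1` together with the two strands of the braid. -/
def quaternionicLoop : LinkDiagram (Fin 2 ⊕ Fin 1) where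
  word :=
    [.cup 0 (.inl 0) true, .box 0, .cup 1 (.inl 0) true, .cup 2 (.inr 0) true, .box 2,
      .cross 0 false,
      .cup 1 (.inl 0) true, .cross 0 true, .cap 1,
      .cup 0 (.inl 1) false, .box 0,
      .cross 1 true, .cross 2 true, .cross 3 true,
      .cross 3 true, .cross 2 true, .cross 1 true, .cap 0,
      .cap 2, .cap 1, .cap 0]
  closed := by decide
  marked := by decide
  curves_eq := by decide

/-- `I_r(M)`. -/
def invM (r : ℕ) (η k : ℂ) : ℂ := quantumInvariant r η k quaternionic fun _ => 0

/-- `I_r(M, (0, 0, c))`. -/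
def invMLoop (r : ℕ) (η k : ℂ) (c : ℕ) : ℂ := quantumInvariant r η k quaternionicLoop fun _ => c

end KauffmanSkein

end

noncomputable section

namespace KauffmanSkein

open MulOpposite

/-! The computation takes place in `Planar A`, the algebra of crossingless diagrams modulo planar
isotopy, where infinitely many strands are imagined to the right, so that a diagram does not record
its number of strands. A closed diagram is a scalar there, namely its bracket
(`toPlanar_eq_bracket`), and the scalars are faithful because the algebra acts on functions of sign
sequences (`planarRelations_action`). Brackets can therefore be computed algebraically, from
naturality of band crossings, the trace property of closures, and the Jones–Wenzl idempotents.

Colour the two surgery components by `a` and `b`, and the loop by `n`. The diagram is a closure of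
`2a + n` strands encircled by colour `b` (`toPlanar_loopWord`). The kink contributes the scalar
`twistFactor A 0 a`. The two parallel bands of colour `a` are fused into the channels `2j`, `0 ≤ j ≤
a`, on which their crossing acts by `twistFactor A j (a - j)` (`exists_fusion`,
`bandCross_mul_vertex`). In channel `2j` there remains an unknot of colour `b` around parallel
unknots of colours `2j` and `n`, and fusing these two gives a sum of Hopf links, `hopfPair`. The
weights of the channels are never computed: they are `1` wherever the vertex is nonzero, and this is
checked only for the channels that survive.

At `A_r` the sum over `b`, weighted by `Δ_b`, annihilates every fused colour except `0` and `r - 2`,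
where `η²` normalizes it to `1` (`eta_sum_hopf`). With `r = 2h + 3`, the channel `2j` combined with
`n` contains such a colour only for `j = 0` if `n = 0`, for `j = h` (through the colour `r - 2`) if
`n = 1`, and for `j = 1` if `n = 2` (`eta_sum_hopfPair`). The linking matrix has eigenvalues `2` and
`-2`, so the signature correction is trivial. What remains is a single sum over `a` from `j` to `h`
of `Δ_a` times two twist factors (`invMLoop_eq_sum`).

For `n = 0` the summand is `Δ_a A^(2a² + 4a)`; the factor `1 - A⁴` splits it into two Gaussian
terms, and the reflection `j ↦ r - 1 - j` turns the two half sums into the full one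
(`mul_sum_delta`). For `n = 1` only `a = h` is left, and `A ^ r = -1` evaluates it. For `n = 2` the
summand times `A⁴` is the negative of that for `n = 0`, and the term `a = 0`, which equals `1`, is
missing. -/

/-- The value of a circle. -/
def loopValue (A : ℂ) : ℂ := -A ^ (-2 : ℤ) - A ^ 2

/-! ### Crossingless diagrams by generators and relations -/

section Presentation

variable {S : Type*} [Ring S] [Algebra ℂ S]

/-- The planar isotopies of crossingless diagrams with infinitely many strands to the right, and
the evaluation of circles, for given minima `u i` and maxima `v i`. -/
structure PlanarRelations (A : ℂ) (u v : ℕ → S) : Prop where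
  circle : ∀ i, u i * v i = loopValue A • 1
  zigzag_left : ∀ i, u i * v (i + 1) = 1
  zigzag_right : ∀ i, u (i + 1) * v i = 1
  cup_cup : ∀ i j, i ≤ j → u j * u i = u i * u (j + 2)
  cap_cap : ∀ i j, i ≤ j → v (j + 2) * v i = v i * v j
  cup_cap : ∀ i j, i ≤ j → u (j + 2) * v i = v i * u j
  cap_cup : ∀ i j, i ≤ j → u i * v (j + 2) = v j * u i

/-- The defining relations of `Planar`. -/
inductive PlanarRel (A : ℂ) : Skein → Skein → Prop
  | circle (i) : PlanarRel A (piece (.cup i) * piece (.cap i)) (loopValue A • 1)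
  | zigzag_left (i) : PlanarRel A (piece (.cup i) * piece (.cap (i + 1))) 1
  | zigzag_right (i) : PlanarRel A (piece (.cup (i + 1)) * piece (.cap i)) 1
  | cup_cup (i j) : i ≤ j → PlanarRel A (piece (.cup j) * piece (.cup i))
      (piece (.cup i) * piece (.cup (j + 2)))
  | cap_cap (i j) : i ≤ j → PlanarRel A (piece (.cap (j + 2)) * piece (.cap i))
      (piece (.cap i) * piece (.cap j))
  | cup_cap (i j) : i ≤ j → PlanarRel A (piece (.cup (j + 2)) * piece (.cap i))
      (piece (.cap i) * piece (.cup j))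
  | cap_cup (i j) : i ≤ j → PlanarRel A (piece (.cup i) * piece (.cap (j + 2)))
      (piece (.cap j) * piece (.cup i))

/-- The algebra of crossingless diagrams up to planar isotopy. -/
def Planar (A : ℂ) : Type := RingQuot (PlanarRel A)

instance (A : ℂ) : Ring (Planar A) := inferInstanceAs (Ring (RingQuot (PlanarRel A)))

instance (A : ℂ) : Algebra ℂ (Planar A) := inferInstanceAs (Algebra ℂ (RingQuot (PlanarRel A)))

/-- The class of a combination of diagrams. -/
def toPlanar (A : ℂ) : Skein →ₐ[ℂ] Planar A := RingQuot.mkAlgHom ℂ (PlanarRel A)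

/-- A local minimum. -/
def cup (A : ℂ) (i : ℕ) : Planar A := toPlanar A (piece (.cup i))

/-- A local maximum. -/
def cap (A : ℂ) (i : ℕ) : Planar A := toPlanar A (piece (.cap i))

theorem toPlanar_rel {A : ℂ} {x y : Skein} (h : PlanarRel A x y) :
    toPlanar A x = toPlanar A y := RingQuot.mkAlgHom_rel ℂ h

theorem planarRelations (A : ℂ) : PlanarRelations A (cup A) (cap A) where
  circle i := by simpa [cup, cap] using toPlanar_rel (PlanarRel.circle (A := A) i)
  zigzag_left i := by simpa [cup, cap] using toPlanar_rel (PlanarRel.zigzag_left (A := A) i)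
  zigzag_right i := by simpa [cup, cap] using toPlanar_rel (PlanarRel.zigzag_right (A := A) i)
  cup_cup i j h := by simpa [cup, cap] using toPlanar_rel (PlanarRel.cup_cup (A := A) i j h)
  cap_cap i j h := by simpa [cup, cap] using toPlanar_rel (PlanarRel.cap_cap (A := A) i j h)
  cup_cap i j h := by simpa [cup, cap] using toPlanar_rel (PlanarRel.cup_cap (A := A) i j h)
  cap_cup i j h := by simpa [cup, cap] using toPlanar_rel (PlanarRel.cap_cup (A := A) i j h)

/-- The homomorphism from the free algebra with given images of the pieces. -/
def skeinLift (u v : ℕ → S) : Skein →ₐ[ℂ] S :=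
  MonoidAlgebra.lift ℂ S (FreeMonoid Piece) (FreeMonoid.lift fun
    | .cup i => u i
    | .cap i => v i)

@[simp] theorem skeinLift_cup (u v : ℕ → S) (i : ℕ) : skeinLift u v (piece (.cup i)) = u i := by
  rw [skeinLift, piece, MonoidAlgebra.lift_of]; simp

@[simp] theorem skeinLift_cap (u v : ℕ → S) (i : ℕ) : skeinLift u v (piece (.cap i)) = v i := by
  rw [skeinLift, piece, MonoidAlgebra.lift_of]; simp

/-- The homomorphism given by elements that satisfy the planar relations. -/
def PlanarRelations.lift {A : ℂ} {u v : ℕ → S} (h : PlanarRelations A u v) : Planar A →ₐ[ℂ] S :=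
  RingQuot.liftAlgHom ℂ ⟨skeinLift u v, by
    intro x y hxy
    cases hxy with
    | circle i => simpa using h.circle i
    | zigzag_left i => simpa using h.zigzag_left i
    | zigzag_right i => simpa using h.zigzag_right i
    | cup_cup i j hij => simpa using h.cup_cup i j hij
    | cap_cap i j hij => simpa using h.cap_cap i j hij
    | cup_cap i j hij => simpa using h.cup_cap i j hij
    | cap_cup i j hij => simpa using h.cap_cup i j hij⟩

theorem PlanarRelations.lift_toPlanar {A : ℂ} {u v : ℕ → S} (h : PlanarRelations A u v)
    (x : Skein) : h.lift (toPlanar A x) = skeinLift u v x :=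
  RingQuot.liftAlgHom_mkAlgHom_apply ℂ _ _ _

@[simp] theorem PlanarRelations.lift_cup {A : ℂ} {u v : ℕ → S} (h : PlanarRelations A u v)
    (i : ℕ) : h.lift (cup A i) = u i := by rw [cup, h.lift_toPlanar, skeinLift_cup]

@[simp] theorem PlanarRelations.lift_cap {A : ℂ} {u v : ℕ → S} (h : PlanarRelations A u v)
    (i : ℕ) : h.lift (cap A i) = v i := by rw [cap, h.lift_toPlanar, skeinLift_cap]

end Presentation

variable {A : ℂ}

theorem Planar.induction {motive : Planar A → Prop} (x : Planar A)
    (one : motive 1) (cup : ∀ i, motive (cup A i)) (cap : ∀ i, motive (cap A i))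
    (smul : ∀ (a : ℂ) x, motive x → motive (a • x))
    (add : ∀ x y, motive x → motive y → motive (x + y))
    (mul : ∀ x y, motive x → motive y → motive (x * y)) : motive x := by
  obtain ⟨x, rfl⟩ : ∃ y, toPlanar A y = x := RingQuot.mkAlgHom_surjective ℂ _ x
  induction x using MonoidAlgebra.induction_on with
  | of w =>
    induction w using FreeMonoid.recOn with
    | one => rw [map_one, map_one]; exact one
    | of_mul p w ih =>
      rw [map_mul, map_mul]
      refine mul _ _ ?_ ih
      cases p with
      | cup i => exact cup i
      | cap i => exact cap i
  | add x y hx hy => rw [map_add]; exact add _ _ hx hy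
  | smul a x hx => rw [map_smul]; exact smul _ _ hx

/-! ### Translation and reflection of diagrams -/

/-- The shift of a diagram to the right by `k` positions. -/
def shift (k : ℕ) : Planar A →ₐ[ℂ] Planar A :=
  PlanarRelations.lift (A := A) (u := fun i => cup A (i + k)) (v := fun i => cap A (i + k))
    { circle := fun i => (planarRelations A).circle _
      zigzag_left := fun i => by simpa [add_right_comm] using (planarRelations A).zigzag_left (i + k)
      zigzag_right := fun i => by
        simpa [add_right_comm] using (planarRelations A).zigzag_right (i + k)
      cup_cup := fun i j h => by
        simpa [add_right_comm] using (planarRelations A).cup_cup (i + k) (j + k) (by omega)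
      cap_cap := fun i j h => by
        simpa [add_right_comm] using (planarRelations A).cap_cap (i + k) (j + k) (by omega)
      cup_cap := fun i j h => by
        simpa [add_right_comm] using (planarRelations A).cup_cap (i + k) (j + k) (by omega)
      cap_cup := fun i j h => by
        simpa [add_right_comm] using (planarRelations A).cap_cup (i + k) (j + k) (by omega) }

@[simp] theorem shift_cup (k i : ℕ) : shift k (cup A i) = cup A (i + k) :=
  PlanarRelations.lift_cup _ _

@[simp] theorem shift_cap (k i : ℕ) : shift k (cap A i) = cap A (i + k) :=
  PlanarRelations.lift_cap _ _

theorem shift_shift (k l : ℕ) (x : Planar A) : shift k (shift l x) = shift (l + k) x := by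
  induction x using Planar.induction with
  | one => simp
  | cup i => simp [add_assoc]
  | cap i => simp [add_assoc]
  | smul a x hx => simp [hx]
  | add x y hx hy => simp [hx, hy]
  | mul x y hx hy => simp [hx, hy]

@[simp] theorem shift_zero (x : Planar A) : shift 0 x = x := by
  induction x using Planar.induction with
  | one => simp
  | cup i => simp
  | cap i => simp
  | smul a x hx => simp [hx]
  | add x y hx hy => simp [hx, hy]
  | mul x y hx hy => simp [hx, hy]

/-- The reflection of diagrams in a horizontal line, as a homomorphism to the opposite algebra. -/
def flipHom : Planar A →ₐ[ℂ] (Planar A)ᵐᵒᵖ :=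
  PlanarRelations.lift (A := A) (u := fun i => op (cap A i)) (v := fun i => op (cup A i))
    { circle := fun i => by rw [← op_mul, (planarRelations A).circle]; rfl
      zigzag_left := fun i => by rw [← op_mul, (planarRelations A).zigzag_right]; rfl
      zigzag_right := fun i => by rw [← op_mul, (planarRelations A).zigzag_left]; rfl
      cup_cup := fun i j h => by
        rw [← op_mul, ← op_mul, (planarRelations A).cap_cap _ _ h]
      cap_cap := fun i j h => by
        rw [← op_mul, ← op_mul, (planarRelations A).cup_cup _ _ h]
      cup_cap := fun i j h => by
        rw [← op_mul, ← op_mul, (planarRelations A).cap_cup _ _ h]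
      cap_cup := fun i j h => by
        rw [← op_mul, ← op_mul, (planarRelations A).cup_cap _ _ h] }

/-- The reflection of diagrams in a horizontal line. -/
def flip (x : Planar A) : Planar A := unop (flipHom x)

@[simp] theorem flip_cup (i : ℕ) : flip (cup A i) = cap A i := by simp [flip, flipHom]
@[simp] theorem flip_cap (i : ℕ) : flip (cap A i) = cup A i := by simp [flip, flipHom]
@[simp] theorem flip_one : flip (1 : Planar A) = 1 := by simp [flip]
@[simp] theorem flip_zero : flip (0 : Planar A) = 0 := by simp [flip]
@[simp] theorem flip_add (x y : Planar A) : flip (x + y) = flip x + flip y := by simp [flip]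
@[simp] theorem flip_sub (x y : Planar A) : flip (x - y) = flip x - flip y := by simp [flip]
@[simp] theorem flip_smul (a : ℂ) (x : Planar A) : flip (a • x) = a • flip x := by simp [flip]
@[simp] theorem flip_mul (x y : Planar A) : flip (x * y) = flip y * flip x := by simp [flip]

@[simp] theorem flip_shift (k : ℕ) (x : Planar A) : flip (shift k x) = shift k (flip x) := by
  induction x using Planar.induction with
  | one => simp
  | cup i => simp
  | cap i => simp
  | smul a x hx => simp [hx]
  | add x y hx hy => simp [hx, hy]
  | mul x y hx hy => simp [hx, hy]

@[simp] theorem flip_flip (x : Planar A) : flip (flip x) = x := by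
  induction x using Planar.induction with
  | one => simp
  | cup i => simp
  | cap i => simp
  | smul a x hx => simp [hx]
  | add x y hx hy => simp [hx, hy]
  | mul x y hx hy => simp [hx, hy]

/-! ### Morphisms -/

section Hom

variable {S : Type*} [Ring S] {u v : ℕ → S}

/-- Words in the minima `u i` and the maxima `v i` that lead from `m` to `n` strands. -/
inductive Word (u v : ℕ → S) : ℕ → ℕ → S → Prop
  | nil (m : ℕ) : Word u v m m 1
  | cup {m n i : ℕ} {x : S} : i ≤ m → Word u v (m + 2) n x → Word u v m n (u i * x)
  | cap {m n i : ℕ} {x : S} : i ≤ m → Word u v m n x → Word u v (m + 2) n (v i * x)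

theorem word_mul {l m n : ℕ} {x y : S} (hx : Word u v l m x) (hy : Word u v m n y) :
    Word u v l n (x * y) := by
  induction hx with
  | nil => simpa
  | cup h _ ih => rw [mul_assoc]; exact .cup h (ih hy)
  | cap h _ ih => rw [mul_assoc]; exact .cap h (ih hy)

/-- Positions are counted from the left, so adding idle strands on the right changes the numbers of
ends but not the element. -/
theorem word_mono {m n : ℕ} (k : ℕ) {x : S} (h : Word u v m n x) :
    Word u v (m + k) (n + k) x := by
  induction h with
  | nil => exact .nil _
  | cup h _ ih => exact .cup (by omega) (by rwa [add_right_comm])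
  | cap h _ ih => rw [add_right_comm]; exact .cap (by omega) ih

variable [Algebra ℂ S]

/-- The combinations of words from `m` to `n` strands. -/
def HomOf (u v : ℕ → S) (m n : ℕ) : Submodule ℂ S := Submodule.span ℂ {x | Word u v m n x}

theorem word_mem {m n : ℕ} {x : S} (h : Word u v m n x) : x ∈ HomOf u v m n :=
  Submodule.subset_span h

theorem hom_one (m : ℕ) : (1 : S) ∈ HomOf u v m m := word_mem (Word.nil m)

theorem hom_mul {l m n : ℕ} {x y : S} (hx : x ∈ HomOf u v l m) (hy : y ∈ HomOf u v m n) :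
    x * y ∈ HomOf u v l n := by
  have h : HomOf u v l m * HomOf u v m n ≤ HomOf u v l n := by
    rw [HomOf, HomOf, Submodule.span_mul_span, Submodule.span_le]
    rintro _ ⟨x, hx, y, hy, rfl⟩
    exact word_mem (word_mul hx hy)
  exact h (Submodule.mul_mem_mul hx hy)

theorem hom_cup {i m : ℕ} (h : i ≤ m) : u i ∈ HomOf u v m (m + 2) := by
  simpa using word_mem (Word.cup (v := v) h (.nil _))

theorem hom_cap {i m : ℕ} (h : i ≤ m) : v i ∈ HomOf u v (m + 2) m := by
  simpa using word_mem (Word.cap (u := u) h (.nil _))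

theorem hom_hook {i m : ℕ} (h : i + 2 ≤ m) : v i * u i ∈ HomOf u v m m := by
  obtain ⟨m, rfl⟩ : ∃ l, m = l + 2 := ⟨m - 2, by omega⟩
  exact hom_mul (hom_cap (by omega)) (hom_cup (by omega))

theorem hom_mono {m n : ℕ} (k : ℕ) : HomOf u v m n ≤ HomOf u v (m + k) (n + k) :=
  Submodule.span_mono fun _ h => word_mono k h

end Hom

/-- The combinations of diagrams from `m` to `n` strands, up to planar isotopy. -/
abbrev Hom (A : ℂ) (m n : ℕ) : Submodule ℂ (Planar A) := HomOf (cup A) (cap A) m n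

/-- The combinations of diagrams from `m` to `n` strands. -/
abbrev SkeinHom (m n : ℕ) : Submodule ℂ Skein :=
  HomOf (fun i => piece (.cup i)) (fun i => piece (.cap i)) m n

theorem toPlanar_mem {m n : ℕ} {x : Skein} (h : x ∈ SkeinHom m n) :
    toPlanar A x ∈ Hom A m n := by
  have : SkeinHom m n ≤ (Hom A m n).comap (toPlanar A).toLinearMap := by
    clear h
    refine Submodule.span_le.2 fun x hx => ?_
    show toPlanar A x ∈ Hom A m n
    apply word_mem
    induction hx with
    | nil m => rw [map_one]; exact .nil m
    | cup h _ ih => rw [map_mul]; exact .cup h ih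
    | cap h _ ih => rw [map_mul]; exact .cap h ih
  exact this h

theorem word_shift {m n : ℕ} (k : ℕ) {x : Planar A} (h : Word (cup A) (cap A) m n x) :
    Word (cup A) (cap A) (k + m) (k + n) (shift k x) := by
  induction h with
  | nil => rw [map_one]; exact .nil _
  | cup h _ ih => rw [map_mul, shift_cup]; exact .cup (by rw [add_comm]; exact Nat.add_le_add_left h k) ih
  | cap h _ ih => rw [map_mul, shift_cap]; exact .cap (by rw [add_comm]; exact Nat.add_le_add_left h k) ih

theorem shift_mem {m n : ℕ} (k : ℕ) {x : Planar A} (h : x ∈ Hom A m n) :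
    shift k x ∈ Hom A (k + m) (k + n) := by
  have : Hom A m n ≤ (Hom A (k + m) (k + n)).comap (shift k).toLinearMap :=
    Submodule.span_le.2 fun x hx => word_mem (word_shift k hx)
  exact this h

theorem flip_mem {m n : ℕ} {x : Planar A} (h : x ∈ Hom A m n) : flip x ∈ Hom A n m := by
  induction h using Submodule.span_induction with
  | mem x hx =>
    induction hx with
    | nil m => rw [flip_one]; exact hom_one m
    | cup h _ ih => rw [flip_mul, flip_cup]; exact hom_mul ih (hom_cap h)
    | cap h _ ih => rw [flip_mul, flip_cap]; exact hom_mul ih (hom_cup h)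
  | zero => rw [flip_zero]; exact zero_mem _
  | add x y _ _ hx hy => rw [flip_add]; exact add_mem hx hy
  | smul a x _ hx => rw [flip_smul]; exact Submodule.smul_mem _ _ hx

/-- On generators these are the relations between distant pieces. The extra shift by `2` accounts
for the two strands that the minimum inserts to the left of `x`. -/
theorem cup_mul_shift {i k : ℕ} (h : i ≤ k) (x : Planar A) :
    cup A i * shift (k + 2) x = shift k x * cup A i := by
  induction x using Planar.induction with
  | one => simp
  | cup j => simpa [← add_assoc] using ((planarRelations A).cup_cup i (j + k) (by omega)).symm
  | cap j => simpa [← add_assoc] using (planarRelations A).cap_cup i (j + k) (by omega)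
  | smul a x hx => simp [hx]
  | add x y hx hy => simp [hx, hy, mul_add, add_mul]
  | mul x y hx hy => rw [map_mul, map_mul, ← mul_assoc, hx, mul_assoc, hy, mul_assoc]

theorem cap_mul_shift {i k : ℕ} (h : i ≤ k) (x : Planar A) :
    cap A i * shift k x = shift (k + 2) x * cap A i := by
  have := congrArg flip (cup_mul_shift h (flip x))
  simpa using this.symm

/-- A diagram commutes with the diagrams to its right. -/
theorem mul_shift {m n : ℕ} {x : Planar A} (h : x ∈ Hom A m n) (y : Planar A) :
    x * shift n y = shift m y * x := by
  induction h using Submodule.span_induction with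
  | mem x hx =>
    induction hx with
    | nil => simp
    | cup h _ ih => rw [mul_assoc, ih, ← mul_assoc, cup_mul_shift h, mul_assoc]
    | cap h _ ih => rw [mul_assoc, ih, ← mul_assoc, cap_mul_shift h, mul_assoc]
  | zero => simp
  | add x y _ _ hx hy => rw [add_mul, mul_add, hx, hy]
  | smul a x _ hx => rw [smul_mul_assoc, mul_smul_comm, hx]

/-! ### The bracket as a scalar of the algebra of planar diagrams -/

theorem joinEnds_append (p t : List ℕ) (a b : ℕ) :
    joinEnds p.length (p ++ a :: b :: t) =
      if a = b then (1, p ++ t) else (0, (p ++ t).map fun x => if x = b then a else x) := by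
  simp [joinEnds]

/-- The partial diagram `x` joins its upper ends as recorded by `l`. -/
inductive Joins : List ℕ → Planar A → Prop
  | nil : Joins [] 1
  | insert {p q : List ℕ} {x : Planar A} {k : ℕ} : Joins (p ++ q) x → k ∉ p ++ q →
      Joins (p ++ k :: k :: q) (x * cup A p.length)
  | rename {l : List ℕ} {x : Planar A} (f : ℕ → ℕ) : Joins l x → Set.InjOn f {a | a ∈ l} →
      Joins (l.map f) x

theorem Joins.eq_one {l : List ℕ} {x : Planar A} (h : Joins l x) (hl : l = []) : x = 1 := by
  induction h with
  | nil => rfl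
  | insert => simp at hl
  | rename f _ _ ih => exact ih (by simpa using hl)

theorem List.exists_append_cons_cons {l : List ℕ} {i : ℕ} (h : i + 2 ≤ l.length) :
    ∃ p a b t, l = p ++ a :: b :: t ∧ p.length = i := by
  have h1 : i < l.length := by omega
  have h2 : i + 1 < l.length := by omega
  refine ⟨l.take i, l[i], l[i + 1], l.drop (i + 2), ?_, by simp; omega⟩
  rw [← List.drop_eq_getElem_cons h2, ← List.drop_eq_getElem_cons h1, List.take_append_drop]

/-- Compare the new maximum with the last minimum of `x`. If they are disjoint, they commute and the
induction continues; if they share one strand, a zigzag is straightened; if they share both, a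
circle is split off. The constructor `rename` is needed because joining two arcs merges their
numbers. -/
theorem Joins.cap {l : List ℕ} {x : Planar A} (h : Joins l x) :
    ∀ i, i + 2 ≤ l.length → ∃ y : Planar A, Joins (joinEnds i l).2 y ∧
      x * cap A i = loopValue A ^ (joinEnds i l).1 • y := by
  have R := planarRelations A
  induction h with
  | nil => intro i hi; simp at hi
  | @insert p q x k hx hk ih =>
    intro i hi
    simp only [List.mem_append, not_or] at hk
    obtain hij | hij | rfl | rfl | hij : i + 2 ≤ p.length ∨ p.length = i + 1 ∨ i = p.length ∨
      i = p.length + 1 ∨ p.length + 2 ≤ i := by omega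
    · obtain ⟨p₁, a, b, t, rfl, rfl⟩ := List.exists_append_cons_cons hij
      obtain ⟨y, hy, hxy⟩ := ih p₁.length (by simp)
      have hc := R.cup_cap p₁.length (p₁.length + t.length) (by omega)
      have e : (p₁ ++ a :: b :: t).length = p₁.length + t.length + 2 := by simp; omega
      have e1 : p₁ ++ a :: b :: t ++ q = p₁ ++ a :: b :: (t ++ q) := by simp
      have e2 : p₁ ++ a :: b :: t ++ k :: k :: q = p₁ ++ a :: b :: (t ++ k :: k :: q) := by simp
      rw [e1, joinEnds_append] at hy hxy
      refine ⟨y * cup A (p₁.length + t.length), ?_, ?_⟩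
      · rw [e2, joinEnds_append]
        simp only [List.mem_append, List.mem_cons, not_or] at hk
        split_ifs with hab
        · rw [if_pos hab] at hy
          have := Joins.insert (p := p₁ ++ t) (q := q) (k := k) (by simpa using hy) (by simp; tauto)
          simpa using this
        · rw [if_neg hab] at hy
          have := Joins.insert (p := (p₁ ++ t).map fun x => if x = b then a else x)
            (q := q.map fun x => if x = b then a else x) (k := k) (by simpa using hy) (by
              simp only [List.mem_append, List.mem_map, not_or, not_exists]
              refine ⟨?_, ?_⟩ <;> rintro z ⟨hz, hz'⟩ <;> split_ifs at hz' <;> subst hz' <;> tauto)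
          simpa [if_neg hk.1.2.2.1] using this
      · rw [e2, e, mul_assoc, hc, ← mul_assoc, hxy, smul_mul_assoc, joinEnds_append]
        split_ifs <;> rfl
    · obtain ⟨p, a, rfl⟩ : ∃ p' a, p = p' ++ [a] :=
        ⟨p.dropLast, p.getLast (by rintro rfl; simp at hij), by rw [List.dropLast_append_getLast]⟩
      have hi : p.length = i := by simp at hij; omega
      subst hi
      have hc := R.zigzag_right p.length
      refine ⟨x, ?_, ?_⟩
      · rw [show p ++ [a] ++ k :: k :: q = p ++ a :: k :: (k :: q) by simp, joinEnds_append]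
        simp only [List.mem_append, List.mem_cons, not_or] at hk
        rw [if_neg (by tauto)]
        have h1 : ∀ s : List ℕ, k ∉ s → (s.map fun x => if x = k then a else x) = s := by
          intro s hs
          conv_rhs => rw [← List.map_id s]
          refine List.map_congr_left fun z hz => ?_
          rw [if_neg (by rintro rfl; exact hs hz)]; rfl
        simpa [h1 p hk.1.1, h1 q hk.2] using hx
      · rw [show p ++ [a] ++ k :: k :: q = p ++ a :: k :: (k :: q) by simp, joinEnds_append]
        simp only [List.mem_append, List.mem_cons, not_or] at hk
        rw [if_neg (by tauto), mul_assoc, List.length_append, List.length_singleton, hc]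
        simp
    · refine ⟨x, ?_, ?_⟩ <;> rw [joinEnds_append, if_pos rfl]
      · exact hx
      · rw [mul_assoc, R.circle]; simp
    · obtain ⟨b, t, rfl⟩ : ∃ b t, q = b :: t := by
        cases q with
        | nil => simp at hi
        | cons b t => exact ⟨b, t, rfl⟩
      simp only [List.mem_cons, not_or] at hk
      have e : joinEnds (p.length + 1) (p ++ k :: k :: b :: t) =
          (0, (p ++ b :: t).map fun x => if x = b then k else x) := by
        rw [show p ++ k :: k :: b :: t = (p ++ [k]) ++ k :: b :: t by simp,
          show p.length + 1 = (p ++ [k]).length by simp, joinEnds_append, if_neg hk.2.1]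
        simp
      refine ⟨x, ?_, ?_⟩ <;> rw [e]
      · refine Joins.rename _ hx ?_
        intro y hy z hz hyz
        simp only [Set.mem_ofPred_eq, List.mem_append, List.mem_cons] at hy hz
        simp only at hyz
        split_ifs at hyz with h1 h2 h2
        · rw [h1, h2]
        · subst hyz; tauto
        · subst hyz; tauto
        · exact hyz
      · rw [mul_assoc, R.zigzag_left]; simp
    · have hq : (i - (p.length + 2)) + 2 ≤ q.length := by simp at hi; omega
      obtain ⟨q, a, b, t, rfl, hq'⟩ := List.exists_append_cons_cons hq
      obtain ⟨y, hy, hxy⟩ := ih (p ++ q).length (by simp; omega)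
      obtain rfl : i = p.length + q.length + 2 := by omega
      have hc := R.cap_cup p.length (p.length + q.length) (by omega)
      have e1 : p ++ (q ++ a :: b :: t) = (p ++ q) ++ a :: b :: t := by simp
      have e2 : joinEnds (p.length + q.length + 2) (p ++ k :: k :: (q ++ a :: b :: t)) =
          joinEnds (p ++ k :: k :: q).length ((p ++ k :: k :: q) ++ a :: b :: t) := by
        congr 1
        · simp; omega
        · simp
      rw [e1, joinEnds_append] at hy hxy
      refine ⟨y * cup A p.length, ?_, ?_⟩
      · rw [e2, joinEnds_append]
        simp only [List.mem_append, List.mem_cons, not_or] at hk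
        split_ifs with hab
        · rw [if_pos hab] at hy
          have := Joins.insert (p := p) (q := q ++ t) (k := k) (by simpa using hy) (by simp; tauto)
          simpa using this
        · rw [if_neg hab] at hy
          have := Joins.insert (p := p.map fun x => if x = b then a else x)
            (q := (q ++ t).map fun x => if x = b then a else x) (k := k) (by simpa using hy) (by
              simp only [List.mem_append, List.mem_map, not_or, not_exists]
              refine ⟨?_, ?_⟩ <;> rintro z ⟨hz, hz'⟩ <;> split_ifs at hz' <;> subst hz' <;> tauto)
          simpa [if_neg hk.2.2.2.1] using this
      · rw [e2, joinEnds_append, mul_assoc, hc, ← mul_assoc, ← List.length_append, hxy,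
          smul_mul_assoc]
        split_ifs <;> rfl
  | @rename l x f hx hf ih =>
    intro i hi
    rw [List.length_map] at hi
    obtain ⟨y, hy, hxy⟩ := ih i hi
    obtain ⟨p, a, b, t, rfl, rfl⟩ := List.exists_append_cons_cons hi
    have e : joinEnds p.length ((p ++ a :: b :: t).map f) =
        if f a = f b then (1, (p ++ t).map f)
          else (0, ((p ++ t).map f).map fun x => if x = f b then f a else x) := by
      rw [List.map_append, List.map_cons, List.map_cons, List.map_append, ← joinEnds_append,
        List.length_map]
    have hab : f a = f b ↔ a = b := hf.eq_iff (by simp) (by simp)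
    rw [joinEnds_append] at hy hxy
    rw [e]
    by_cases h : a = b
    · rw [if_pos h] at hy hxy
      rw [if_pos (hab.2 h)]
      exact ⟨y, hy.rename f (hf.mono fun z hz => by simp at hz ⊢; tauto), hxy⟩
    · rw [if_neg h] at hy hxy
      rw [if_neg (mt hab.1 h)]
      refine ⟨y, ?_, hxy⟩
      convert hy.rename f (hf.mono fun z hz => ?_) using 1
      · simp only [List.map_map]
        refine List.map_congr_left fun z hz => ?_
        have : f z = f b ↔ z = b :=
          hf.eq_iff (by simp at hz ⊢; tauto) (by simp)
        simp only [Function.comp, this]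
        split_ifs <;> rfl
      · simp only [List.mem_map, Set.mem_ofPred_eq] at hz
        obtain ⟨w, hw, rfl⟩ := hz
        simp only [Set.mem_ofPred_eq]
        split_ifs
        · simp
        · simp at hw ⊢; tauto

theorem joinEnds_lt {p t : List ℕ} {a b k : ℕ} (h : ∀ x ∈ p ++ a :: b :: t, x < k) :
    ∀ x ∈ (joinEnds p.length (p ++ a :: b :: t)).2, x < k := by
  intro x hx
  rw [joinEnds_append] at hx
  split_ifs at hx
  · exact h x (by simp at hx ⊢; tauto)
  · simp only [List.mem_map] at hx
    obtain ⟨y, hy, rfl⟩ := hx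
    split_ifs
    · exact h a (by simp)
    · exact h y (by simp at hy ⊢; tauto)

theorem length_joinEnds (p t : List ℕ) (a b : ℕ) :
    (joinEnds p.length (p ++ a :: b :: t)).2.length = p.length + t.length := by
  rw [joinEnds_append]; split_ifs <;> simp

/-- The function `circles` consumes a word from the bottom, so the induction has to allow an
arbitrary partial diagram `y` below the word. The bound by `k` guarantees that the number given to
the next minimum is fresh. -/
theorem Word.toPlanar_eq {m n : ℕ} {x : Skein}
    (h : Word (fun i => piece (.cup i)) (fun i => piece (.cap i)) m n x) (hn : n = 0) :
    ∃ w, x = MonoidAlgebra.of ℂ (FreeMonoid Piece) w ∧ ∀ (l : List ℕ) (k : ℕ) (y : Planar A),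
      Joins l y → l.length = m → (∀ a ∈ l, a < k) →
        y * toPlanar A x = loopValue A ^ circles w.toList l k • 1 := by
  induction h with
  | nil m =>
    refine ⟨1, by rw [map_one], fun l k y hy hl _ => ?_⟩
    rw [hy.eq_one (by rw [← List.length_eq_zero_iff, hl, hn])]
    simp [circles]
  | @cup m n i x hi _ ih =>
    obtain ⟨w, rfl, hw⟩ := ih hn
    refine ⟨FreeMonoid.of (.cup i) * w, by rw [map_mul]; rfl, fun l k y hy hl hk => ?_⟩
    have hlen : (l.take i).length = i := by simp; omega
    have := hw (l.take i ++ k :: k :: l.drop i) (k + 1) (y * KauffmanSkein.cup A i) (by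
        have := Joins.insert (A := A) (p := l.take i) (q := l.drop i) (k := k) (x := y)
          (by rwa [List.take_append_drop])
          (by rw [List.take_append_drop]; exact fun h => (hk _ h).ne rfl)
        rwa [hlen] at this)
      (by simp; omega) (by
        intro a ha
        simp only [List.mem_append, List.mem_cons] at ha
        rcases ha with ha | rfl | rfl | ha
        · exact (hk _ (List.mem_of_mem_take ha)).trans (by omega)
        · omega
        · omega
        · exact (hk _ (List.mem_of_mem_drop ha)).trans (by omega))
    rw [map_mul, ← mul_assoc, ← KauffmanSkein.cup, this]
    simp [circles]
  | @cap m n i x hi _ ih =>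
    obtain ⟨w, rfl, hw⟩ := ih hn
    refine ⟨FreeMonoid.of (.cap i) * w, by rw [map_mul]; rfl, fun l k y hy hl hk => ?_⟩
    obtain ⟨z, hz, hyz⟩ := hy.cap i (by omega)
    have hil : i + 2 ≤ l.length := by omega
    obtain ⟨p, a, b, t, rfl, rfl⟩ := List.exists_append_cons_cons hil
    have := hw _ k z hz (by rw [length_joinEnds]; simp at hl; omega) (joinEnds_lt hk)
    rw [map_mul, ← mul_assoc, ← KauffmanSkein.cap, hyz, smul_mul_assoc, this, smul_smul, ← pow_add]
    simp [circles]

theorem bracket_of (w : FreeMonoid Piece) :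
    bracket A (MonoidAlgebra.of ℂ (FreeMonoid Piece) w) =
      loopValue A ^ circles w.toList [] 0 := by
  rw [bracket, MonoidAlgebra.of_apply, MonoidAlgebra.coeff_single, Finsupp.sum_single_index (by simp), one_mul]; rfl

theorem bracket_add (x y : Skein) : bracket A (x + y) = bracket A x + bracket A y :=
  Finsupp.sum_add_index' (by simp) (by simp [add_mul])

theorem bracket_smul (a : ℂ) (x : Skein) : bracket A (a • x) = a * bracket A x := by
  rw [bracket, bracket, MonoidAlgebra.coeff_smul, Finsupp.sum_smul_index (by simp), Finsupp.mul_sum]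
  simp only [mul_assoc]

/-- This is what makes the combinatorial bracket accessible: from here on closed diagrams are
manipulated by planar relations only. -/
theorem toPlanar_eq_bracket {x : Skein} (h : x ∈ SkeinHom 0 0) :
    toPlanar A x = bracket A x • 1 := by
  induction h using Submodule.span_induction with
  | mem x hx =>
    obtain ⟨w, rfl, hw⟩ := Word.toPlanar_eq (A := A) hx rfl
    rw [bracket_of, ← hw [] 0 1 .nil rfl (by simp), one_mul]
  | zero => simp [bracket]
  | add x y _ _ hx hy => rw [map_add, hx, hy, bracket_add, add_smul]
  | smul a x _ hx => rw [map_smul, hx, bracket_smul, mul_smul]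

/-! ### The algebra is not trivial -/

/-- The sequence `s` with `x`, `y` inserted at the positions `i`, `i + 1`. -/
def insertPair (i : ℕ) (x y : Bool) (s : ℕ → Bool) : ℕ → Bool := fun j =>
  if j < i then s j else if j = i then x else if j = i + 1 then y else s (j - 2)

/-- The sequence `s` without the entries at the positions `i`, `i + 1`. -/
def deletePair (i : ℕ) (s : ℕ → Bool) : ℕ → Bool := fun j => if j < i then s j else s (j + 2)

/-- The bilinear form of the fundamental representation of quantum `sl₂`. -/
def pairing (A : ℂ) : Bool → Bool → ℂ
  | false, true => Complex.I * A
  | true, false => -(Complex.I * A⁻¹)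
  | _, _ => 0

/-- The action of a minimum on the functions of sequences of signs. -/
def cupAction (A : ℂ) (i : ℕ) : Module.End ℂ ((ℕ → Bool) → ℂ) where
  toFun φ s := ∑ x, ∑ y, pairing A x y * φ (insertPair i x y s)
  map_add' φ ψ := by
    funext s
    simp only [Pi.add_apply, mul_add, Finset.sum_add_distrib]
  map_smul' a φ := by
    funext s
    simp only [Pi.smul_apply, smul_eq_mul, Finset.mul_sum, RingHom.id_apply]
    exact Finset.sum_congr rfl fun _ _ => Finset.sum_congr rfl fun _ _ => by ring

/-- The action of a maximum on the functions of sequences of signs. -/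
def capAction (A : ℂ) (i : ℕ) : Module.End ℂ ((ℕ → Bool) → ℂ) where
  toFun φ s := pairing A (s i) (s (i + 1)) * φ (deletePair i s)
  map_add' φ ψ := by funext s; simp [mul_add]
  map_smul' a φ := by funext s; simp; ring

theorem cupAction_apply (i : ℕ) (φ : (ℕ → Bool) → ℂ) (s : ℕ → Bool) :
    cupAction A i φ s = ∑ x, ∑ y, pairing A x y * φ (insertPair i x y s) := rfl

theorem capAction_apply (i : ℕ) (φ : (ℕ → Bool) → ℂ) (s : ℕ → Bool) :
    capAction A i φ s = pairing A (s i) (s (i + 1)) * φ (deletePair i s) := rfl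

/-- The `2 × 2` matrix of `pairing` squares to the identity, because `(I A) * (-(I A⁻¹)) = 1`. -/
theorem pairing_zigzag (hA : A ≠ 0) (x z : Bool) (φ : Bool → ℂ) :
    ∑ y, pairing A x y * (pairing A y z * φ x) = if x = z then φ z else 0 := by
  have hI := Complex.I_mul_I
  cases x <;> cases z <;> simp [pairing] <;> field_simp <;> simp

/-- Circles have the right value because the squares of the entries of `pairing` add up to `-A² -
A⁻²`; zigzags straighten because its matrix is an involution; the other relations only compare
insertions and deletions at distant positions of a sequence. -/
theorem planarRelations_action (hA : A ≠ 0) :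
    PlanarRelations A (cupAction A) (capAction A) where
  circle i := by
    ext φ s
    have h : ∀ x y, deletePair i (insertPair i x y s) = s := by
      intro x y; funext j; simp only [deletePair, insertPair]
      split_ifs <;> first | rfl | omega
    have h1 : ∀ x y, insertPair i x y s i = x := by intro x y; simp [insertPair]
    have h2 : ∀ x y, insertPair i x y s (i + 1) = y := by intro x y; simp [insertPair]
    simp [cupAction_apply, capAction_apply, h, h1, h2, pairing, loopValue]
    have := Complex.I_mul_I
    field_simp
    simp only [Complex.I_sq]
    ring
  zigzag_left i := by
    ext φ s
    have h : ∀ x y, deletePair (i + 1) (insertPair i x y s) = Function.update s i x := by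
      intro x y; funext j; simp only [deletePair, insertPair, Function.update_apply]
      split_ifs <;> first | rfl | omega
    have h1 : ∀ x y, insertPair i x y s (i + 1) = y := by intro x y; simp [insertPair]
    have h2 : ∀ x y, insertPair i x y s (i + 1 + 1) = s i := by
      intro x y; simp only [insertPair]
      rw [if_neg (by omega), if_neg (by omega), if_neg (by omega)]; rfl
    simp only [Module.End.mul_apply, cupAction_apply, capAction_apply,
      h, h1, h2, Module.End.one_apply]
    simp only [pairing_zigzag hA _ (s i) fun x => φ (Function.update s i x)]
    simp
  zigzag_right i := by
    ext φ s
    have h : ∀ x y, deletePair i (insertPair (i + 1) x y s) = Function.update s i y := by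
      intro x y; funext j; simp only [deletePair, insertPair, Function.update_apply]
      split_ifs <;> first | rfl | (congr 1; omega)
    have h1 : ∀ x y, insertPair (i + 1) x y s i = s i := by intro x y; simp [insertPair]
    have h2 : ∀ x y, insertPair (i + 1) x y s (i + 1) = x := by intro x y; simp [insertPair]
    simp only [Module.End.mul_apply, cupAction_apply, capAction_apply,
      h, h1, h2, Module.End.one_apply]
    have h3 : s = Function.update s i (s i) := by simp
    have hI := Complex.I_mul_I
    rcases h4 : s i with _ | _ <;> rw [h4] at h3 <;> simp [pairing, ← h3] <;> field_simp <;> simp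
  cup_cup i j hij := by
    ext φ s
    have h : ∀ x y z w, insertPair i z w (insertPair j x y s) =
        insertPair (j + 2) x y (insertPair i z w s) := by
      intro x y z w; funext l; simp only [insertPair]
      split_ifs <;> first | rfl | (congr 1; omega)
    simp only [Module.End.mul_apply, cupAction_apply, h, Fintype.sum_bool]
    ring
  cap_cap i j hij := by
    ext φ s
    have h : deletePair i (deletePair (j + 2) s) = deletePair j (deletePair i s) := by
      funext l; simp only [deletePair]
      split_ifs <;> first | rfl | (congr 1; omega)
    have h1 : deletePair (j + 2) s i = s i := by simp only [deletePair]; rw [if_pos (by omega)]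
    have h2 : deletePair (j + 2) s (i + 1) = s (i + 1) := by
      simp only [deletePair]; rw [if_pos (by omega)]
    have h3 : deletePair i s j = s (j + 2) := by simp only [deletePair]; rw [if_neg (by omega)]
    have h4 : deletePair i s (j + 1) = s (j + 2 + 1) := by
      simp only [deletePair]; rw [if_neg (by omega)]
    simp only [Module.End.mul_apply, capAction_apply, h, h1, h2, h3, h4]
    ring
  cup_cap i j hij := by
    ext φ s
    have h : ∀ x y, deletePair i (insertPair (j + 2) x y s) = insertPair j x y (deletePair i s) := by
      intro x y; funext l; simp only [deletePair, insertPair]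
      split_ifs <;> first | rfl | (congr 1; omega)
    have h1 : ∀ x y, insertPair (j + 2) x y s i = s i := by
      intro x y; simp only [insertPair]; rw [if_pos (by omega)]
    have h2 : ∀ x y, insertPair (j + 2) x y s (i + 1) = s (i + 1) := by
      intro x y; simp only [insertPair]; rw [if_pos (by omega)]
    simp only [Module.End.mul_apply, cupAction_apply, capAction_apply, h, h1,
      h2, Fintype.sum_bool]
    ring
  cap_cup i j hij := by
    ext φ s
    have h : ∀ x y, deletePair (j + 2) (insertPair i x y s) = insertPair i x y (deletePair j s) := by
      intro x y; funext l; simp only [deletePair, insertPair]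
      split_ifs <;> first | rfl | (congr 1; omega)
    have h1 : ∀ x y, insertPair i x y s (j + 2) = s j := by
      intro x y; simp only [insertPair]
      rw [if_neg (by omega), if_neg (by omega), if_neg (by omega)]; rfl
    have h2 : ∀ x y, insertPair i x y s (j + 2 + 1) = s (j + 1) := by
      intro x y; simp only [insertPair]
      rw [if_neg (by omega), if_neg (by omega), if_neg (by omega)]; congr 1
    simp only [Module.End.mul_apply, cupAction_apply, capAction_apply, h, h1,
      h2, Fintype.sum_bool]
    ring

theorem planar_nontrivial (hA : A ≠ 0) : Nontrivial (Planar A) := by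
  have : Nontrivial (Module.End ℂ ((ℕ → Bool) → ℂ)) := inferInstance
  exact (planarRelations_action hA).lift.toRingHom.domain_nontrivial

/-- Converts an identity of closed diagrams in `Planar A` into an identity of numbers. -/
theorem smul_one_injective (hA : A ≠ 0) {a b : ℂ} (h : a • (1 : Planar A) = b • 1) : a = b := by
  have := planar_nontrivial hA
  exact smul_left_injective ℂ one_ne_zero h

/-! ### Crossings -/

theorem cup_cap_assoc (i : ℕ) (y : Planar A) : cup A i * (cap A i * y) = loopValue A • y := by
  rw [← mul_assoc, (planarRelations A).circle, smul_one_mul]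

theorem cup_cap_succ_assoc (i : ℕ) (y : Planar A) : cup A i * (cap A (i + 1) * y) = y := by
  rw [← mul_assoc, (planarRelations A).zigzag_left, one_mul]

theorem cup_succ_cap_assoc (i : ℕ) (y : Planar A) : cup A (i + 1) * (cap A i * y) = y := by
  rw [← mul_assoc, (planarRelations A).zigzag_right, one_mul]

/-- A local maximum below a local minimum. -/
def turnback (A : ℂ) (i : ℕ) : Planar A := cap A i * cup A i

/-- The coefficient of the vertical smoothing of a crossing. -/
def coef (A : ℂ) (s : Bool) : ℂ := if s then A else A⁻¹

/-- A crossing. -/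
def braid (A : ℂ) (s : Bool) (i : ℕ) : Planar A := coef A s • 1 + coef A (!s) • turnback A i

theorem coef_mul (hA : A ≠ 0) (s : Bool) : coef A s * coef A (!s) = 1 := by
  cases s <;> simp [coef, hA]

theorem loopValue_eq (s : Bool) : loopValue A = -coef A s ^ 2 - coef A (!s) ^ 2 := by
  cases s <;> simp [coef, loopValue, zpow_neg]; ring

@[simp] theorem shift_turnback (k i : ℕ) : shift k (turnback A i) = turnback A (i + k) := by
  simp [turnback]

@[simp] theorem flip_turnback (i : ℕ) : flip (turnback A i) = turnback A i := by
  simp [turnback]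

@[simp] theorem shift_braid (k : ℕ) (s : Bool) (i : ℕ) :
    shift k (braid A s i) = braid A s (i + k) := by
  simp [braid]

@[simp] theorem flip_braid (s : Bool) (i : ℕ) : flip (braid A s i) = braid A s i := by
  simp [braid]

theorem turnback_mem {i m : ℕ} (h : i + 2 ≤ m) : turnback A i ∈ Hom A m m := hom_hook h

theorem braid_mem (s : Bool) {i m : ℕ} (h : i + 2 ≤ m) : braid A s i ∈ Hom A m m :=
  add_mem (Submodule.smul_mem _ _ (hom_one m)) (Submodule.smul_mem _ _ (turnback_mem h))

/-- The second Reidemeister move: the two coefficients of a crossing have product `1`, and the sum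
of their squares cancels the value of a circle. -/
theorem braid_mul_braid_not (hA : A ≠ 0) (s : Bool) (i : ℕ) :
    braid A s i * braid A (!s) i = 1 := by
  have h := coef_mul hA s
  simp only [braid, turnback, mul_add, add_mul, smul_mul_assoc, mul_smul_comm, mul_one, one_mul,
    mul_assoc, cup_cap_assoc, Bool.not_not, loopValue_eq s]
  match_scalars
  · linear_combination h
  · linear_combination -(coef A s ^ 2 + coef A (!s) ^ 2) * h

/-- The second Reidemeister move for a minimum that is pulled off a strand crossing both of its
legs. -/
theorem cup_braid_braid (hA : A ≠ 0) (s : Bool) (i : ℕ) :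
    cup A (i + 1) * (braid A s i * braid A s (i + 1)) = cup A i := by
  have h := coef_mul hA s
  simp only [braid, turnback, mul_add, add_mul, smul_mul_assoc, mul_smul_comm, mul_one, one_mul,
    mul_assoc, cup_cap_assoc, cup_cap_succ_assoc, cup_succ_cap_assoc, loopValue_eq s]
  match_scalars
  · linear_combination -(coef A s ^ 2 + coef A (!s) ^ 2) * h
  · linear_combination h

theorem braid_braid_cap (hA : A ≠ 0) (s : Bool) (i : ℕ) :
    braid A s i * (braid A s (i + 1) * cap A i) = cap A (i + 1) := by
  have h := coef_mul hA s
  simp only [braid, turnback, mul_add, add_mul, smul_mul_assoc, mul_smul_comm, mul_one, one_mul,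
    mul_assoc, loopValue_eq s,
    (planarRelations A).circle, (planarRelations A).zigzag_left, (planarRelations A).zigzag_right]
  match_scalars
  · linear_combination -(coef A s ^ 2 + coef A (!s) ^ 2) * h
  · linear_combination h

/-- The first Reidemeister move with its framing factor. -/
theorem braid_cap (hA : A ≠ 0) (s : Bool) (i : ℕ) :
    braid A s i * cap A i = (-coef A (!s) ^ 3) • cap A i := by
  have h := coef_mul hA s
  simp only [braid, turnback, add_mul, smul_mul_assoc, mul_smul_comm, mul_one, one_mul,
    mul_assoc, loopValue_eq s, (planarRelations A).circle]
  match_scalars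
  linear_combination -coef A s * h

/-! ### Crossings of bands -/

/-- A strand crosses the `m` strands on its right. -/
def across (A : ℂ) (s : Bool) : ℕ → Planar A
  | 0 => 1
  | m + 1 => across A s m * braid A s m

/-- A strand crosses the `m` strands on its left. -/
def back (A : ℂ) (s : Bool) : ℕ → Planar A
  | 0 => 1
  | m + 1 => braid A s m * back A s m

/-- A band of `a` strands crosses the `b` strands on its right. -/
def bandCross (A : ℂ) (s : Bool) : ℕ → ℕ → Planar A
  | 0, _ => 1
  | a + 1, b => shift 1 (bandCross A s a b) * across A s b

theorem across_mem (s : Bool) (m : ℕ) : across A s m ∈ Hom A (m + 1) (m + 1) := by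
  induction m with
  | zero => exact hom_one _
  | succ m ih => exact hom_mul (hom_mono 1 ih) (braid_mem s le_rfl)

@[simp] theorem flip_across (s : Bool) (m : ℕ) : flip (across A s m) = back A s m := by
  induction m with
  | zero => simp [across, back]
  | succ m ih => simp [across, back, ih]

@[simp] theorem flip_back (s : Bool) (m : ℕ) : flip (back A s m) = across A s m := by
  rw [← flip_across, flip_flip]

theorem back_mem (s : Bool) (m : ℕ) : back A s m ∈ Hom A (m + 1) (m + 1) := by
  rw [← flip_across]; exact flip_mem (across_mem s m)

theorem across_add (s : Bool) (m n : ℕ) :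
    across A s (m + n) = across A s m * shift m (across A s n) := by
  induction n with
  | zero => simp [across]
  | succ n ih => rw [← add_assoc]; simp [across, ih, mul_assoc, add_comm]

theorem across_succ' (s : Bool) (m : ℕ) :
    across A s (m + 1) = braid A s 0 * shift 1 (across A s m) := by
  rw [add_comm, across_add]; simp [across]

theorem back_succ' (s : Bool) (m : ℕ) :
    back A s (m + 1) = shift 1 (back A s m) * braid A s 0 := by
  have := congrArg flip (across_succ' (A := A) s m)
  simpa using this

theorem across_mul_back (hA : A ≠ 0) (s : Bool) (m : ℕ) : across A s m * back A (!s) m = 1 := by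
  induction m with
  | zero => simp [across, back]
  | succ m ih =>
    rw [across, back, mul_assoc, ← mul_assoc (braid A s m), braid_mul_braid_not hA, one_mul, ih]

theorem braid_eq_shift (s : Bool) (k : ℕ) : braid A s k = shift k (braid A s 0) := by simp

/-- Only the two crossings with the legs of the arc matter, and they cancel by `cup_braid_braid`;
the arc commutes with the crossings to its left, and with those to its right up to a shift. -/
theorem cup_succ_across (hA : A ≠ 0) (s : Bool) (m i : ℕ) (h : i ≤ m) :
    cup A (i + 1) * across A s (m + 2) = across A s m * cup A i := by
  induction m with
  | zero =>
    obtain rfl : i = 0 := by omega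
    simpa [across] using cup_braid_braid hA s 0
  | succ m ih =>
    obtain rfl | h : i = m + 1 ∨ i ≤ m := by omega
    · have := mul_shift (across_mem (A := A) s (m + 1)) (cup A 0)
      simp only [shift_cup, zero_add] at this
      rw [across, across, mul_assoc, ← mul_assoc, ← this, mul_assoc, cup_braid_braid hA]
    · rw [across, ← mul_assoc, ih h, across, mul_assoc, mul_assoc, braid_eq_shift s (m + 2),
        cup_mul_shift h, ← braid_eq_shift]

theorem cap_succ_across (hA : A ≠ 0) (s : Bool) (m i : ℕ) (h : i ≤ m) :
    cap A (i + 1) * across A s m = across A s (m + 2) * cap A i := by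
  induction m with
  | zero =>
    obtain rfl : i = 0 := by omega
    simpa [across, mul_assoc] using (braid_braid_cap hA s 0).symm
  | succ m ih =>
    obtain rfl | h : i = m + 1 ∨ i ≤ m := by omega
    · have := mul_shift (across_mem (A := A) s (m + 1)) (cap A 0)
      simp only [shift_cap, zero_add] at this
      rw [← this, across.eq_2 A s (m + 2), across.eq_2 A s (m + 1), mul_assoc, mul_assoc,
        braid_braid_cap hA]
    · rw [across, ← mul_assoc, ih h, mul_assoc, braid_eq_shift s m, cap_mul_shift h,
        ← braid_eq_shift, across.eq_2 A s (m + 2), mul_assoc]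

/-- A strand can be moved across a diagram. -/
theorem shift_mul_across (hA : A ≠ 0) (s : Bool) {m n : ℕ} {x : Planar A} (h : x ∈ Hom A m n) :
    shift 1 x * across A s n = across A s m * x := by
  induction h using Submodule.span_induction with
  | mem x hx =>
    induction hx with
    | nil => simp
    | cup h _ ih =>
      rw [map_mul, mul_assoc, ih, shift_cup, ← mul_assoc, cup_succ_across hA s _ _ h, mul_assoc]
    | cap h _ ih =>
      rw [map_mul, mul_assoc, ih, shift_cap, ← mul_assoc, cap_succ_across hA s _ _ h, mul_assoc]
  | zero => simp
  | add x y _ _ hx hy => rw [map_add, add_mul, mul_add, hx, hy]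
  | smul a x _ hx => rw [map_smul, smul_mul_assoc, mul_smul_comm, hx]

@[simp] theorem bandCross_zero_right (s : Bool) (a : ℕ) : bandCross A s a 0 = 1 := by
  induction a with
  | zero => rfl
  | succ a ih => simp [bandCross, ih, across]

theorem bandCross_mem (s : Bool) (a b : ℕ) : bandCross A s a b ∈ Hom A (a + b) (a + b) := by
  induction a with
  | zero => exact hom_one _
  | succ a ih =>
    refine hom_mul (m := a + 1 + b) ?_ ?_
    · convert shift_mem 1 ih using 2 <;> omega
    · convert hom_mono a (across_mem s b) using 2 <;> omega

/-- The crossings of two bands form a rectangle, which can be read by rows or by columns. -/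
theorem bandCross_succ_right (s : Bool) (a b : ℕ) :
    bandCross A s a (b + 1) = bandCross A s a b * shift b (back A s a) := by
  induction a with
  | zero => simp [bandCross, back]
  | succ a ih =>
    have := mul_shift (across_mem (A := A) s b) (back A s a)
    rw [bandCross, ih, bandCross, map_mul, shift_shift, across, back_succ', mul_assoc,
      ← mul_assoc _ (across A s b), ← this, map_mul, shift_shift, add_comm 1 b]
    simp [mul_assoc]

theorem bandCross_add_right (s : Bool) (a b c : ℕ) :
    bandCross A s a (b + c) = bandCross A s a b * shift b (bandCross A s a c) := by
  induction c with
  | zero => simp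
  | succ c ih =>
    rw [← add_assoc, bandCross_succ_right, ih, bandCross_succ_right, map_mul, shift_shift,
      mul_assoc, add_comm c b]

theorem bandCross_add_left (s : Bool) (a b c : ℕ) :
    bandCross A s (a + b) c = shift a (bandCross A s b c) * bandCross A s a c := by
  induction a with
  | zero => simp [bandCross]
  | succ a ih =>
    rw [add_right_comm, bandCross, ih, bandCross, map_mul, shift_shift, mul_assoc]

theorem bandCross_one_right (s : Bool) (a : ℕ) : bandCross A s a 1 = back A s a := by
  simpa using bandCross_succ_right (A := A) s a 0

theorem bandCross_one_left (s : Bool) (b : ℕ) : bandCross A s 1 b = across A s b := by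
  simp [bandCross]

theorem bandCross_succ_right' (s : Bool) (a b : ℕ) :
    bandCross A s a (b + 1) = back A s a * shift 1 (bandCross A s a b) := by
  rw [add_comm, bandCross_add_right, bandCross_one_right]

theorem bandCross_succ_left' (s : Bool) (a b : ℕ) :
    bandCross A s (a + 1) b = shift a (across A s b) * bandCross A s a b := by
  rw [bandCross_add_left, bandCross_one_left]

@[simp] theorem flip_bandCross (s : Bool) (a b : ℕ) :
    flip (bandCross A s a b) = bandCross A s b a := by
  induction a with
  | zero => simp [bandCross]
  | succ a ih => rw [bandCross, bandCross_succ_right']; simp [ih]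

/-- A band can be moved across a diagram on its right. -/
theorem shift_mul_bandCross (hA : A ≠ 0) (s : Bool) (a : ℕ) {m n : ℕ} {x : Planar A}
    (h : x ∈ Hom A m n) : shift a x * bandCross A s a n = bandCross A s a m * x := by
  induction a with
  | zero => simp [bandCross]
  | succ a ih =>
    rw [bandCross, bandCross, ← mul_assoc, ← shift_shift, ← map_mul, ih, map_mul, mul_assoc,
      shift_mul_across hA s h, mul_assoc]

/-- A band can be moved across a diagram on its left. -/
theorem mul_bandCross (hA : A ≠ 0) (s : Bool) (b : ℕ) {m n : ℕ} {x : Planar A}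
    (h : x ∈ Hom A m n) : x * bandCross A s n b = bandCross A s m b * shift b x := by
  have := congrArg flip (shift_mul_bandCross hA s b (flip_mem h))
  simpa using this.symm

/-! ### Nested arcs -/

/-- `n` nested minima. -/
def nestedCups (A : ℂ) : ℕ → Planar A
  | 0 => 1
  | n + 1 => nestedCups A n * cup A n

/-- `n` nested maxima. -/
def nestedCaps (A : ℂ) : ℕ → Planar A
  | 0 => 1
  | n + 1 => cap A n * nestedCaps A n

@[simp] theorem flip_nestedCups (n : ℕ) : flip (nestedCups A n) = nestedCaps A n := by
  induction n with
  | zero => simp [nestedCups, nestedCaps]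
  | succ n ih => simp [nestedCups, nestedCaps, ih]

@[simp] theorem flip_nestedCaps (n : ℕ) : flip (nestedCaps A n) = nestedCups A n := by
  rw [← flip_nestedCups, flip_flip]

theorem nestedCups_mem (n : ℕ) : nestedCups A n ∈ Hom A 0 (n + n) := by
  induction n with
  | zero => exact hom_one _
  | succ n ih =>
    have := hom_mul ih (hom_cup (u := cup A) (v := cap A) (i := n) (m := n + n) (by omega))
    rwa [show n + n + 2 = n + 1 + (n + 1) by omega] at this

theorem nestedCaps_mem (n : ℕ) : nestedCaps A n ∈ Hom A (n + n) 0 := by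
  rw [← flip_nestedCups]; exact flip_mem (nestedCups_mem n)

theorem nestedCups_add (m n : ℕ) :
    nestedCups A (m + n) = nestedCups A m * shift m (nestedCups A n) := by
  induction n with
  | zero => simp [nestedCups]
  | succ n ih => rw [← add_assoc]; simp [nestedCups, ih, mul_assoc, add_comm]

theorem nestedCaps_add (m n : ℕ) :
    nestedCaps A (m + n) = shift m (nestedCaps A n) * nestedCaps A m := by
  have := congrArg flip (nestedCups_add (A := A) m n)
  simpa using this

/-- An arc that meets the left legs of nested maxima slides along them to the right legs, where it
turns upside down and appears at the mirrored position, hence `n - i`. -/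
theorem cup_mul_nestedCaps (n i : ℕ) (h : i ≤ n) :
    cup A i * nestedCaps A (n + 2) = shift n (cap A (n - i)) * nestedCaps A n := by
  have R := planarRelations A
  induction n with
  | zero =>
    obtain rfl : i = 0 := by omega
    simp [nestedCaps, cup_cap_succ_assoc]
  | succ n ih =>
    obtain rfl | h : i = n + 1 ∨ i ≤ n := by omega
    · simp [nestedCaps, cup_cap_succ_assoc]
    · rw [nestedCaps.eq_2 A (n + 2), ← mul_assoc, R.cap_cup i n h, mul_assoc, ih h, nestedCaps,
        ← mul_assoc, ← mul_assoc, shift_cap, shift_cap, ← R.cap_cap n _ (by omega)]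
      congr 3; omega

theorem cap_mul_nestedCaps (n i : ℕ) (h : i ≤ n) :
    cap A i * nestedCaps A n = shift (n + 2) (cup A (n - i)) * nestedCaps A (n + 2) := by
  have R := planarRelations A
  induction n with
  | zero =>
    obtain rfl : i = 0 := by omega
    simp [nestedCaps, cup_succ_cap_assoc]
  | succ n ih =>
    obtain rfl | h : i = n + 1 ∨ i ≤ n := by omega
    · simp [nestedCaps, cup_succ_cap_assoc]
    · rw [nestedCaps, ← mul_assoc, ← R.cap_cap i n h, mul_assoc, ih h, nestedCaps.eq_2 A (n + 2),
        ← mul_assoc, ← mul_assoc, shift_cup, shift_cup, ← R.cup_cap (n + 2) _ (by omega)]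
      congr 3; omega

theorem nestedCups_mul_cap (n i : ℕ) (h : i ≤ n) :
    nestedCups A (n + 2) * cap A i = nestedCups A n * shift n (cup A (n - i)) := by
  have := congrArg flip (cup_mul_nestedCaps (A := A) n i h)
  simpa using this

theorem nestedCups_mul_cup (n i : ℕ) (h : i ≤ n) :
    nestedCups A n * cup A i = nestedCups A (n + 2) * shift (n + 2) (cap A (n - i)) := by
  have := congrArg flip (cap_mul_nestedCaps (A := A) n i h)
  simpa using this

theorem turnback_mul_nestedCaps (n i : ℕ) (h : i ≤ n) :
    turnback A i * nestedCaps A (n + 2) =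
      shift (n + 2) (turnback A (n - i)) * nestedCaps A (n + 2) := by
  have : cap A i * shift n (cap A (n - i)) = shift (n + 2) (cap A (n - i)) * cap A i :=
    cap_mul_shift h _
  rw [turnback, mul_assoc, cup_mul_nestedCaps n i h, ← mul_assoc, this, mul_assoc,
    cap_mul_nestedCaps n i h, ← mul_assoc, ← map_mul, turnback]

theorem nestedCups_zigzag (n : ℕ) : nestedCups A n * shift n (nestedCaps A n) = 1 := by
  induction n with
  | zero => simp [nestedCups, nestedCaps]
  | succ n ih =>
    have h : nestedCaps A (n + 1) = shift 1 (nestedCaps A n) * cap A 0 := by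
      rw [add_comm, nestedCaps_add]; simp [nestedCaps]
    have h1 := mul_shift (hom_cup (u := cup A) (v := cap A) (i := n) (m := n) le_rfl)
      (nestedCaps A n)
    rw [nestedCups, h, map_mul, shift_shift, mul_assoc, ← mul_assoc (cup A n), add_comm 1 (n + 1),
      h1, mul_assoc, shift_cap, zero_add, (planarRelations A).zigzag_left, mul_one, ih]

/-! ### Encircling -/

/-- A closed band, which contains the endomorphism `x` of `b` strands, encircles `m` strands. -/
def encircle (b m : ℕ) (x : Planar A) : Planar A :=
  nestedCups A b * x * shift b (bandCross A true b m * bandCross A true m b) * nestedCaps A b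

theorem encircle_mem {b m : ℕ} {x : Planar A} (h : x ∈ Hom A b b) :
    encircle b m x ∈ Hom A m m := by
  have h1 := hom_mono m (nestedCups_mem (A := A) b)
  have h2 := hom_mono m (nestedCaps_mem (A := A) b)
  have h3 := hom_mono (b + m) h
  have h4 : bandCross A true m b ∈ Hom A (b + m) (b + m) := by
    have := bandCross_mem (A := A) true m b
    rwa [add_comm] at this
  have h5 := shift_mem b (hom_mul (bandCross_mem (A := A) true b m) h4)
  rw [zero_add, add_assoc] at h1 h2
  exact hom_mul (hom_mul (hom_mul h1 h3) h5) h2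

/-- A diagram slides through the ring: both band crossings are natural, and the rest of the ring
lies to the left of `y`. -/
theorem encircle_mul (hA : A ≠ 0) {b m n : ℕ} {x y : Planar A} (hx : x ∈ Hom A b b)
    (hy : y ∈ Hom A m n) : y * encircle b n x = encircle b m x * y := by
  have h1 := mul_shift (nestedCups_mem (A := A) b) y
  have h2 := mul_shift (nestedCaps_mem (A := A) b) y
  have h3 := mul_shift hx (shift b y)
  rw [shift_zero] at h1 h2
  rw [shift_shift] at h3
  have h4 : shift b y * (bandCross A true b n * bandCross A true n b) =
      bandCross A true b m * bandCross A true m b * shift b y := by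
    rw [← mul_assoc, shift_mul_bandCross hA true b hy, mul_assoc, mul_bandCross hA true b hy,
      mul_assoc]
  have h5 := congrArg (shift b) h4
  rw [map_mul, map_mul _ _ (shift b y), shift_shift] at h5
  simp only [encircle, mul_assoc]
  rw [← mul_assoc, ← h1, mul_assoc, ← mul_assoc _ x, ← h3, mul_assoc, ← mul_assoc (shift (b + b) y),
    h5, mul_assoc, ← h2]

/-- The arc travels once around the ring: over the nested maxima it becomes a maximum on the
returning strands, passes the encircled strands there, and becomes a minimum again at the nested
minima, below `x`. -/
theorem encircle_mul_cup (hA : A ≠ 0) {n m i : ℕ} {x : Planar A} (hx : x ∈ Hom A (n + 2) n)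
    (hi : i ≤ n) : encircle (n + 2) m (x * cup A i) = encircle n m (cup A i * x) := by
  have hc : cap A (n - i) ∈ Hom A (n + 2) n := hom_cap (by omega)
  have h1 := cup_mul_shift hi (bandCross A true (n + 2) m * bandCross A true m (n + 2))
  have h2 : bandCross A true (n + 2) m * bandCross A true m (n + 2) * cap A (n - i) =
      cap A (n - i) * (bandCross A true n m * bandCross A true m n) := by
    rw [mul_assoc, ← shift_mul_bandCross hA true m hc, ← mul_assoc, ← mul_bandCross hA true m hc,
      mul_assoc]
  have h3 := congrArg (shift n) h2
  rw [map_mul, map_mul _ (cap A (n - i))] at h3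
  have h4 := mul_shift hx (cap A (n - i))
  simp only [encircle, mul_assoc]
  rw [← mul_assoc (cup A i), h1, mul_assoc, cup_mul_nestedCaps n i hi, ← mul_assoc (shift n _),
    h3, mul_assoc, ← mul_assoc x, h4, mul_assoc, ← mul_assoc, ← nestedCups_mul_cup n i hi, mul_assoc]

theorem encircle_mul_cap (hA : A ≠ 0) {n m i : ℕ} {x : Planar A} (hx : x ∈ Hom A n (n + 2))
    (hi : i ≤ n) : encircle n m (x * cap A i) = encircle (n + 2) m (cap A i * x) := by
  have hc : cup A (n - i) ∈ Hom A n (n + 2) := hom_cup (by omega)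
  have h1 := cap_mul_shift hi (bandCross A true n m * bandCross A true m n)
  have h2 : bandCross A true n m * bandCross A true m n * cup A (n - i) =
      cup A (n - i) * (bandCross A true (n + 2) m * bandCross A true m (n + 2)) := by
    rw [mul_assoc, ← shift_mul_bandCross hA true m hc, ← mul_assoc, ← mul_bandCross hA true m hc,
      mul_assoc]
  have h3 := congrArg (shift (n + 2)) h2
  rw [map_mul, map_mul _ (cup A (n - i))] at h3
  have h4 := mul_shift hx (cup A (n - i))
  simp only [encircle, mul_assoc]
  rw [← mul_assoc (cap A i), h1, mul_assoc, cap_mul_nestedCaps n i hi,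
    ← mul_assoc (shift (n + 2) _), h3, mul_assoc, ← mul_assoc x, h4, mul_assoc, ← mul_assoc,
    ← nestedCups_mul_cap n i hi, mul_assoc]

/-- Encircling is a trace. -/
theorem encircle_comm (hA : A ≠ 0) {a b m : ℕ} {x y : Planar A} (hx : x ∈ Hom A a b)
    (hy : y ∈ Hom A b a) : encircle a m (x * y) = encircle b m (y * x) := by
  induction hy using Submodule.span_induction with
  | mem y hy =>
    induction hy generalizing x with
    | nil => simp
    | cup h hw ih =>
      rw [← mul_assoc, ih (hom_mul hx (hom_cup h)), ← mul_assoc,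
        encircle_mul_cup hA (hom_mul (word_mem hw) hx) h, mul_assoc]
    | cap h hw ih =>
      rw [← mul_assoc, ih (hom_mul hx (hom_cap h)), ← mul_assoc,
        encircle_mul_cap hA (hom_mul (word_mem hw) hx) h, mul_assoc]
  | zero => simp [encircle]
  | add y z _ _ hy hz =>
    simp only [encircle, mul_add, add_mul] at *
    rw [hy, hz]
  | smul c y _ hy =>
    simp only [encircle, smul_mul_assoc, mul_smul_comm] at *
    rw [hy]

/-! ### Jones-Wenzl idempotents -/

theorem toPlanar_hook (i : ℕ) : toPlanar A (hook i) = turnback A i := map_mul _ _ _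

theorem skein_cup_mem {i m : ℕ} (h : i ≤ m) : piece (.cup i) ∈ SkeinHom m (m + 2) :=
  hom_cup (u := fun i => piece (.cup i)) (v := fun i => piece (.cap i)) h

theorem skein_cap_mem {i m : ℕ} (h : i ≤ m) : piece (.cap i) ∈ SkeinHom (m + 2) m :=
  hom_cap (u := fun i => piece (.cup i)) (v := fun i => piece (.cap i)) h

theorem skein_hook_mem {i m : ℕ} (h : i + 2 ≤ m) : hook i ∈ SkeinHom m m :=
  hom_hook (u := fun i => piece (.cup i)) (v := fun i => piece (.cap i)) h

theorem cups_succ (k n : ℕ) : cups k (n + 1) = cups k n * piece (.cup (k + n)) := by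
  simp [cups, List.range_succ]

theorem caps_succ (k n : ℕ) : caps k (n + 1) = piece (.cap (k + n)) * caps k n := by
  simp [caps, List.range_succ]

theorem skein_cups_mem {k m : ℕ} (h : k ≤ m) (n : ℕ) : cups k n ∈ SkeinHom m (m + 2 * n) := by
  induction n with
  | zero => exact hom_one _
  | succ n ih =>
    rw [cups_succ]
    exact hom_mul ih (skein_cup_mem (i := k + n) (m := m + 2 * n) (by omega))

theorem skein_caps_mem {k m : ℕ} (h : k ≤ m) (n : ℕ) : caps k n ∈ SkeinHom (m + 2 * n) m := by
  induction n with
  | zero => exact hom_one _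
  | succ n ih =>
    rw [caps_succ]
    exact hom_mul (skein_cap_mem (i := k + n) (m := m + 2 * n) (by omega)) ih

theorem toPlanar_cups (k n : ℕ) : toPlanar A (cups k n) = shift k (nestedCups A n) := by
  induction n with
  | zero => simp [cups, nestedCups]
  | succ n ih =>
    rw [cups_succ, map_mul, ih, nestedCups, map_mul, shift_cup, ← cup, add_comm]

theorem toPlanar_caps (k n : ℕ) : toPlanar A (caps k n) = shift k (nestedCaps A n) := by
  induction n with
  | zero => simp [caps, nestedCaps]
  | succ n ih =>
    rw [caps_succ, map_mul, ih, nestedCaps, map_mul, shift_cap, ← cap, add_comm]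

/-- The Jones-Wenzl idempotent. -/
def jw (A : ℂ) (n : ℕ) : Planar A := toPlanar A (jonesWenzl A n 0)

theorem jonesWenzl_succ_succ (n k : ℕ) : jonesWenzl A (n + 2) k =
    jonesWenzl A (n + 1) k - (delta A n / delta A (n + 1)) •
      (jonesWenzl A (n + 1) k * hook (k + n) * jonesWenzl A (n + 1) k) := by
  rw [jonesWenzl]; rfl

theorem jw_zero : jw A 0 = 1 := by simp [jw, jonesWenzl]

theorem jw_one : jw A 1 = 1 := by simp [jw, jonesWenzl]

theorem jw_succ_succ (n : ℕ) : jw A (n + 2) =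
    jw A (n + 1) - (delta A n / delta A (n + 1)) •
      (jw A (n + 1) * turnback A n * jw A (n + 1)) := by
  rw [jw, jonesWenzl_succ_succ]
  simp [jw, toPlanar_hook]

theorem skein_jonesWenzl_mem (n : ℕ) : ∀ {k m : ℕ}, k + n ≤ m →
    jonesWenzl A n k ∈ SkeinHom m m := by
  induction n using Nat.strong_induction_on with
  | _ n ih =>
    intro k m h
    match n with
    | 0 => rw [jonesWenzl]; exact hom_one _
    | 1 => rw [jonesWenzl]; exact hom_one _
    | n + 2 =>
      rw [jonesWenzl_succ_succ]
      have h1 : jonesWenzl A (n + 1) k ∈ SkeinHom m m := ih (n + 1) (by omega) (by omega)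
      exact sub_mem h1 (Submodule.smul_mem _ _
        (hom_mul (hom_mul h1 (skein_hook_mem (by omega))) h1))

theorem toPlanar_jonesWenzl (n k : ℕ) : toPlanar A (jonesWenzl A n k) = shift k (jw A n) := by
  induction n using Nat.strong_induction_on with
  | _ n ih =>
    match n with
    | 0 => simp [jw_zero, jonesWenzl]
    | 1 => simp [jw_one, jonesWenzl]
    | n + 2 =>
      rw [jonesWenzl_succ_succ, jw_succ_succ]
      simp [ih, toPlanar_hook, add_comm]

theorem jw_mem (n : ℕ) : jw A n ∈ Hom A n n := toPlanar_mem (skein_jonesWenzl_mem n (by omega))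

@[simp] theorem flip_jw (n : ℕ) : flip (jw A n) = jw A n := by
  induction n using Nat.strong_induction_on with
  | _ n ih =>
    match n with
    | 0 => simp [jw_zero]
    | 1 => simp [jw_one]
    | n + 2 => simp [jw_succ_succ, ih, mul_assoc]

theorem nestedCups_jw_nestedCaps (n : ℕ) :
    nestedCups A n * jw A n * nestedCaps A n = delta A n • 1 := by
  have h := hom_mul (hom_mul (skein_cups_mem (le_refl 0) n)
    (skein_jonesWenzl_mem (A := A) n (k := 0) (m := 0 + 2 * n) (by omega)))
    (skein_caps_mem (le_refl 0) n)
  have := toPlanar_eq_bracket (A := A) h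
  rw [delta, planeClosure, ← this, map_mul, map_mul, toPlanar_cups, toPlanar_caps, shift_zero,
    shift_zero, jw]

theorem delta_zero (hA : A ≠ 0) : delta A 0 = 1 := by
  refine smul_one_injective hA ?_
  rw [← nestedCups_jw_nestedCaps]; simp [nestedCups, nestedCaps, jw_zero]

theorem delta_one (hA : A ≠ 0) : delta A 1 = loopValue A := by
  refine smul_one_injective hA ?_
  rw [← nestedCups_jw_nestedCaps]
  simp [nestedCups, nestedCaps, jw_one, (planarRelations A).circle]

theorem cup_mul_comm {n : ℕ} {x : Planar A} (h : x ∈ Hom A n n) : cup A n * x = x * cup A n := by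
  simpa using (mul_shift h (cup A 0)).symm

theorem cap_mul_comm {n : ℕ} {x : Planar A} (h : x ∈ Hom A n n) : cap A n * x = x * cap A n := by
  simpa using (mul_shift h (cap A 0)).symm

/-- The four properties carry each other through the induction. The partial closure evaluates an
idempotent between two turnbacks, and the ratio in the recursion is exactly the one for which the
correction term then cancels. Annihilation of turnbacks gives idempotency, and closing the recursion
gives the next partial closure. -/
theorem jw_properties (hA : A ≠ 0) (n : ℕ) (hΔ : ∀ i ≤ n, delta A i ≠ 0) :
    jw A (n + 1) * jw A (n + 1) = jw A (n + 1) ∧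
    (∀ i, i + 2 ≤ n + 1 → jw A (n + 1) * turnback A i = 0) ∧
    jw A (n + 1) * jw A n = jw A (n + 1) ∧
    cup A n * jw A (n + 1) * cap A n = (delta A (n + 1) / delta A n) • jw A n := by
  induction n with
  | zero =>
    refine ⟨by simp [jw_one], fun i hi => by omega, by simp [jw_one, jw_zero], ?_⟩
    simp [jw_one, jw_zero, (planarRelations A).circle, delta_zero hA, delta_one hA]
  | succ n ih =>
    obtain ⟨h1, h2, h3, h4⟩ := ih fun i hi => hΔ i (by omega)
    have hn := hΔ n (by omega)
    have hn1 := hΔ (n + 1) le_rfl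
    set r := delta A n / delta A (n + 1) with hr
    have hrec : jw A (n + 2) = jw A (n + 1) - r • (jw A (n + 1) * turnback A n * jw A (n + 1)) :=
      jw_succ_succ n
    have key : r • (turnback A n * jw A (n + 1) * turnback A n) = jw A n * turnback A n := by
      have : turnback A n * jw A (n + 1) * turnback A n =
          cap A n * (cup A n * jw A (n + 1) * cap A n) * cup A n := by
        simp only [turnback, mul_assoc]
      rw [this, h4, mul_smul_comm, smul_mul_assoc, smul_smul, hr,
        show delta A n / delta A (n + 1) * (delta A (n + 1) / delta A n) = 1 by field_simp,
        one_smul, cap_mul_comm (jw_mem n), mul_assoc, turnback]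
    have k2 : ∀ i, i + 2 ≤ n + 2 → jw A (n + 2) * turnback A i = 0 := by
      intro i hi
      obtain rfl | hi : i = n ∨ i + 2 ≤ n + 1 := by omega
      · rw [hrec, sub_mul, smul_mul_assoc, mul_assoc, mul_assoc, ← mul_assoc (turnback A i),
          ← mul_smul_comm, key, ← mul_assoc, h3, sub_self]
      · rw [hrec, sub_mul, h2 i hi, smul_mul_assoc, mul_assoc, h2 i hi, mul_zero, smul_zero,
          sub_zero]
    have k3 : jw A (n + 2) * jw A (n + 1) = jw A (n + 2) := by
      rw [hrec, sub_mul, smul_mul_assoc, mul_assoc _ _ (jw A (n + 1)), h1]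
    have k4 : cup A (n + 1) * jw A (n + 2) * cap A (n + 1) = (loopValue A - r) • jw A (n + 1) := by
      have hu := cup_mul_comm (jw_mem (A := A) (n + 1))
      have hv := cap_mul_comm (jw_mem (A := A) (n + 1))
      have e1 : cup A (n + 1) * jw A (n + 1) * cap A (n + 1) = loopValue A • jw A (n + 1) := by
        rw [hu, mul_assoc, (planarRelations A).circle, mul_smul_one]
      have e2 : cup A (n + 1) * (jw A (n + 1) * turnback A n * jw A (n + 1)) * cap A (n + 1) =
          jw A (n + 1) := by
        simp only [turnback, mul_assoc]
        rw [← hv, ← mul_assoc (cup A (n + 1)), hu, mul_assoc, cup_succ_cap_assoc,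
          cup_cap_succ_assoc, h1]
      rw [hrec, mul_sub, sub_mul, mul_smul_comm, smul_mul_assoc, e1, e2, sub_smul]
    have k5 : delta A (n + 2) = (loopValue A - r) * delta A (n + 1) := by
      refine smul_one_injective hA ?_
      rw [← nestedCups_jw_nestedCaps, mul_smul, ← nestedCups_jw_nestedCaps, nestedCups.eq_2 A (n + 1),
        nestedCaps.eq_2 A (n + 1)]
      have : nestedCups A (n + 1) * cup A (n + 1) * jw A (n + 2) *
          (cap A (n + 1) * nestedCaps A (n + 1)) = nestedCups A (n + 1) *
          (cup A (n + 1) * jw A (n + 2) * cap A (n + 1)) * nestedCaps A (n + 1) := by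
        simp only [mul_assoc]
      rw [this, k4, mul_smul_comm, smul_mul_assoc]
    refine ⟨?_, k2, k3, ?_⟩
    · calc
        _ = jw A (n + 2) * (jw A (n + 1) - r • (jw A (n + 1) * turnback A n * jw A (n + 1))) := by
          rw [← hrec]
        _ = _ := ?_
      rw [mul_sub, k3, mul_smul_comm, ← mul_assoc, ← mul_assoc, k3, k2 n le_rfl, zero_mul,
        smul_zero, sub_zero]
    · rw [k4, k5, mul_div_assoc, div_self hn1, mul_one]

theorem jw_mul_self (hA : A ≠ 0) {n : ℕ} (hΔ : ∀ i < n, delta A i ≠ 0) :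
    jw A n * jw A n = jw A n := by
  cases n with
  | zero => simp [jw_zero]
  | succ n => exact (jw_properties hA n fun i hi => hΔ i (by omega)).1

theorem jw_mul_turnback (hA : A ≠ 0) {n : ℕ} (hΔ : ∀ i < n, delta A i ≠ 0) {i : ℕ}
    (hi : i + 2 ≤ n) : jw A n * turnback A i = 0 := by
  cases n with
  | zero => omega
  | succ n => exact (jw_properties hA n fun i hi => hΔ i (by omega)).2.1 i hi

theorem cup_jw_cap (hA : A ≠ 0) {n : ℕ} (hΔ : ∀ i ≤ n, delta A i ≠ 0) :
    cup A n * jw A (n + 1) * cap A n = (delta A (n + 1) / delta A n) • jw A n :=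
  (jw_properties hA n hΔ).2.2.2

/-- Compare `cup_jw_cap` for the idempotent on `n + 2` strands with the partial closure of its
recursion; after complete closure the factors are numbers. -/
theorem delta_succ_succ (hA : A ≠ 0) {n : ℕ} (hΔ : ∀ i ≤ n + 1, delta A i ≠ 0) :
    delta A (n + 2) = loopValue A * delta A (n + 1) - delta A n := by
  have hn1 := hΔ (n + 1) le_rfl
  have hn := hΔ n (by omega)
  have h1 := jw_mul_self hA (n := n + 1) fun i hi => hΔ i (by omega)
  have hu := cup_mul_comm (jw_mem (A := A) (n + 1))
  have hv := cap_mul_comm (jw_mem (A := A) (n + 1))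
  have h := cup_jw_cap hA hΔ
  have e1 : cup A (n + 1) * jw A (n + 1) * cap A (n + 1) = loopValue A • jw A (n + 1) := by
    rw [hu, mul_assoc, (planarRelations A).circle, mul_smul_one]
  have e2 : cup A (n + 1) * (jw A (n + 1) * turnback A n * jw A (n + 1)) * cap A (n + 1) =
      jw A (n + 1) := by
    simp only [turnback, mul_assoc]
    rw [← hv, ← mul_assoc (cup A (n + 1)), hu, mul_assoc, cup_succ_cap_assoc,
      cup_cap_succ_assoc, h1]
  rw [jw_succ_succ, mul_sub, sub_mul, mul_smul_comm, smul_mul_assoc, e1, e2] at h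
  have h' := congrArg (fun x => nestedCups A (n + 1) * x * nestedCaps A (n + 1)) h
  simp only [mul_sub, sub_mul, mul_smul_comm, smul_mul_assoc, nestedCups_jw_nestedCaps] at h'
  rw [smul_smul, smul_smul, smul_smul, ← sub_smul] at h'
  have := smul_one_injective hA h'
  field_simp at this
  linear_combination -this

theorem jw_mul_cap (hA : A ≠ 0) {n : ℕ} (hΔ : ∀ i < n, delta A i ≠ 0) {i : ℕ}
    (hi : i + 2 ≤ n) : jw A n * cap A i = 0 := by
  have := congrArg (· * cap A (i + 1)) (jw_mul_turnback hA hΔ hi)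
  simpa [turnback, mul_assoc, (planarRelations A).zigzag_left] using this

theorem cup_mul_jw (hA : A ≠ 0) {n : ℕ} (hΔ : ∀ i < n, delta A i ≠ 0) {i : ℕ}
    (hi : i + 2 ≤ n) : cup A i * jw A n = 0 := by
  simpa using congrArg flip (jw_mul_cap hA hΔ hi)

/-- Each step of the recursion changes the smaller idempotent by a term containing a turnback, which
the larger one annihilates. -/
theorem jw_mul_shift_jw (hA : A ≠ 0) {n : ℕ} (hΔ : ∀ i < n, delta A i ≠ 0) (k m : ℕ)
    (h : k + m ≤ n) : jw A n * shift k (jw A m) = jw A n := by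
  induction m using Nat.strong_induction_on with
  | _ m ih =>
    match m with
    | 0 => simp [jw_zero]
    | 1 => simp [jw_one]
    | m + 2 =>
      have h1 := ih (m + 1) (by omega) (by omega)
      rw [jw_succ_succ, map_sub, map_smul, map_mul, map_mul, mul_sub, h1, mul_smul_comm,
        ← mul_assoc, ← mul_assoc, h1, shift_turnback, jw_mul_turnback hA hΔ (by omega), zero_mul,
        smul_zero, sub_zero]

theorem jw_mul_jw (hA : A ≠ 0) {n : ℕ} (hΔ : ∀ i < n, delta A i ≠ 0) {m : ℕ} (h : m ≤ n) :
    jw A n * jw A m = jw A n := by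
  simpa using jw_mul_shift_jw hA hΔ 0 m (by omega)

theorem jw_mul_braid (hA : A ≠ 0) {n : ℕ} (hΔ : ∀ i < n, delta A i ≠ 0) (s : Bool) {i : ℕ}
    (hi : i + 2 ≤ n) : jw A n * braid A s i = coef A s • jw A n := by
  rw [braid, mul_add, mul_smul_comm, mul_smul_comm, jw_mul_turnback hA hΔ hi]; simp

theorem jw_mul_across (hA : A ≠ 0) {n : ℕ} (hΔ : ∀ i < n, delta A i ≠ 0) (s : Bool) {k m : ℕ}
    (h : k + m < n) : jw A n * shift k (across A s m) = coef A s ^ m • jw A n := by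
  induction m with
  | zero => simp [across]
  | succ m ih =>
    rw [across, map_mul, ← mul_assoc, ih (by omega), shift_braid, smul_mul_assoc,
      jw_mul_braid hA hΔ s (by omega), smul_smul, pow_succ]

theorem jw_mul_back (hA : A ≠ 0) {n : ℕ} (hΔ : ∀ i < n, delta A i ≠ 0) (s : Bool) {k m : ℕ}
    (h : k + m < n) : jw A n * shift k (back A s m) = coef A s ^ m • jw A n := by
  induction m with
  | zero => simp [back]
  | succ m ih =>
    rw [back, map_mul, ← mul_assoc, shift_braid, jw_mul_braid hA hΔ s (by omega), smul_mul_assoc,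
      ih (by omega), smul_smul, pow_succ']

/-! ### Encircling of the idempotents -/

/-- Moving an arc across `m` strands replaces the crossings on its right leg by opposite crossings
on its left leg. -/
theorem cup_shift_across (hA : A ≠ 0) (s : Bool) (m : ℕ) :
    cup A 0 * shift 1 (across A s m) = cup A m * back A (!s) m := by
  have h := mul_bandCross hA s m (hom_cup (u := cup A) (v := cap A) (le_refl 0))
  simp only [bandCross, zero_add, map_one, one_mul, shift_cup] at h
  rw [← h, mul_assoc, mul_assoc, across_mul_back hA, mul_one]

theorem shift_back_cap (hA : A ≠ 0) (s : Bool) (m : ℕ) :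
    shift 1 (back A s m) * cap A 0 = across A (!s) m * cap A m := by
  simpa using congrArg flip (cup_shift_across hA s m)

theorem braid_mul_self (hA : A ≠ 0) (s : Bool) (i : ℕ) :
    braid A s i * braid A s i = coef A s ^ 2 • 1 + (1 - coef A (!s) ^ 4) • turnback A i := by
  have h := coef_mul hA s
  simp only [braid, turnback, mul_add, add_mul, smul_mul_assoc, mul_smul_comm, mul_one, one_mul,
    mul_assoc, cup_cap_assoc, loopValue_eq s]
  match_scalars
  · ring
  · linear_combination (1 - coef A s * coef A (!s)) * h

/-- The factor by which a circle around `c` strands acts on the idempotent. -/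
def circleFactor (A : ℂ) (c : ℕ) : ℂ := -A ^ (2 * (c + 1)) - A⁻¹ ^ (2 * (c + 1))

theorem encircle_one (m : ℕ) : encircle 1 m (1 : Planar A) =
    cup A 0 * shift 1 (across A true m * back A true m) * cap A 0 := by
  simp [encircle, nestedCups, nestedCaps, bandCross_one_left, bandCross_one_right]

/-- Resolve the two crossings of the circle with the last encircled strand. One term is a circle
around one strand fewer; in the other the circle is cut open into a strand that crosses the `m`
others twice, and the idempotent absorbs these crossings with `A⁻¹` each. -/
theorem jw_mul_circle (hA : A ≠ 0) {n : ℕ} (hΔ : ∀ i < n, delta A i ≠ 0) (m : ℕ) (hm : m ≤ n) :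
    jw A n * encircle 1 m 1 = circleFactor A m • jw A n := by
  induction m with
  | zero =>
    simp [encircle_one, across, back, (planarRelations A).circle, circleFactor, loopValue,
      zpow_neg]
    congr 1; ring
  | succ m ih =>
    have h1 : cup A 0 * shift 1 (across A true m) * cap A (m + 1) = back A false m := by
      rw [cup_shift_across hA, mul_assoc, ← cap_mul_comm (back_mem _ m), ← mul_assoc,
        (planarRelations A).zigzag_left, one_mul]; rfl
    have h2 : cup A (m + 1) * shift 1 (back A true m) * cap A 0 = across A false m := by
      have := congrArg flip h1
      simpa [mul_assoc] using this
    have h3 : encircle 1 (m + 1) (1 : Planar A) = A ^ 2 • encircle 1 m 1 +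
        (1 - A⁻¹ ^ 4) • (back A false m * across A false m) := by
      rw [← h1, ← h2]
      have h4 : across A true (m + 1) * back A true (m + 1) =
          across A true m * (braid A true m * braid A true m) * back A true m := by
        simp only [across, back, mul_assoc]
      rw [encircle_one, encircle_one, h4, braid_mul_self hA]
      simp only [mul_add, add_mul, map_add, map_mul, map_smul, mul_smul_comm, smul_mul_assoc,
        mul_one, turnback, shift_cap, shift_cup, mul_assoc, coef]
      simp
    have h5 := jw_mul_back hA hΔ false (k := 0) (m := m) (by omega)
    have h6 := jw_mul_across hA hΔ false (k := 0) (m := m) (by omega)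
    rw [shift_zero] at h5 h6
    rw [h3, mul_add, mul_smul_comm, ih (by omega), mul_smul_comm, ← mul_assoc, h5, smul_mul_assoc,
      h6, smul_smul, smul_smul, smul_smul, ← add_smul]
    congr 1
    simp only [circleFactor, coef]
    simp
    field_simp
    ring

/-- The factor by which a circle with `b` strands around `c` strands acts on the idempotent. -/
def encircleFactor (A : ℂ) (c : ℕ) : ℕ → ℂ
  | 0 => 1
  | 1 => circleFactor A c
  | b + 2 => circleFactor A c * encircleFactor A c (b + 1) - encircleFactor A c b

/-- Since `x` uses only `b` strands, the last strand of the band is a separate circle, the innermost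
one. So `y` is moved inside the other `b` strands (`hin`), where it meets this circle and turns it
into the scalar `a`. -/
theorem mul_encircle_succ (hA : A ≠ 0) {b m : ℕ} {x y : Planar A} (hx : x ∈ Hom A b b)
    (hy : y ∈ Hom A m m) {a : ℂ} (h : y * encircle 1 m 1 = a • y) :
    y * encircle (b + 1) m x = a • (y * encircle b m x) := by
  have h1 := mul_shift (nestedCups_mem (A := A) b) y
  have h3 := mul_shift hx (shift b y)
  rw [shift_zero] at h1
  rw [shift_shift] at h3
  have hin : ∀ w : Planar A, y * (nestedCups A b * x *
      shift b (bandCross A true b m * w * bandCross A true m b) * nestedCaps A b) =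
      nestedCups A b * x *
      shift b (bandCross A true b m * (y * w) * bandCross A true m b) * nestedCaps A b := by
    intro w
    have h4 : shift b y * (bandCross A true b m * w * bandCross A true m b) =
        bandCross A true b m * (y * w) * bandCross A true m b := by
      simp only [← mul_assoc]
      rw [shift_mul_bandCross hA true b hy]
    rw [← h4, map_mul _ (shift b y), shift_shift]
    simp only [← mul_assoc]
    rw [← h1, mul_assoc _ _ x, ← h3]
    simp only [mul_assoc]
  have hs : encircle (b + 1) m x = nestedCups A b * x *
      shift b (bandCross A true b m * encircle 1 m 1 * bandCross A true m b) * nestedCaps A b := by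
    have h5 := cup_mul_shift (le_refl b) (bandCross A true b m)
    have h6 := cap_mul_shift (le_refl b) (bandCross A true m b)
    rw [encircle_one, encircle, nestedCups, nestedCaps, bandCross, bandCross_succ_right']
    simp only [map_mul, shift_shift, shift_cup, shift_cap, zero_add, mul_assoc]
    rw [← mul_assoc (cup A b) x, cup_mul_comm hx, mul_assoc, ← mul_assoc (cup A b),
      add_comm 1 (b + 1), h5, mul_assoc, ← mul_assoc (cap A b), h6, mul_assoc, add_comm 1 b]
  have h1' := hin 1
  rw [mul_one, mul_one] at h1'
  rw [hs, hin, h, encircle, h1', mul_smul_comm, smul_mul_assoc, map_smul, mul_smul_comm,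
    smul_mul_assoc]

theorem encircle_sub (b m : ℕ) (x y : Planar A) :
    encircle b m (x - y) = encircle b m x - encircle b m y := by
  simp only [encircle, mul_sub, sub_mul]

theorem encircle_smul (b m : ℕ) (a : ℂ) (x : Planar A) :
    encircle b m (a • x) = a • encircle b m x := by
  simp only [encircle, mul_smul_comm, smul_mul_assoc]

/-- Under the trace, the correction term of the idempotent on `b + 2` strands closes up to the
idempotent on `b` strands, and its ratio cancels the partial closure. This leaves the Chebyshev
recursion of `encircleFactor`. -/
theorem jw_mul_encircle (hA : A ≠ 0) {b c : ℕ} (hb : ∀ i < b, delta A i ≠ 0)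
    (hc : ∀ i < c, delta A i ≠ 0) :
    jw A c * encircle b c (jw A b) = encircleFactor A c b • jw A c := by
  have h1 := jw_mul_circle hA hc c le_rfl
  induction b using Nat.strong_induction_on with
  | _ b ih =>
    match b with
    | 0 => simp [encircle, nestedCups, nestedCaps, jw_zero, encircleFactor, bandCross]
    | 1 => rw [jw_one, h1, encircleFactor]
    | b + 2 =>
      have hx : jw A (b + 1) * cap A b ∈ Hom A (b + 2) b :=
        hom_mul (hom_mono 1 (jw_mem (b + 1))) (hom_cap le_rfl)
      have hy : cup A b * jw A (b + 1) ∈ Hom A b (b + 2) :=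
        hom_mul (hom_cup le_rfl) (hom_mono 1 (jw_mem (b + 1)))
      have h2 := encircle_comm hA (m := c) hx hy
      have h3 : jw A (b + 1) * turnback A b * jw A (b + 1) =
          jw A (b + 1) * cap A b * (cup A b * jw A (b + 1)) := by
        simp only [turnback, mul_assoc]
      have h4 : cup A b * jw A (b + 1) * (jw A (b + 1) * cap A b) =
          (delta A (b + 1) / delta A b) • jw A b := by
        rw [← cup_jw_cap hA fun i hi => hb i (by omega), mul_assoc, ← mul_assoc (jw A (b + 1)),
          jw_mul_self hA fun i hi => hb i (by omega), mul_assoc]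
      have h5 := hb b (by omega)
      have h6 := hb (b + 1) (by omega)
      rw [jw_succ_succ, encircle_sub, encircle_smul, h3, h2, h4, encircle_smul, smul_smul,
        show delta A b / delta A (b + 1) * (delta A (b + 1) / delta A b) = 1 by field_simp,
        one_smul, mul_sub, mul_encircle_succ hA (jw_mem _) (jw_mem _) h1,
        ih (b + 1) (by omega) fun i hi => hb i (by omega), ih b (by omega) fun i hi => hb i (by omega),
        smul_smul, ← sub_smul, encircleFactor]

/-! ### Morphisms to and from idempotents -/

/-- Words in maxima that lead from `m` to `n` strands. -/
inductive CapWord (A : ℂ) : ℕ → ℕ → Planar A → Prop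
  | nil (m : ℕ) : CapWord A m m 1
  | cap {m n i : ℕ} {x : Planar A} : i ≤ m → CapWord A m n x → CapWord A (m + 2) n (cap A i * x)

/-- The combinations of words in maxima, followed by the idempotent. -/
def CapSpan (A : ℂ) (m n : ℕ) : Submodule ℂ (Planar A) :=
  Submodule.span ℂ {y | ∃ c, CapWord A m n c ∧ y = c * jw A n}

theorem cap_mul_capSpan {m n i : ℕ} (hi : i ≤ m) {y : Planar A} (hy : y ∈ CapSpan A m n) :
    cap A i * y ∈ CapSpan A (m + 2) n := by
  induction hy using Submodule.span_induction with
  | mem y hy =>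
    obtain ⟨c, hc, rfl⟩ := hy
    exact Submodule.subset_span ⟨_, .cap hi hc, by rw [mul_assoc]⟩
  | zero => rw [mul_zero]; exact zero_mem _
  | add y z _ _ hy hz => rw [mul_add]; exact add_mem hy hz
  | smul a y _ hy => rw [mul_smul_comm]; exact Submodule.smul_mem _ _ hy

/-- A minimum below a word of maxima rises until it cancels against one of them or reaches the
idempotent, which annihilates it. -/
theorem cup_mul_capWord (hA : A ≠ 0) {n : ℕ} (hΔ : ∀ i < n, delta A i ≠ 0) {l : ℕ} {c : Planar A}
    (h : CapWord A l n c) : ∀ m j, l = m + 2 → j ≤ m → cup A j * (c * jw A n) ∈ CapSpan A m n := by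
  have R := planarRelations A
  induction h with
  | nil n =>
    rintro m j rfl hj
    rw [one_mul, cup_mul_jw hA hΔ (by omega)]
    exact zero_mem _
  | @cap l n i c hi hc ih =>
    intro m j hm hj
    obtain rfl : l = m := by omega
    have hc' : c * jw A n ∈ CapSpan A l n := Submodule.subset_span ⟨c, hc, rfl⟩
    rw [mul_assoc]
    obtain rfl | rfl | rfl | h | h : i = j ∨ i = j + 1 ∨ j = i + 1 ∨ j + 2 ≤ i ∨ i + 2 ≤ j := by
      omega
    · rw [cup_cap_assoc]; exact Submodule.smul_mem _ _ hc'
    · rwa [cup_cap_succ_assoc]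
    · rwa [cup_succ_cap_assoc]
    · obtain ⟨i, rfl⟩ : ∃ i', i = i' + 2 := ⟨i - 2, by omega⟩
      obtain ⟨l, rfl⟩ : ∃ l', l = l' + 2 := ⟨l - 2, by omega⟩
      rw [← mul_assoc, R.cap_cup j i (by omega), mul_assoc]
      exact cap_mul_capSpan (by omega) (ih hΔ l j rfl (by omega))
    · obtain ⟨j, rfl⟩ : ∃ j', j = j' + 2 := ⟨j - 2, by omega⟩
      obtain ⟨l, rfl⟩ : ∃ l', l = l' + 2 := ⟨l - 2, by omega⟩
      rw [← mul_assoc, R.cup_cap i j (by omega), mul_assoc]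
      exact cap_mul_capSpan (by omega) (ih hΔ l j rfl (by omega))

theorem cup_mul_capSpan (hA : A ≠ 0) {m n j : ℕ} (hΔ : ∀ i < n, delta A i ≠ 0) (hj : j ≤ m)
    {y : Planar A} (hy : y ∈ CapSpan A (m + 2) n) : cup A j * y ∈ CapSpan A m n := by
  induction hy using Submodule.span_induction with
  | mem y hy =>
    obtain ⟨c, hc, rfl⟩ := hy
    exact cup_mul_capWord hA hΔ hc m j rfl hj
  | zero => rw [mul_zero]; exact zero_mem _
  | add y z _ _ hy hz => rw [mul_add]; exact add_mem hy hz
  | smul a y _ hy => rw [mul_smul_comm]; exact Submodule.smul_mem _ _ hy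

theorem mul_jw_mem_capSpan (hA : A ≠ 0) {m n : ℕ} (hΔ : ∀ i < n, delta A i ≠ 0) {x : Planar A}
    (h : x ∈ Hom A m n) : x * jw A n ∈ CapSpan A m n := by
  induction h using Submodule.span_induction with
  | mem x hx =>
    induction hx with
    | nil n => exact Submodule.subset_span ⟨1, .nil n, rfl⟩
    | cup h _ ih => rw [mul_assoc]; exact cup_mul_capSpan hA hΔ h (ih hΔ)
    | cap h _ ih => rw [mul_assoc]; exact cap_mul_capSpan h (ih hΔ)
  | zero => rw [zero_mul]; exact zero_mem _
  | add x y _ _ hx hy => rw [add_mul]; exact add_mem hx hy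
  | smul a x _ hx => rw [smul_mul_assoc]; exact Submodule.smul_mem _ _ hx

/-- Schur's lemma for distinct colours: after `mul_jw_mem_capSpan` every term begins with a maximum,
which the lower idempotent annihilates. -/
theorem jw_mul_jw_eq_zero (hA : A ≠ 0) {m n : ℕ} (hm : ∀ i < m, delta A i ≠ 0)
    (hn : ∀ i < n, delta A i ≠ 0) (hmn : m ≠ n) {x : Planar A} (h : x ∈ Hom A m n) :
    jw A m * (x * jw A n) = 0 := by
  have h' := mul_jw_mem_capSpan hA hn h
  generalize x * jw A n = y at h'
  induction h' using Submodule.span_induction with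
  | mem y hy =>
    obtain ⟨c, hc, rfl⟩ := hy
    cases hc with
    | nil => exact absurd rfl hmn
    | cap hi hc => rw [← mul_assoc, ← mul_assoc, jw_mul_cap hA hm (by omega), zero_mul, zero_mul]
  | zero => rw [mul_zero]
  | add y z _ _ hy hz => rw [mul_add, hy, hz, add_zero]
  | smul a y _ hy => rw [mul_smul_comm, hy, smul_zero]

theorem exists_jw_mul_jw_eq_smul (hA : A ≠ 0) {n : ℕ} (hn : ∀ i < n, delta A i ≠ 0)
    {x : Planar A} (h : x ∈ Hom A n n) : ∃ a : ℂ, jw A n * (x * jw A n) = a • jw A n := by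
  have h' := mul_jw_mem_capSpan hA hn h
  generalize x * jw A n = y at h'
  induction h' using Submodule.span_induction with
  | mem y hy =>
    obtain ⟨c, hc, rfl⟩ := hy
    cases hc with
    | nil => exact ⟨1, by rw [one_mul, jw_mul_self hA hn, one_smul]⟩
    | cap hi hc =>
      exact ⟨0, by rw [← mul_assoc, ← mul_assoc, jw_mul_cap hA hn (by omega)]; simp⟩
  | zero => exact ⟨0, by simp⟩
  | add y z _ _ hy hz =>
    obtain ⟨a, ha⟩ := hy
    obtain ⟨b, hb⟩ := hz
    exact ⟨a + b, by rw [mul_add, ha, hb, add_smul]⟩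
  | smul a y _ hy =>
    obtain ⟨b, hb⟩ := hy
    exact ⟨a * b, by rw [mul_smul_comm, hb, mul_smul]⟩

/-- The endomorphisms of `m` strands that factor through the idempotent on `c` strands. -/
def Through (A : ℂ) (m c : ℕ) : Submodule ℂ (Planar A) :=
  Submodule.span ℂ {z | ∃ x ∈ Hom A m c, ∃ y ∈ Hom A c m, z = x * jw A c * y}

/-- Adding a strand to the idempotent on `c` strands gives, by the recursion, the idempotent on `c +
1` strands and a term that factors through `c - 1`. For `c = 0` the first summand suffices, so the
truncated subtraction is harmless. -/
theorem through_le (hA : A ≠ 0) {m c : ℕ} (hΔ : ∀ i < c, delta A i ≠ 0) :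
    Through A m c ≤ Through A (m + 1) (c + 1) ⊔ Through A (m + 1) (c - 1) := by
  refine Submodule.span_le.2 ?_
  rintro _ ⟨x, hx, y, hy, rfl⟩
  have hx' := hom_mono 1 hx
  have hy' := hom_mono 1 hy
  match c with
  | 0 =>
    refine Submodule.mem_sup_left (Submodule.subset_span ⟨x, hx', y, hy', ?_⟩)
    rw [jw_zero, jw_one]
  | c + 1 =>
    have e : jw A (c + 1) * turnback A c * jw A (c + 1) =
        jw A (c + 1) * cap A c * jw A c * (cup A c * jw A (c + 1)) := by
      rw [mul_assoc (jw A (c + 1)) (cap A c), cap_mul_comm (jw_mem c),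
        ← mul_assoc _ (jw A c) (cap A c), jw_mul_jw hA hΔ (by omega)]
      simp only [turnback, mul_assoc]
    have h : x * jw A (c + 1) * y = x * jw A (c + 2) * y + (delta A c / delta A (c + 1)) •
        (x * (jw A (c + 1) * cap A c) * jw A c * (cup A c * jw A (c + 1) * y)) := by
      have : x * (jw A (c + 1) * cap A c) * jw A c * (cup A c * jw A (c + 1) * y) =
          x * (jw A (c + 1) * turnback A c * jw A (c + 1)) * y := by
        rw [e]; simp only [mul_assoc]
      rw [this, ← smul_mul_assoc, ← mul_smul_comm, ← add_mul, ← mul_add, jw_succ_succ,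
        sub_add_cancel]
    rw [h]
    have hj := hom_mono 1 (jw_mem (A := A) (c + 1))
    refine Submodule.add_mem_sup (Submodule.subset_span ⟨x, hx', y, hy', rfl⟩)
      (Submodule.smul_mem _ _ (Submodule.subset_span ⟨_, hom_mul hx' (hom_mul hj (hom_cap le_rfl)),
        _, hom_mul (hom_mul (hom_cup le_rfl) hj) hy', rfl⟩))

theorem one_sub_jw_mem (hA : A ≠ 0) {m : ℕ} (hΔ : ∀ i < m, delta A i ≠ 0) :
    1 - jw A m ∈ ⨆ c ∈ Finset.range m, Through A m c := by
  induction m with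
  | zero => simp [jw_zero]
  | succ m ih =>
    have h1 : ⨆ c ∈ Finset.range m, Through A m c ≤
        ⨆ c ∈ Finset.range (m + 1), Through A (m + 1) c := by
      refine iSup₂_le fun c hc => ?_
      rw [Finset.mem_range] at hc
      refine (through_le hA fun i hi => hΔ i (by omega)).trans (sup_le ?_ ?_)
      · exact le_iSup₂_of_le (c + 1) (Finset.mem_range.2 (by omega)) le_rfl
      · exact le_iSup₂_of_le (c - 1) (Finset.mem_range.2 (by omega)) le_rfl
    have h2 := h1 (ih fun i hi => hΔ i (by omega))
    match m with
    | 0 => simp [jw_one]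
    | m + 1 =>
      have e : 1 - jw A (m + 2) = (1 - jw A (m + 1)) + (delta A m / delta A (m + 1)) •
          (jw A (m + 1) * cap A m * jw A m * (cup A m * jw A (m + 1))) := by
        rw [mul_assoc (jw A (m + 1)) (cap A m), cap_mul_comm (jw_mem m),
          ← mul_assoc _ (jw A m) (cap A m), jw_mul_jw hA (fun i hi => hΔ i (by omega)) (by omega), jw_succ_succ]
        simp only [turnback, mul_assoc]
        abel
      have hj := hom_mono 1 (jw_mem (A := A) (m + 1))
      rw [e]
      refine add_mem h2 (Submodule.smul_mem _ _ ?_)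
      refine (le_iSup₂_of_le m (Finset.mem_range.2 (by omega)) le_rfl :
        Through A (m + 2) m ≤ _) (Submodule.subset_span ?_)
      exact ⟨_, hom_mul hj (hom_cap le_rfl), _, hom_mul (hom_cup le_rfl) hj, rfl⟩

/-! ### Pairs of idempotents -/

/-- Two neighbouring idempotents. -/
def jwPair (A : ℂ) (a : ℕ) : Planar A := jw A a * shift a (jw A a)

/-- Two neighbouring idempotents on `j + i` strands, with `i` nested maxima between them. -/
def fork (A : ℂ) (j i : ℕ) : Planar A := jwPair A (j + i) * shift j (nestedCaps A i)

theorem jwPair_comm (a : ℕ) : jwPair A a = shift a (jw A a) * jw A a :=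
  (mul_shift (jw_mem a) (jw A a))

theorem jwPair_mem (a : ℕ) : jwPair A a ∈ Hom A (2 * a) (2 * a) := by
  rw [two_mul]
  exact hom_mul (hom_mono a (jw_mem a)) (shift_mem a (jw_mem a))

@[simp] theorem flip_jwPair (a : ℕ) : flip (jwPair A a) = jwPair A a := by
  have h : flip (jwPair A a) = shift a (jw A a) * jw A a := by simp [jwPair]
  rw [h, jwPair_comm]

theorem jwPair_mul_self (hA : A ≠ 0) {a : ℕ} (hΔ : ∀ i < a, delta A i ≠ 0) :
    jwPair A a * jwPair A a = jwPair A a := by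
  have h := jw_mul_self hA hΔ
  conv_lhs => enter [2]; rw [jwPair_comm]
  rw [jwPair, mul_assoc, ← mul_assoc (shift a _), ← map_mul, h, ← mul_shift (jw_mem a), ← mul_assoc, h]

theorem jwPair_mul_left {a : ℕ} {x : Planar A}
    {c : ℂ} (h : jw A a * x = c • jw A a) : jwPair A a * x = c • jwPair A a := by
  rw [jwPair_comm, mul_assoc, h, mul_smul_comm]

theorem jwPair_mul_right {a : ℕ} {x : Planar A}
    {c : ℂ} (h : jw A a * x = c • jw A a) : jwPair A a * shift a x = c • jwPair A a := by
  rw [jwPair, mul_assoc, ← map_mul, h, map_smul, mul_smul_comm]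

theorem fork_mem (j i : ℕ) : fork A j i ∈ Hom A (2 * (j + i)) (2 * j) := by
  refine hom_mul (jwPair_mem _) ?_
  have := hom_mono j (shift_mem j (nestedCaps_mem (A := A) i))
  rwa [show j + (i + i) + j = 2 * (j + i) by omega, show j + 0 + j = 2 * j by omega] at this

/-- A maximum away from the middle joins two strands of the same idempotent once it has been moved
below the nested maxima. -/
theorem fork_mul_cap_eq_zero (hA : A ≠ 0) {j i l : ℕ} (hΔ : ∀ k < j + i, delta A k ≠ 0)
    (hl : l + 2 ≤ 2 * j) (hlj : l + 1 ≠ j) : fork A j i * cap A l = 0 := by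
  obtain h | h : l + 2 ≤ j ∨ j ≤ l := by omega
  · obtain ⟨k, rfl⟩ : ∃ k, j = k + 2 := ⟨j - 2, by omega⟩
    have h1 := cap_mul_shift (show l ≤ k by omega) (nestedCaps A i)
    have h2 := jw_mul_cap hA hΔ (i := l) (by omega)
    rw [fork, mul_assoc, ← h1, ← mul_assoc, jwPair_comm, mul_assoc _ _ (cap A l), h2, mul_zero,
      zero_mul]
  · have h1 := mul_shift (shift_mem j (nestedCaps_mem (A := A) i)) (cap A (l - j))
    have h2 := jw_mul_cap hA hΔ (i := l + i - j) (by omega)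
    simp only [shift_cap] at h1
    rw [show l - j + (j + 0) = l by omega,
      show l - j + (j + (i + i)) = l + i - j + (j + i) by omega] at h1
    rw [fork, mul_assoc, h1, ← mul_assoc, jwPair, mul_assoc (jw A (j + i)), ← shift_cap, ← map_mul,
      h2, map_zero, mul_zero, zero_mul]

theorem nestedCaps_succ' (n : ℕ) : nestedCaps A (n + 1) = shift 1 (nestedCaps A n) * cap A 0 := by
  rw [add_comm, nestedCaps_add]; simp [nestedCaps]

theorem fork_mul_cap (j i : ℕ) : fork A (j + 1) i * cap A j = fork A j (i + 1) := by
  rw [fork, fork, show j + 1 + i = j + (i + 1) by omega, mul_assoc, nestedCaps_succ', map_mul,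
    shift_shift, shift_cap, zero_add, add_comm 1 j]

/-- Each maximum either kills the fork or enlarges the nest in its middle, so a word of maxima
contributes at most one fork. -/
theorem fork_mul_capWord (hA : A ≠ 0) {m n : ℕ} {w : Planar A} (h : CapWord A m n w) :
    ∀ j i, m = 2 * j → (∀ k < j + i, delta A k ≠ 0) →
      (fork A j i * w = 0 ∨
        ∃ j' i', j' + i' = j + i ∧ n = 2 * j' ∧ fork A j i * w = fork A j' i') := by
  induction h with
  | nil m => exact fun j i hm _ => .inr ⟨j, i, rfl, hm, mul_one _⟩
  | @cap m n l x hl _ ih =>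
    intro j i hm hΔ
    by_cases h : l + 1 = j
    · subst h
      obtain h | ⟨j', i', h1, h2, h3⟩ := ih l (i + 1) (by omega) fun k hk => hΔ k (by omega)
      · left; rw [← mul_assoc, fork_mul_cap, h]
      · right; exact ⟨j', i', by omega, h2, by rw [← mul_assoc, fork_mul_cap, h3]⟩
    · left; rw [← mul_assoc, fork_mul_cap_eq_zero hA hΔ (by omega) h, zero_mul]

/-- Hence morphisms from the pair to one idempotent form a space of dimension at most one, and they
vanish unless that colour is `2 * j` with `j ≤ a`. -/
theorem jwPair_mul_capSpan (hA : A ≠ 0) {a n : ℕ} (ha : ∀ k < a, delta A k ≠ 0)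
    {y : Planar A} (h : y ∈ CapSpan A (2 * a) n) :
    (∃ j i, j + i = a ∧ n = 2 * j ∧ ∃ c : ℂ, jwPair A a * y = c • (fork A j i * jw A n)) ∨
      jwPair A a * y = 0 := by
  induction h using Submodule.span_induction with
  | mem y hy =>
    obtain ⟨w, hw, rfl⟩ := hy
    have e : jwPair A a = fork A a 0 := by simp [fork, nestedCaps]
    obtain h | ⟨j, i, h1, h2, h3⟩ := fork_mul_capWord hA hw a 0 rfl ha
    · right; rw [e, ← mul_assoc, h, zero_mul]
    · left; exact ⟨j, i, h1, h2, 1, by rw [e, ← mul_assoc, h3, one_smul]⟩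
  | zero => right; simp
  | add y z _ _ hy hz =>
    obtain ⟨j, i, h1, h2, c, hc⟩ | hy := hy
    · left
      refine ⟨j, i, h1, h2, ?_⟩
      obtain ⟨j', i', h1', h2', d, hd⟩ | hz := hz
      · obtain rfl : j = j' := by omega
        obtain rfl : i = i' := by omega
        exact ⟨c + d, by rw [mul_add, hc, hd, add_smul]⟩
      · exact ⟨c, by rw [mul_add, hc, hz, add_zero]⟩
    · rw [mul_add, hy, zero_add]; exact hz
  | smul a y _ hy =>
    obtain ⟨j, i, h1, h2, c, hc⟩ | hy := hy
    · left; exact ⟨j, i, h1, h2, a * c, by rw [mul_smul_comm, hc, mul_smul]⟩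
    · right; rw [mul_smul_comm, hy, smul_zero]

/-- The vertex that joins an idempotent on `2 * j` strands to two idempotents on `j + i`
strands. -/
def vertex (A : ℂ) (j i : ℕ) : Planar A := fork A j i * jw A (2 * j)

theorem vertex_mem (j i : ℕ) : vertex A j i ∈ Hom A (2 * (j + i)) (2 * j) :=
  hom_mul (fork_mem j i) (jw_mem _)

theorem jwPair_mul_vertex (hA : A ≠ 0) {j i : ℕ} (hΔ : ∀ k < j + i, delta A k ≠ 0) :
    jwPair A (j + i) * vertex A j i = vertex A j i := by
  rw [vertex, fork, ← mul_assoc, ← mul_assoc, jwPair_mul_self hA hΔ]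

theorem exists_jwPair_mul_through (hA : A ≠ 0) {j i : ℕ} (hΔ : ∀ k < j + i, delta A k ≠ 0)
    (hj : ∀ k < 2 * j, delta A k ≠ 0) {z : Planar A} (h : z ∈ Through A (2 * (j + i)) (2 * j)) :
    ∃ c : ℂ, jwPair A (j + i) * z * jwPair A (j + i) =
      c • (vertex A j i * flip (vertex A j i)) := by
  have key : ∀ x ∈ Hom A (2 * (j + i)) (2 * j), ∃ c : ℂ,
      jwPair A (j + i) * x * jw A (2 * j) = c • vertex A j i := by
    intro x hx
    obtain ⟨j', i', h1, h2, c, hc⟩ | h := jwPair_mul_capSpan hA hΔ (mul_jw_mem_capSpan hA hj hx)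
    · obtain rfl : j = j' := by omega
      obtain rfl : i = i' := by omega
      exact ⟨c, by rw [mul_assoc, hc, vertex]⟩
    · exact ⟨0, by rw [mul_assoc, h, zero_smul]⟩
  induction h using Submodule.span_induction with
  | mem z hz =>
    obtain ⟨x, hx, y, hy, rfl⟩ := hz
    obtain ⟨c, hc⟩ := key x hx
    obtain ⟨d, hd⟩ := key (flip y) (flip_mem hy)
    have hd' := congrArg flip hd
    simp only [flip_mul, flip_jwPair, flip_jw, flip_flip, flip_smul] at hd'
    refine ⟨c * d, ?_⟩
    calc _ = (jwPair A (j + i) * x * jw A (2 * j)) * (jw A (2 * j) * (y * jwPair A (j + i))) := by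
          conv_lhs => rw [← jw_mul_self hA hj]
          simp only [mul_assoc]
      _ = _ := by rw [hc, hd', smul_mul_assoc, mul_smul_comm, smul_smul]
  | zero => exact ⟨0, by simp⟩
  | add y z _ _ hy hz =>
    obtain ⟨c, hc⟩ := hy
    obtain ⟨d, hd⟩ := hz
    exact ⟨c + d, by rw [mul_add, add_mul, hc, hd, add_smul]⟩
  | smul a y _ hy =>
    obtain ⟨c, hc⟩ := hy
    exact ⟨a * c, by rw [mul_smul_comm, smul_mul_assoc, hc, mul_smul]⟩

theorem jwPair_mul_through_eq_zero (hA : A ≠ 0) {a n : ℕ} (ha : ∀ k < a, delta A k ≠ 0)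
    (hn : ∀ k < n, delta A k ≠ 0) (h : ∀ j ≤ a, n ≠ 2 * j) {z : Planar A}
    (hz : z ∈ Through A (2 * a) n) : jwPair A a * z = 0 := by
  induction hz using Submodule.span_induction with
  | mem z hz =>
    obtain ⟨x, hx, y, hy, rfl⟩ := hz
    obtain ⟨j', i', h1, h2, c, hc⟩ | h := jwPair_mul_capSpan hA ha (mul_jw_mem_capSpan hA hn hx)
    · exact absurd h2 (h j' (by omega))
    · rw [← mul_assoc, h, zero_mul]
  | zero => simp
  | add y z _ _ hy hz => rw [mul_add, hy, hz, add_zero]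
  | smul a y _ hy => rw [mul_smul_comm, hy, smul_zero]

theorem through_mul_jw_eq_zero (hA : A ≠ 0) {m n c : ℕ} (hc : ∀ k < c, delta A k ≠ 0)
    (hn : ∀ k < n, delta A k ≠ 0) (h : c ≠ n) {z w : Planar A}
    (hz : z ∈ Through A m c) (hw : w ∈ Hom A m n) : z * (w * jw A n) = 0 := by
  induction hz using Submodule.span_induction with
  | mem z hz =>
    obtain ⟨x, hx, y, hy, rfl⟩ := hz
    have := jw_mul_jw_eq_zero hA hc hn h (hom_mul hy hw)
    rw [mul_assoc, mul_assoc, ← mul_assoc y, this, mul_zero]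
  | zero => simp
  | add y z _ _ hy hz => rw [add_mul, hy, hz, add_zero]
  | smul a y _ hy => rw [smul_mul_assoc, hy, smul_zero]

/-! ### Fusion -/

theorem sum_range_two_mul {M : Type*} [AddCommMonoid M] (f : ℕ → M) (a : ℕ)
    (h : ∀ j < a, f (2 * j + 1) = 0) :
    ∑ c ∈ Finset.range (2 * a + 1), f c = ∑ j ∈ Finset.range (a + 1), f (2 * j) := by
  induction a with
  | zero => simp
  | succ a ih =>
    rw [show 2 * (a + 1) + 1 = 2 * a + 1 + 1 + 1 by ring, Finset.sum_range_succ,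
      Finset.sum_range_succ, ih fun j hj => h j (by omega), h a (by omega), add_zero,
      Finset.sum_range_succ _ (a + 1)]
    rfl

/-- The decomposition of the identity into colours, without naming coefficients. -/
theorem exists_sum_through_eq_one (hA : A ≠ 0) {m : ℕ} (hΔ : ∀ i < m, delta A i ≠ 0) :
    ∃ z : ℕ → Planar A, (∀ c, z c ∈ Through A m c) ∧ ∑ c ∈ Finset.range (m + 1), z c = 1 := by
  have h1 : jw A m ∈ ⨆ c ∈ Finset.range (m + 1), Through A m c :=
    (le_iSup₂_of_le m (by simp) le_rfl : Through A m m ≤ _)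
      (Submodule.subset_span ⟨1, hom_one _, 1, hom_one _, by simp⟩)
  have h2 : ⨆ c ∈ Finset.range m, Through A m c ≤ ⨆ c ∈ Finset.range (m + 1), Through A m c :=
    biSup_mono fun c hc => by simp at hc ⊢; omega
  have h3 := add_mem h1 (h2 (one_sub_jw_mem hA hΔ))
  rw [add_sub_cancel, Submodule.mem_iSup_finset_iff_exists_sum] at h3
  obtain ⟨z, hz⟩ := h3
  exact ⟨fun c => z c, fun c => (z c).2, hz⟩

theorem exists_flip_vertex_mul_vertex (hA : A ≠ 0) {j i : ℕ} (hj : ∀ k < 2 * j, delta A k ≠ 0) :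
    ∃ c : ℂ, flip (vertex A j i) * vertex A j i = c • jw A (2 * j) := by
  obtain ⟨c, hc⟩ := exists_jw_mul_jw_eq_smul hA hj
    (hom_mul (flip_mem (fork_mem (A := A) j i)) (fork_mem j i))
  exact ⟨c, by rw [← hc, vertex, flip_mul, flip_jw]; simp only [mul_assoc]⟩

/-- A trace of an endomorphism of a pair of idempotents is expressed by the eigenvalues of the
endomorphism. -/
theorem exists_fusion (hA : A ≠ 0) {a : ℕ} (hΔ : ∀ i < 2 * a, delta A i ≠ 0) :
    ∃ μ : ℕ → ℂ, (∀ j i, j + i = a → vertex A j i ≠ 0 → μ j = 1) ∧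
      ∀ T : ℕ → Planar A →ₗ[ℂ] Planar A,
        (∀ m n, ∀ x ∈ Hom A m n, ∀ y ∈ Hom A n m, T m (x * y) = T n (y * x)) →
      ∀ σ ∈ Hom A (2 * a) (2 * a), jwPair A a * σ = σ * jwPair A a →
      ∀ l : ℕ → ℂ, (∀ j i, j + i = a → σ * vertex A j i = l j • vertex A j i) →
        T (2 * a) (jwPair A a * σ) =
          ∑ j ∈ Finset.range (a + 1), (l j * μ j) • T (2 * j) (jw A (2 * j)) := by
  have ha : ∀ k < a, delta A k ≠ 0 := fun k hk => hΔ k (by omega)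
  have hP := jwPair_mul_self hA ha
  obtain ⟨z, hz, hz1⟩ := exists_sum_through_eq_one hA hΔ
  have hzm : ∀ c, z c ∈ Hom A (2 * a) (2 * a) := fun c => by
    refine (Submodule.span_le.2 ?_ : Through A (2 * a) c ≤ _) (hz c)
    rintro _ ⟨x, hx, y, hy, rfl⟩
    exact hom_mul (hom_mul hx (jw_mem c)) hy
  -- Neither the coefficient `c` of a channel nor the norm `n` of its vertex is computed. Only their
  -- product enters the trace, and a nonzero vertex forces it to be `1`.
  have key : ∀ j, ∃ m : ℂ, ∀ i, j + i = a → (vertex A j i ≠ 0 → m = 1) ∧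
      ∃ c : ℂ, ∃ n : ℂ, m = c * n ∧
      jwPair A a * z (2 * j) * jwPair A a = c • (vertex A j i * flip (vertex A j i)) ∧
      flip (vertex A j i) * vertex A j i = n • jw A (2 * j) := by
    intro j
    by_cases hja : j ≤ a
    swap
    · exact ⟨0, fun i hi => by omega⟩
    obtain ⟨i, rfl⟩ : ∃ i, a = j + i := ⟨a - j, by omega⟩
    have hj : ∀ k < 2 * j, delta A k ≠ 0 := fun k hk => hΔ k (by omega)
    obtain ⟨c, hc⟩ := exists_jwPair_mul_through hA ha hj (hz (2 * j))
    obtain ⟨n, hn⟩ := exists_flip_vertex_mul_vertex (i := i) hA hj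
    refine ⟨c * n, fun i' hi' => ?_⟩
    obtain rfl : i = i' := by omega
    refine ⟨fun hv => ?_, c, n, rfl, hc, hn⟩
    have hPv := jwPair_mul_vertex hA ha
    have h1 : z (2 * j) * vertex A j i = vertex A j i := by
      have h2 : ∑ c ∈ Finset.range (2 * (j + i) + 1), z c * vertex A j i = vertex A j i := by
        rw [← Finset.sum_mul, hz1, one_mul]
      rw [Finset.sum_eq_single (2 * j)] at h2
      · exact h2
      · intro c hc hcj
        rw [Finset.mem_range] at hc
        exact through_mul_jw_eq_zero hA (fun k hk => hΔ k (by omega)) hj hcj (hz c) (fork_mem j i)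
      · intro h; exact absurd (Finset.mem_range.2 (by omega)) h
    -- Evaluate the pair, `z (2 * j)` and the pair on the vertex in two ways: by the norm, and by
    -- the fact that only this channel of the identity acts on the vertex.
    have h3 : (c * n) • vertex A j i = vertex A j i := by
      calc (c * n) • vertex A j i = c • (vertex A j i * (n • jw A (2 * j))) := by
            rw [mul_smul, mul_smul_comm, vertex, mul_assoc, jw_mul_self hA hj]
        _ = jwPair A (j + i) * z (2 * j) * jwPair A (j + i) * vertex A j i := by
            rw [hc, smul_mul_assoc, mul_assoc, hn]
        _ = _ := by rw [mul_assoc, hPv, mul_assoc, h1, hPv]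
    by_contra hne
    refine hv ?_
    have : (c * n - 1) • vertex A j i = 0 := by rw [sub_smul, h3, one_smul, sub_self]
    exact (smul_eq_zero.1 this).resolve_left (sub_ne_zero.2 hne)
  choose m hm using key
  refine ⟨m, fun j i hji hv => (hm j i hji).1 hv, fun T hT σ hσ hPσ l hl => ?_⟩
  have hPm := jwPair_mem (A := A) a
  have e : T (2 * a) (jwPair A a * σ) =
      ∑ c ∈ Finset.range (2 * a + 1), T (2 * a) (jwPair A a * σ * z c) := by
    rw [← map_sum, ← Finset.mul_sum, hz1, mul_one]
  rw [e, sum_range_two_mul _ a]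
  · refine Finset.sum_congr rfl fun j hj => ?_
    rw [Finset.mem_range] at hj
    obtain ⟨i, rfl⟩ : ∃ i, a = j + i := ⟨a - j, by omega⟩
    obtain ⟨-, c, n, hmc, hc, hn⟩ := hm j i rfl
    have hv := vertex_mem (A := A) j i
    -- The idempotent pair is doubled and one copy is carried around the trace, so that `z` stands
    -- between two copies.
    have h1 : T (2 * (j + i)) (jwPair A (j + i) * σ * z (2 * j)) =
        T (2 * (j + i)) (σ * (jwPair A (j + i) * z (2 * j) * jwPair A (j + i))) := by
      have h2 := hT _ _ (σ * (jwPair A (j + i) * z (2 * j)))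
        (hom_mul hσ (hom_mul hPm (hzm _))) _ hPm
      have h3 : jwPair A (j + i) * (σ * (jwPair A (j + i) * z (2 * j))) =
          jwPair A (j + i) * σ * z (2 * j) := by
        rw [← mul_assoc, hPσ, mul_assoc, ← mul_assoc (jwPair A _) (jwPair A _), hP, ← mul_assoc]
      rw [← mul_assoc σ, h2, h3]
    rw [h1, hc, mul_smul_comm, ← mul_assoc, hl j i rfl, smul_mul_assoc, map_smul, map_smul,
      hT _ _ _ hv _ (flip_mem hv), hn, map_smul, smul_smul, smul_smul, hmc]
    congr 1; ring
  · intro j hj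
    rw [hPσ, mul_assoc, jwPair_mul_through_eq_zero hA ha (fun k hk => hΔ k (by omega)) (by omega)
      (hz _), mul_zero, map_zero]

/-! ### Twists -/

theorem bandCross_mul_bandCross_not (hA : A ≠ 0) (s : Bool) (a b : ℕ) :
    bandCross A s a b * bandCross A (!s) b a = 1 := by
  induction a with
  | zero => simp [bandCross]
  | succ a ih =>
    rw [bandCross, bandCross_succ_right', mul_assoc, ← mul_assoc (across A s b),
      across_mul_back hA, one_mul, ← map_mul, ih, map_one]

theorem jw_mul_bandCross (hA : A ≠ 0) {n : ℕ} (hΔ : ∀ i < n, delta A i ≠ 0) (s : Bool)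
    (a b k : ℕ) (h : k + (a + b) ≤ n) :
    jw A n * shift k (bandCross A s a b) = coef A s ^ (a * b) • jw A n := by
  induction a generalizing k with
  | zero => simp [bandCross]
  | succ a ih =>
    rw [bandCross, map_mul, shift_shift, ← mul_assoc, ih (1 + k) (by omega), smul_mul_assoc,
      jw_mul_across hA hΔ s (by omega), smul_smul, ← pow_add]
    congr 2; ring

theorem jwPair_mul_bandCross (hA : A ≠ 0) (s : Bool) (a : ℕ) :
    jwPair A a * bandCross A s a a = bandCross A s a a * jwPair A a := by
  have h := jw_mem (A := A) a
  rw [jwPair, mul_assoc, shift_mul_bandCross hA s a h, ← mul_assoc, mul_bandCross hA s a h,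
    mul_assoc, ← jwPair_comm, jwPair]

/-- The two strands joined by the maximum cross each other once, which gives the framing factor `-A
^ 3`. The rest of this arc then slides off the crossing of the other strands, leaving `b` positive
crossings on each side, within reach of the two idempotents. -/
theorem bandCross_mul_cap (hA : A ≠ 0) (b : ℕ) :
    bandCross A false (b + 1) (b + 1) * cap A b = (-A ^ 3) •
      (across A true b * shift (b + 1) (back A true b) * cap A b * bandCross A false b b) := by
  have hx := braid_cap hA false b
  have h1 : across A false b * cap A b = shift 1 (back A true b) * cap A 0 :=
    (shift_back_cap hA true b).symm
  have h2 : across A true b * cap A b = shift 1 (back A false b) * cap A 0 :=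
    (shift_back_cap hA false b).symm
  have h3 : bandCross A false b b * shift b (back A false b) * back A true b =
      shift b (back A true b) * back A false b * shift 1 (bandCross A false b b) := by
    rw [← bandCross_succ_right, ← shift_mul_bandCross hA false b (back_mem true b),
      bandCross_succ_right', mul_assoc]
  have h4 : cap A 0 * bandCross A false b b = shift 2 (bandCross A false b b) * cap A 0 := by
    simpa using cap_mul_shift (le_refl 0) (bandCross A false b b)
  have h5 := mul_shift (across_mem (A := A) true b) (back A true b)
  have h3' := congrArg (shift 1) h3
  simp only [map_mul, shift_shift] at h3'
  rw [h5, bandCross, bandCross_succ_right, across, map_mul, mul_assoc, mul_assoc _ _ (cap A b), hx,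
    mul_smul_comm, mul_smul_comm, h1, mul_assoc _ (across A true b), h2, shift_shift,
    ← mul_assoc, h3']
  simp only [mul_assoc, h4]
  simp [coef]

/-- The factor by which a crossing of two idempotents on `j + i` strands acts on the vertex with
the idempotent on `2 * j` strands. -/
def twistFactor (A : ℂ) (j i : ℕ) : ℂ :=
  (-1) ^ i * A ^ (i ^ 2 + 2 * i * j + 2 * i) * A⁻¹ ^ j ^ 2

/-- The smaller idempotents slide below the maximum and are absorbed by the larger pair; read
backwards, this supplies the pair needed for the induction on nested maxima. -/
theorem jwPair_mul_cap (hA : A ≠ 0) {b : ℕ} (hΔ : ∀ k < b + 1, delta A k ≠ 0) :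
    jwPair A (b + 1) * cap A b * jwPair A b = jwPair A (b + 1) * cap A b := by
  have h1 := jw_mul_jw hA hΔ (Nat.le_succ b)
  have h2 := jw_mul_shift_jw hA hΔ 1 b (by omega)
  have h3 := cap_mul_shift (le_refl b) (jw A b)
  have h4 : jwPair A (b + 1) * shift (b + 2) (jw A b) = jwPair A (b + 1) := by
    have := jwPair_mul_right (c := 1) (x := shift 1 (jw A b)) (by rw [h2, one_smul])
    rwa [one_smul, shift_shift, show 1 + (b + 1) = b + 2 by omega] at this
  have h5 : jwPair A (b + 1) * jw A b = jwPair A (b + 1) := by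
    rw [jwPair_comm, mul_assoc, h1]
  calc _ = jwPair A (b + 1) * (cap A b * shift b (jw A b)) * jw A b := by
        rw [jwPair_comm b]; simp only [mul_assoc]
    _ = jwPair A (b + 1) * (cap A b * jw A b) := by
        rw [h3, ← mul_assoc, h4, mul_assoc]
    _ = _ := by rw [cap_mul_comm (jw_mem b), ← mul_assoc, h5]

/-- Without maxima, the idempotent on `2 * j` strands absorbs `j ^ 2` crossings. Each further
maximum contributes `-A ^ 3` from its own crossing and `A ^ b` from either side, with `b = j + i`.
-/
theorem jwPair_mul_bandCross_mul_nestedCaps (hA : A ≠ 0) {j : ℕ} (i : ℕ)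
    (hΔ : ∀ k < j + i, delta A k ≠ 0) (hj : ∀ k < 2 * j, delta A k ≠ 0) :
    jwPair A (j + i) * bandCross A false (j + i) (j + i) * shift j (nestedCaps A i) *
      jw A (2 * j) = twistFactor A j i • vertex A j i := by
  induction i with
  | zero =>
    have h := congrArg flip (jw_mul_bandCross hA hj false j j 0 (by omega))
    simp only [shift_zero, flip_mul, flip_jw, flip_bandCross, flip_smul] at h
    simp only [add_zero, nestedCaps, map_one, mul_one, mul_assoc, h, vertex, fork, mul_smul_comm]
    congr 1
    simp [twistFactor, coef, sq]
  | succ i ih =>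
    set b := j + i with hb
    have h1 : j + (i + 1) = b + 1 := by omega
    have h2 : shift j (nestedCaps A (i + 1)) = cap A b * shift j (nestedCaps A i) := by
      rw [nestedCaps, map_mul, shift_cap, add_comm i j]
    have h3 : jwPair A (b + 1) * across A true b = A ^ b • jwPair A (b + 1) := by
      have := jw_mul_across hA (n := b + 1) (fun k hk => hΔ k (by omega)) true (k := 0) (m := b)
        (by omega)
      rw [shift_zero] at this
      exact jwPair_mul_left this
    have h4 : jwPair A (b + 1) * shift (b + 1) (back A true b) = A ^ b • jwPair A (b + 1) := by
      have := jw_mul_back hA (n := b + 1) (fun k hk => hΔ k (by omega)) true (k := 0) (m := b)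
        (by omega)
      rw [shift_zero] at this
      exact jwPair_mul_right this
    have h5 := ih fun k hk => hΔ k (by omega)
    have h6 := jwPair_mul_cap hA (b := b) fun k hk => hΔ k (by omega)
    have h7 : jwPair A (b + 1) * bandCross A false (b + 1) (b + 1) * cap A b =
        (-A ^ 3 * A ^ b * A ^ b) •
          (jwPair A (b + 1) * cap A b * (jwPair A b * bandCross A false b b)) := by
      rw [mul_assoc, bandCross_mul_cap hA, mul_smul_comm, ← mul_assoc, ← mul_assoc, ← mul_assoc,
        h3, smul_mul_assoc, smul_mul_assoc, smul_mul_assoc, h4, smul_mul_assoc, smul_mul_assoc,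
        smul_smul, smul_smul, ← mul_assoc, h6]
    have h8 : vertex A j (i + 1) = jwPair A (b + 1) * cap A b * vertex A j i := by
      rw [vertex, fork, h1, h2, vertex, fork, ← hb]
      conv_lhs => rw [← mul_assoc, ← h6]
      simp only [mul_assoc]
    rw [h1, h2, h8, ← mul_assoc, h7, smul_mul_assoc, smul_mul_assoc,
      mul_assoc (jwPair A (b + 1) * cap A b), mul_assoc (jwPair A (b + 1) * cap A b), h5,
      mul_smul_comm, smul_smul]
    congr 1
    rw [twistFactor, twistFactor, hb]
    ring

theorem bandCross_mul_vertex (hA : A ≠ 0) {j i : ℕ}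
    (hΔ : ∀ k < j + i, delta A k ≠ 0) (hj : ∀ k < 2 * j, delta A k ≠ 0) :
    bandCross A false (j + i) (j + i) * vertex A j i = twistFactor A j i • vertex A j i := by
  rw [← jwPair_mul_bandCross_mul_nestedCaps hA i hΔ hj, jwPair_mul_bandCross hA, vertex, fork]
  simp only [mul_assoc]

/-- One idempotent at the nested maxima is enough: a turnback on the left legs is carried over to
the right legs, where the idempotent annihilates it. -/
theorem shift_jw_mul_jw_mul_nestedCaps (hA : A ≠ 0) {a : ℕ} (hΔ : ∀ k < a, delta A k ≠ 0)
    {m : ℕ} (hm : m ≤ a) : shift a (jw A a) * (jw A m * nestedCaps A a) =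
      shift a (jw A a) * nestedCaps A a := by
  induction m using Nat.strong_induction_on with
  | _ m ih =>
    match m with
    | 0 => simp [jw_zero]
    | 1 => simp [jw_one]
    | m + 2 =>
      obtain ⟨n, rfl⟩ : ∃ n, a = n + 2 := ⟨a - 2, by omega⟩
      have h1 := ih (m + 1) (by omega) (by omega)
      have hx : jw A (m + 1) * turnback A m ∈ Hom A (n + 2) (n + 2) := by
        refine hom_mul ?_ (turnback_mem (by omega))
        have := hom_mono (n + 1 - m) (jw_mem (A := A) (m + 1))
        rwa [show m + 1 + (n + 1 - m) = n + 2 by omega] at this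
      have hz : shift (n + 2) (jw A (n + 2)) * (jw A (m + 1) * turnback A m * jw A (m + 1) *
          nestedCaps A (n + 2)) = 0 := by
        rw [mul_assoc _ (jw A (m + 1)), ← mul_assoc, ← mul_shift hx, mul_assoc, h1, ← mul_assoc,
          mul_shift hx, mul_assoc, mul_assoc (jw A (m + 1)), turnback_mul_nestedCaps n m (by omega),
          ← mul_assoc, ← mul_shift (y := jw A (n + 2)) (n := n + 2) (m := n + 2), mul_assoc,
          ← mul_assoc (shift (n + 2) _), ← map_mul, jw_mul_turnback hA hΔ (by omega), map_zero, zero_mul,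
          mul_zero]
        have := hom_mono (n + 1 - m) (jw_mem (A := A) (m + 1))
        rwa [show m + 1 + (n + 1 - m) = n + 2 by omega] at this
      rw [jw_succ_succ m, sub_mul, mul_sub, h1, smul_mul_assoc, mul_smul_comm, hz, smul_zero, sub_zero]

theorem jw_mul_shift_jw_mul_nestedCaps (hA : A ≠ 0) {a : ℕ} (hΔ : ∀ k < a, delta A k ≠ 0)
    {m : ℕ} (hm : m ≤ a) : jw A a * (shift a (jw A m) * nestedCaps A a) =
      jw A a * nestedCaps A a := by
  induction m using Nat.strong_induction_on with
  | _ m ih =>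
    match m with
    | 0 => simp [jw_zero]
    | 1 => simp [jw_one]
    | m + 2 =>
      obtain ⟨n, rfl⟩ : ∃ n, a = n + 2 := ⟨a - 2, by omega⟩
      have h1 := ih (m + 1) (by omega) (by omega)
      have hc := fun y => mul_shift (jw_mem (A := A) (n + 2)) y
      have ht : turnback A (n - m) * nestedCaps A (n + 2) =
          shift (n + 2) (turnback A m) * nestedCaps A (n + 2) := by
        rw [turnback_mul_nestedCaps n (n - m) (by omega), Nat.sub_sub_self (by omega)]
      have hz : jw A (n + 2) * (shift (n + 2) (jw A (m + 1) * turnback A m * jw A (m + 1)) *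
          nestedCaps A (n + 2)) = 0 := by
        rw [map_mul _ _ (jw A (m + 1)), mul_assoc, ← mul_assoc, hc, mul_assoc, h1, ← mul_assoc,
          ← hc, mul_assoc, map_mul, mul_assoc, ← ht, ← mul_assoc, hc, mul_assoc,
          ← mul_assoc (jw A (n + 2)), jw_mul_turnback hA hΔ (by omega), zero_mul, mul_zero]
      rw [jw_succ_succ m, map_sub, map_smul, sub_mul, mul_sub, h1, smul_mul_assoc, mul_smul_comm, hz,
        smul_zero, sub_zero]

/-- The positive crossing to the left of the nested minima equals a negative one to their right
(`h1`). There it meets nested maxima, the vertex of channel `0`, and acts by its eigenvalue; a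
zigzag remains. -/
theorem jw_mul_kink (hA : A ≠ 0) {a : ℕ} (hΔ : ∀ k < a, delta A k ≠ 0) :
    jw A a * (shift a (nestedCups A a) * bandCross A true a a * shift a (nestedCaps A a)) =
      twistFactor A 0 a • jw A a := by
  have h0 := mul_shift (nestedCups_mem (A := A) a) (jw A a)
  rw [shift_zero] at h0
  have h1 : shift a (nestedCups A a) * bandCross A true a a =
      nestedCups A a * shift a (bandCross A false a a) := by
    have := shift_mul_bandCross hA true a (nestedCups_mem (A := A) a)
    rw [bandCross_zero_right, one_mul, bandCross_add_right] at this
    have h := bandCross_mul_bandCross_not hA true a a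
    rw [Bool.not_true] at h
    calc _ = shift a (nestedCups A a) * bandCross A true a a *
          shift a (bandCross A true a a * bandCross A false a a) := by rw [h, map_one, mul_one]
      _ = _ := by rw [map_mul, ← mul_assoc, mul_assoc (shift a _), this]
  have h2 : shift a (jw A a) * (bandCross A false a a * nestedCaps A a) =
      twistFactor A 0 a • (shift a (jw A a) * nestedCaps A a) := by
    have h3 := shift_jw_mul_jw_mul_nestedCaps hA hΔ le_rfl
    have h4 := jw_mul_shift_jw_mul_nestedCaps hA hΔ le_rfl
    have h5 := jwPair_mul_bandCross_mul_nestedCaps hA (j := 0) a (by simpa using hΔ) (by simp)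
    simp only [zero_add, shift_zero, jw_zero, mul_one, vertex, fork, mul_zero] at h5
    rw [← mul_assoc, shift_mul_bandCross hA false a (jw_mem a), mul_assoc, ← h4, ← mul_assoc (jw A a),
      ← jwPair, ← mul_assoc, ← jwPair_mul_bandCross hA, h5, jwPair_comm, mul_assoc, h3]
  have h6 := congrArg (shift a) h2
  rw [map_mul, map_smul, map_mul, map_mul, shift_shift] at h6
  rw [h1, mul_assoc, ← mul_assoc, ← h0, mul_assoc, h6, mul_smul_comm, ← mul_assoc, h0, mul_assoc,
    nestedCups_zigzag, mul_one]

/-! ### Vertices that do not vanish -/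

theorem nestedCups_jwPair_nestedCaps (hA : A ≠ 0) {a : ℕ} (hΔ : ∀ k < a, delta A k ≠ 0) {m : ℕ}
    (hm : m ≤ a) : nestedCups A a * (jw A a * (shift a (jw A m) * nestedCaps A a)) =
      delta A a • 1 := by
  rw [jw_mul_shift_jw_mul_nestedCaps hA hΔ hm, ← mul_assoc, nestedCups_jw_nestedCaps]

/-- Closing this vertex by nested minima gives `Δ_a`. -/
theorem vertex_zero_ne_zero (hA : A ≠ 0) {a : ℕ} (hΔ : ∀ k ≤ a, delta A k ≠ 0) :
    vertex A 0 a ≠ 0 := by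
  have := planar_nontrivial hA
  intro h
  have h1 := nestedCups_jwPair_nestedCaps hA (fun k hk => hΔ k hk.le) (le_refl a)
  rw [vertex, fork, mul_zero, jw_zero, mul_one, zero_add, shift_zero, jwPair, mul_assoc] at h
  rw [h, mul_zero] at h1
  exact hΔ a le_rfl ((smul_eq_zero.1 h1.symm).resolve_right one_ne_zero)

theorem jw_ne_zero (hA : A ≠ 0) {n : ℕ} (hn : delta A n ≠ 0) : jw A n ≠ 0 := by
  have := planar_nontrivial hA
  intro h
  have h1 := nestedCups_jw_nestedCaps (A := A) n
  rw [h, mul_zero, zero_mul] at h1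
  exact hn ((smul_eq_zero.1 h1.symm).resolve_right one_ne_zero)

theorem vertex_right_zero (hA : A ≠ 0) {a : ℕ} (hΔ : ∀ k < 2 * a, delta A k ≠ 0) :
    vertex A a 0 = jw A (2 * a) := by
  have h1 := congrArg flip (jw_mul_jw hA hΔ (show a ≤ 2 * a by omega))
  have h2 := congrArg flip (jw_mul_shift_jw hA hΔ a a (by omega))
  simp only [flip_mul, flip_jw, flip_shift] at h1 h2
  rw [vertex, fork, nestedCaps, map_one, mul_one, add_zero, jwPair, mul_assoc, h2, h1]

/-- Close the vertex with nested arcs in the middle and expand the idempotent on two strands. With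
`a = i + 1` the value is `Δ_a * (Δ_a / Δ_i - 1 / Δ_1)`, that is `Δ_a * Δ_(a+1) / (Δ_1 * Δ_i)`. -/
theorem vertex_one_ne_zero (hA : A ≠ 0) {i : ℕ} (hΔ : ∀ k ≤ i + 2, delta A k ≠ 0) :
    vertex A 1 i ≠ 0 := by
  have hN := planar_nontrivial hA
  intro hv
  set a := i + 1 with ha
  have d0 := delta_zero hA
  have d1 := hΔ 1 (by omega)
  have di := hΔ i (by omega)
  have da := hΔ a (by omega)
  have da1 := hΔ (i + 2) le_rfl
  have dr : delta A (i + 2) = delta A 1 * delta A (i + 1) - delta A i := by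
    rw [delta_one hA]; exact delta_succ_succ hA fun k hk => hΔ k (by omega)
  have hP : ∀ k < a, delta A k ≠ 0 := fun k hk => hΔ k (by omega)
  have hLm : shift 1 (nestedCups A i) ∈ Hom A 2 (2 * a) := by
    have := hom_mono 1 (shift_mem 1 (nestedCups_mem (A := A) i))
    rwa [show 1 + 0 + 1 = 2 by rfl, show 1 + (i + i) + 1 = 2 * a by omega] at this
  have hRm : shift 1 (nestedCaps A i) ∈ Hom A (2 * a) 2 := by
    simpa using flip_mem hLm
  have hPm := jwPair_mem (A := A) a
  have hZ : encircle 2 0 (shift 1 (nestedCups A i) * jwPair A a * shift 1 (nestedCaps A i) *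
      turnback A 0) = delta A a • 1 := by
    have e : nestedCaps A a = shift 1 (nestedCaps A i) * cap A 0 := nestedCaps_succ' i
    have e' : nestedCups A a = cup A 0 * shift 1 (nestedCups A i) := by
      simpa using congrArg flip e
    have h := encircle_comm hA (m := 0)
      (x := shift 1 (nestedCups A i) * jwPair A a * shift 1 (nestedCaps A i) * cap A 0)
      (hom_mul (hom_mul (hom_mul hLm hPm) hRm) (hom_cap (le_refl 0)))
      (hom_cup (u := cup A) (v := cap A) (le_refl 0))
    rw [turnback, ← mul_assoc, h, ← nestedCups_jwPair_nestedCaps hA hP (le_refl a), e, e', jwPair]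
    simp [encircle, nestedCups, nestedCaps, bandCross, mul_assoc]
  have hY : encircle 2 0 (shift 1 (nestedCups A i) * jwPair A a * shift 1 (nestedCaps A i)) =
      (delta A a / delta A i * delta A a) • 1 := by
    have e : nestedCups A 2 * shift 1 (nestedCups A i) = nestedCups A a * cup A (i + a) := by
      have h1 := mul_shift (nestedCups_mem (A := A) i) (cup A 0)
      have h2 := congrArg (shift 1) h1
      rw [shift_zero, map_mul, map_mul, shift_cup, shift_cup, shift_cup] at h2
      rw [nestedCups, nestedCups, nestedCups, mul_assoc, ← h2, ha, add_comm i 1, nestedCups_add]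
      simp only [nestedCups, mul_assoc, one_mul]
      congr 3; omega
    have e' : shift 1 (nestedCaps A i) * nestedCaps A 2 = cap A (i + a) * nestedCaps A a := by
      simpa using congrArg flip e
    have h3 : cup A (i + a) * jwPair A a * cap A (i + a) =
        (delta A a / delta A i) • (jw A a * shift a (jw A i)) := by
      have h4 := cup_jw_cap hA (n := i) fun k hk => hΔ k (by omega)
      have h5 := mul_shift (jw_mem (A := A) a) (cup A i)
      rw [shift_cup] at h5
      rw [jwPair, ← mul_assoc, ← h5, mul_assoc, mul_assoc, ← shift_cup, ← shift_cap, ← map_mul,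
        ← map_mul, ← mul_assoc, h4, map_smul, mul_smul_comm]
    calc _ = nestedCups A 2 * shift 1 (nestedCups A i) * jwPair A a *
          (shift 1 (nestedCaps A i) * nestedCaps A 2) := by
          simp [encircle, bandCross, across, mul_assoc]
      _ = nestedCups A a * (cup A (i + a) * jwPair A a * cap A (i + a)) * nestedCaps A a := by
          rw [e, e']; simp only [mul_assoc]
      _ = _ := by
          rw [h3, mul_smul_comm, smul_mul_assoc, mul_smul,
            ← nestedCups_jwPair_nestedCaps hA hP (show i ≤ a by omega)]
          simp only [mul_assoc]
  have h2 : jw A 2 = 1 - (delta A 0 / delta A 1) • turnback A 0 := by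
    simp [jw_succ_succ 0, jw_one]
  have h := congrArg (fun x => encircle 2 0 (shift 1 (nestedCups A i) * x)) hv
  have hf : 1 + i = a := add_comm 1 i
  simp only [vertex, fork, hf, mul_one, h2, mul_zero, mul_sub, mul_smul_comm] at h
  simp only [← mul_assoc] at h hZ hY
  rw [encircle_sub, encircle_smul, hZ, hY, smul_smul, ← sub_smul] at h
  have h0 : encircle 2 0 (0 : Planar A) = 0 := by simp [encircle]
  rw [h0] at h
  have h4 := (smul_eq_zero.1 h).resolve_right one_ne_zero
  rw [d0] at h4
  field_simp at h4
  rw [mul_zero, mul_eq_zero] at h4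
  refine da1 ?_
  rw [dr]
  linear_combination h4.resolve_left da

/-! ### Values of links that encircle an idempotent -/

/-- The closure in the plane of an element on `m` strands, which are encircled by the closure of
the idempotent on `b` strands. -/
def clasp (A : ℂ) (b m : ℕ) : Planar A →ₗ[ℂ] Planar A where
  toFun x := encircle m 0 (x * encircle b m (jw A b))
  map_add' x y := by simp only [encircle, mul_add, add_mul]
  map_smul' c x := by simp only [encircle, mul_smul_comm, smul_mul_assoc, RingHom.id_apply]

theorem clasp_apply (b m : ℕ) (x : Planar A) :
    clasp A b m x = encircle m 0 (x * encircle b m (jw A b)) := rfl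

theorem clasp_comm (hA : A ≠ 0) (b : ℕ) {m n : ℕ} {x y : Planar A} (hx : x ∈ Hom A m n)
    (hy : y ∈ Hom A n m) : clasp A b m (x * y) = clasp A b n (y * x) := by
  have hb := jw_mem (A := A) b
  rw [clasp_apply, clasp_apply, mul_assoc, encircle_mul hA hb hy, ← mul_assoc,
    encircle_comm hA (hom_mul hx (encircle_mem hb)) hy, mul_assoc]

/-- The value of the Hopf link whose components are labelled by `b` and `c`. -/
def hopf (A : ℂ) (b c : ℕ) : ℂ := encircleFactor A c b * delta A c

theorem clasp_jw (hA : A ≠ 0) {b c : ℕ} (hb : ∀ i < b, delta A i ≠ 0)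
    (hc : ∀ i < c, delta A i ≠ 0) : clasp A b c (jw A c) = hopf A b c • 1 := by
  rw [clasp_apply, jw_mul_encircle hA hb hc, encircle_smul, hopf, mul_smul,
    ← nestedCups_jw_nestedCaps]
  simp [encircle, bandCross]

/-- Fusion of an idempotent with one free strand: the recursion splits it, and the trace property
closes the second term to the idempotent on `m` strands. The parameter `k` counts further free
strands. -/
theorem clasp_jw_succ (hA : A ≠ 0) (b : ℕ) {m : ℕ} (k : ℕ) (hΔ : ∀ i ≤ m + 1, delta A i ≠ 0) :
    clasp A b (m + 2 + k) (jw A (m + 1)) =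
      clasp A b (m + 2 + k) (jw A (m + 2)) + clasp A b (m + k) (jw A m) := by
  have hm := hΔ m (by omega)
  have hm1 := hΔ (m + 1) le_rfl
  have hj : jw A (m + 1) ∈ Hom A (m + 2 + k) (m + 2 + k) := by
    have := hom_mono (1 + k) (jw_mem (A := A) (m + 1))
    rwa [show m + 1 + (1 + k) = m + 2 + k by omega] at this
  have hcap : cap A m ∈ Hom A (m + 2 + k) (m + k) := hom_mono k (hom_cap le_rfl)
  have hcup : cup A m ∈ Hom A (m + k) (m + 2 + k) := hom_mono k (hom_cup le_rfl)
  have h1 := clasp_comm hA b (hom_mul hj hcap) (hom_mul hcup hj)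
  have h2 : cup A m * jw A (m + 1) * (jw A (m + 1) * cap A m) =
      (delta A (m + 1) / delta A m) • jw A m := by
    rw [mul_assoc, ← mul_assoc (jw A _), jw_mul_self hA fun i hi => hΔ i (by omega), ← mul_assoc,
      cup_jw_cap hA fun i hi => hΔ i (by omega)]
  rw [h2, map_smul] at h1
  have h3 : jw A (m + 1) * turnback A m * jw A (m + 1) =
      jw A (m + 1) * cap A m * (cup A m * jw A (m + 1)) := by simp only [turnback, mul_assoc]
  rw [jw_succ_succ m, map_sub, map_smul, h3, h1, smul_smul, div_mul_div_comm, mul_comm,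
    div_self (mul_ne_zero hm1 hm), one_smul, sub_add_cancel]

theorem clasp_jw_add_one (hA : A ≠ 0) {b m : ℕ} (hb : ∀ i < b, delta A i ≠ 0)
    (hm : ∀ i ≤ m + 1, delta A i ≠ 0) :
    clasp A b (m + 2) (jw A (m + 1)) = (hopf A b (m + 2) + hopf A b m) • 1 := by
  rw [add_smul, ← clasp_jw hA hb fun i hi => hm i (by omega),
    ← clasp_jw hA hb fun i hi => hm i (by omega)]
  exact clasp_jw_succ hA b 0 hm

theorem clasp_mul_shift_jw_two (hA : A ≠ 0) {b c : ℕ} (h1 : delta A 1 ≠ 0)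
    (hb : ∀ i < b, delta A i ≠ 0) (hc : ∀ i < c, delta A i ≠ 0) :
    clasp A b (c + 2) (jw A c * shift c (jw A 2)) =
      clasp A b (c + 2) (jw A c) - hopf A b c • 1 := by
  have hj := hom_mono 2 (jw_mem (A := A) c)
  have h := clasp_comm hA b (hom_mul hj (hom_cap (u := cup A) (le_refl c)))
    (hom_cup (u := cup A) (v := cap A) (le_refl c))
  rw [← mul_assoc, cup_mul_comm (jw_mem c), mul_assoc, mul_assoc, (planarRelations A).circle,
    ← delta_one hA, mul_smul_comm, mul_one, map_smul, clasp_jw hA hb hc] at h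
  rw [jw_succ_succ 0, jw_one, delta_zero hA, map_sub, mul_sub, map_sub, map_one, mul_one, map_smul,
    mul_smul_comm, map_smul, one_mul, mul_one, shift_turnback, zero_add, turnback, zero_add, h, smul_smul,
    one_div, inv_mul_cancel₀ h1, one_smul]

/-- The value of an unknot labelled by `b` around parallel unknots labelled by `c` and `n`,
for `n ≤ 2`. -/
def hopfPair (A : ℂ) (b c : ℕ) : ℕ → ℂ
  | 0 => hopf A b c
  | 1 => hopf A b (c + 1) + if c = 0 then 0 else hopf A b (c - 1)
  | _ + 2 => hopf A b (c + 2) + if c < 2 then 0 else hopf A b c + hopf A b (c - 2)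

/-- The fusion rules for colours `c` and `n ≤ 2`. The case `c = 1` is excluded because for `n = 2`
it contains the colours `3` and `1`, which `hopfPair` does not describe; only even `c` occur. -/
theorem clasp_mul_shift_jw (hA : A ≠ 0) {b c n : ℕ} (hn : n ≤ 2) (hc1 : c ≠ 1)
    (hb : ∀ i < b, delta A i ≠ 0) (hc : ∀ i < c + n, delta A i ≠ 0) :
    clasp A b (c + n) (jw A c * shift c (jw A n)) = hopfPair A b c n • 1 := by
  match n with
  | 0 => simpa [jw_zero, hopfPair] using clasp_jw hA hb fun i hi => hc i (by omega)
  | 1 =>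
    rw [jw_one, map_one, mul_one, hopfPair]
    match c with
    | 0 => simpa [jw_zero, jw_one] using clasp_jw hA hb hc
    | c + 1 => simpa using clasp_jw_add_one hA hb fun i hi => hc i (by omega)
  | 2 =>
    rw [clasp_mul_shift_jw_two hA (hc 1 (by omega)) hb fun i hi => hc i (by omega), hopfPair]
    match c with
    | 0 =>
      have := clasp_jw_add_one hA (m := 0) hb fun i hi => hc i (by omega)
      rw [zero_add, jw_one] at this
      rw [zero_add, jw_zero, this, ← sub_smul]
      simp
    | 1 => omega
    | c + 2 =>
      have h1 := clasp_jw_succ hA b (m := c + 1) 1 fun i hi => hc i (by omega)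
      have h2 := clasp_jw_add_one hA (m := c + 1 + 1) hb fun i hi => hc i (by omega)
      have h3 := clasp_jw_add_one hA (m := c) hb fun i hi => hc i (by omega)
      have h4 : clasp A b (c + 2 + 2) (jw A (c + 2)) = _ := h1
      have h5 : clasp A b (c + 2 + 2) (jw A (c + 1 + 2)) = _ := h2
      rw [h4, show c + 1 + 2 + 1 = c + 1 + 1 + 2 from rfl, h5,
        show clasp A b (c + 1 + 1) (jw A (c + 1)) = _ from h3, ← add_smul, ← sub_smul]
      simp only [if_neg (show ¬c + 2 < 2 by omega), Nat.add_sub_cancel]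
      congr 1
      ring

/-! ### Evaluation of the diagrams -/

theorem toPlanar_crossing (i : ℕ) (s : Bool) : toPlanar A (crossing A i s) = braid A s i := by
  cases s <;> simp [crossing, braid, coef, toPlanar_hook]

theorem skein_crossing_mem (s : Bool) {i m : ℕ} (h : i + 2 ≤ m) :
    crossing A i s ∈ SkeinHom m m := by
  have h1 : (1 : Skein) ∈ SkeinHom m m := hom_one m
  have h2 := skein_hook_mem h
  cases s
  · exact add_mem (Submodule.smul_mem _ _ h1) (Submodule.smul_mem _ _ h2)
  · exact add_mem (Submodule.smul_mem _ _ h1) (Submodule.smul_mem _ _ h2)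

theorem crossings_succ (k a b : ℕ) (s : Bool) : crossings A k (a + 1) b s =
    ((List.range b).map fun t => crossing A (k + a + t) s).prod * crossings A k a b s := by
  simp [crossings, List.range_succ]

theorem toPlanar_crossings (k a b : ℕ) (s : Bool) :
    toPlanar A (crossings A k a b s) = shift k (bandCross A s a b) := by
  induction a with
  | zero => simp [crossings, bandCross]
  | succ a ih =>
    rw [crossings_succ, map_mul, ih, bandCross_succ_left', map_mul, shift_shift]
    congr 1
    clear ih
    induction b with
    | zero => simp [across]
    | succ b ihb =>
      rw [List.range_succ, List.map_append, List.prod_append, map_mul, ihb, across, map_mul]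
      simp [toPlanar_crossing, add_comm]

theorem skein_crossings_mem (s : Bool) {k a b m : ℕ} (h : k + (a + b) ≤ m) :
    crossings A k a b s ∈ SkeinHom m m := by
  induction a with
  | zero => simpa [crossings] using hom_one m
  | succ a ih =>
    rw [crossings_succ]
    refine hom_mul ?_ (ih (by omega))
    clear ih
    induction b with
    | zero => simpa using hom_one m
    | succ b ihb =>
      rw [List.range_succ, List.map_append, List.prod_append]
      exact hom_mul (ihb (by omega)) (by simpa using skein_crossing_mem s (by omega))

/-- The word of `quaternionicLoop`, if its components are labelled by `a`, `b` and `n`. -/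
def loopWord (A : ℂ) (a b n : ℕ) : Skein :=
  cups 0 a * (jonesWenzl A a 0 * (cups a a * (cups (a + a) n * (jonesWenzl A n (a + a) *
    (crossings A 0 a a false * (cups a a * (crossings A 0 a a true * (caps a a *
    (cups 0 b * (jonesWenzl A b 0 * (crossings A b b a true * (crossings A (b + a) b a true *
    (crossings A (b + (a + a)) b n true * (crossings A (b + (a + a)) n b true *
    (crossings A (b + a) a b true * (crossings A b a b true * (caps 0 b *
    (caps (a + a) n * (caps a a * caps 0 a)))))))))))))))))))

theorem labelledBracket_quaternionicLoop (f : Fin 2 ⊕ Fin 1 → ℕ) :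
    labelledBracket A quaternionicLoop f =
      bracket A (loopWord A (f (.inl 0)) (f (.inl 1)) (f (.inr 0))) := by
  simp [labelledBracket, quaternionicLoop, history, step, labelledMove, width, loopWord]

theorem labelledBracket_quaternionic (f : Fin 2 ⊕ Fin 0 → ℕ) :
    labelledBracket A quaternionic f = bracket A (loopWord A (f (.inl 0)) (f (.inl 1)) 0) := by
  simp [labelledBracket, quaternionic, history, step, labelledMove, width, loopWord]
  simp [cups, caps, crossings, jonesWenzl]

theorem loopWord_mem (a b n : ℕ) : loopWord A a b n ∈ SkeinHom 0 0 := by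
  have c1 {k m l : ℕ} (n : ℕ) (h : k ≤ m) (hl : m + 2 * n = l) : cups k n ∈ SkeinHom m l :=
    hl ▸ skein_cups_mem h n
  have c2 {k m l : ℕ} (n : ℕ) (h : k ≤ m) (hl : m + 2 * n = l) : caps k n ∈ SkeinHom l m :=
    hl ▸ skein_caps_mem h n
  refine hom_mul (c1 a le_rfl rfl) ?_
  refine hom_mul (skein_jonesWenzl_mem a (by omega)) ?_
  refine hom_mul (c1 a (by omega) rfl) ?_
  refine hom_mul (c1 n (by omega) rfl) ?_
  refine hom_mul (skein_jonesWenzl_mem n (by omega)) ?_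
  refine hom_mul (skein_crossings_mem _ (by omega)) ?_
  refine hom_mul (c1 a (by omega) rfl) ?_
  refine hom_mul (skein_crossings_mem _ (by omega)) ?_
  refine hom_mul (c2 (m := 2 * (a + a + n)) a (by omega) (by omega)) ?_
  refine hom_mul (c1 b (by omega) rfl) ?_
  refine hom_mul (skein_jonesWenzl_mem b (by omega)) ?_
  iterate 6 refine hom_mul (skein_crossings_mem _ (by omega)) ?_
  refine hom_mul (c2 (m := 2 * (a + a + n)) b (by omega) (by omega)) ?_
  refine hom_mul (c2 (m := 2 * (a + a)) n (by omega) (by omega)) ?_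
  exact hom_mul (c2 (m := 2 * a) a (by omega) (by omega)) (c2 a (by omega) (by omega))

/-- A positive kink of `a` parallel strands. -/
def kink (A : ℂ) (a : ℕ) : Planar A :=
  shift a (nestedCups A a) * bandCross A true a a * shift a (nestedCaps A a)

theorem kink_mul_jw (hA : A ≠ 0) {a : ℕ} (hΔ : ∀ k < a, delta A k ≠ 0) :
    kink A a * jw A a = twistFactor A 0 a • jw A a := by
  have := congrArg flip (jw_mul_kink hA hΔ)
  simpa [kink, mul_assoc] using this

theorem kink_mem (a : ℕ) : kink A a ∈ Hom A a a := by
  have h1 := shift_mem a (nestedCups_mem (A := A) a)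
  have h2 := shift_mem a (nestedCaps_mem (A := A) a)
  have h3 := hom_mono a (bandCross_mem (A := A) true a a)
  rw [add_zero] at h1 h2
  rw [add_assoc] at h3
  exact hom_mul (hom_mul h1 h3) h2

/-- The closing arcs of the two bands and of the loop form one nest of `2a + n` arcs, and the
crossings with the encircling component form two band crossings. The idempotents only have to be
moved past minima on their right. -/
theorem toPlanar_loopWord (a b n : ℕ) : toPlanar A (loopWord A a b n) =
    clasp A b (2 * a + n) (jw A a * shift (2 * a) (jw A n) * bandCross A false a a * kink A a) := by
  rw [two_mul]
  have h (z : Planar A) :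
      jw A a * (shift a (nestedCups A a) * (shift (a + a) (nestedCups A n) * z)) =
        shift a (nestedCups A a) * (shift (a + a) (nestedCups A n) * (jw A a * z)) := by
    have := mul_shift (jw_mem (A := A) a) (nestedCups A a * shift a (nestedCups A n))
    rw [map_mul, shift_shift] at this
    rw [← mul_assoc (shift a _), ← mul_assoc, this]
    simp only [mul_assoc]
  simp only [loopWord, clasp_apply, encircle, kink, nestedCups_add, nestedCaps_add,
    bandCross_add_left, bandCross_add_right, map_mul, toPlanar_cups, toPlanar_caps,
    toPlanar_crossings, toPlanar_jonesWenzl, shift_shift, shift_zero, bandCross_zero_right,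
    map_one, mul_assoc, h]
  simp [bandCross, add_comm, add_left_comm]

/-- A second copy of the idempotent is carried around the closure. It turns the kink into a scalar,
then passes through the crossing to the second band, so that both bands carry an idempotent and
fusion applies. -/
theorem bracket_loopWord (hA : A ≠ 0) {a : ℕ} (hΔ : ∀ k < a, delta A k ≠ 0) (b n : ℕ) :
    bracket A (loopWord A a b n) • (1 : Planar A) = twistFactor A 0 a •
      clasp A b (2 * a + n) (jwPair A a * bandCross A false a a * shift (2 * a) (jw A n)) := by
  have hj := hom_mono (a + n) (jw_mem (A := A) a)
  have hs := shift_mem (2 * a) (jw_mem (A := A) n)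
  have hσ := hom_mono n (bandCross_mem (A := A) false a a)
  have hk := hom_mono (a + n) (kink_mem (A := A) a)
  rw [← two_mul] at hσ
  rw [← add_assoc, ← two_mul] at hj hk
  have h1 := jw_mul_self hA hΔ
  have h2 : bandCross A false a a * jw A a = shift a (jw A a) * bandCross A false a a :=
    (shift_mul_bandCross hA false a (jw_mem a)).symm
  have h3 := mul_shift (hom_mul (shift_mem a (jw_mem (A := A) a)) (bandCross_mem false a a))
    (jw A n)
  rw [← two_mul] at h3
  rw [← toPlanar_eq_bracket (loopWord_mem a b n), toPlanar_loopWord]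
  calc _ = clasp A b (2 * a + n) (jw A a *
        (jw A a * shift (2 * a) (jw A n) * bandCross A false a a * kink A a)) := by
        conv_lhs => rw [← h1]
        simp only [mul_assoc]
    _ = clasp A b (2 * a + n)
        (jw A a * shift (2 * a) (jw A n) * bandCross A false a a * (kink A a * jw A a)) := by
        rw [clasp_comm hA b hj (hom_mul (hom_mul (hom_mul hj hs) hσ) hk)]
        simp only [mul_assoc]
    _ = _ := by
        rw [kink_mul_jw hA hΔ, mul_smul_comm, map_smul, mul_assoc (jw A a * _), h2, mul_assoc,
          ← h3, jwPair]
        simp only [mul_assoc]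

theorem exists_bracket_loopWord (hA : A ≠ 0) {a : ℕ} (hΔ : ∀ i < 2 * a, delta A i ≠ 0) :
    -- The weights `μ` are chosen before `b` and `n`, so the later sum over `b` acts on `hopfPair`
    -- alone.
    ∃ μ : ℕ → ℂ, (∀ j i, j + i = a → vertex A j i ≠ 0 → μ j = 1) ∧
      ∀ b n, n ≤ 2 → (∀ i < b, delta A i ≠ 0) → (∀ i < 2 * a + n, delta A i ≠ 0) →
        bracket A (loopWord A a b n) = twistFactor A 0 a * ∑ j ∈ Finset.range (a + 1),
          twistFactor A j (a - j) * μ j * hopfPair A b (2 * j) n := by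
  obtain ⟨μ, hμ, h⟩ := exists_fusion hA hΔ
  refine ⟨μ, hμ, fun b n hn hb hc => smul_one_injective hA ?_⟩
  -- The trace to which fusion is applied: the loop of colour `n` is placed beside the `m` strands,
  -- and everything is encircled by colour `b`.
  let T (m : ℕ) : Planar A →ₗ[ℂ] Planar A :=
    clasp A b (m + n) ∘ₗ LinearMap.mulRight ℂ (shift m (jw A n))
  have hT : ∀ k l, ∀ x ∈ Hom A k l, ∀ y ∈ Hom A l k, T k (x * y) = T l (y * x) := by
    intro k l x hx y hy
    have h1 := clasp_comm hA b (hom_mul (hom_mono n hx) (shift_mem l (jw_mem n))) (hom_mono n hy)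
    simp only [T, LinearMap.comp_apply, LinearMap.mulRight_apply]
    rw [mul_assoc, mul_shift hy, ← mul_assoc, h1, mul_assoc]
  have h1 := h T hT (bandCross A false a a) (by rw [two_mul]; exact bandCross_mem false a a)
    (jwPair_mul_bandCross hA false a) (fun j => twistFactor A j (a - j)) (by
      rintro j i rfl
      rw [Nat.add_sub_cancel_left]
      exact bandCross_mul_vertex hA (fun k hk => hΔ k (by omega)) fun k hk => hΔ k (by omega))
  rw [bracket_loopWord hA fun k hk => hΔ k (by omega), mul_smul]
  congr 1
  refine h1.trans ?_
  rw [Finset.sum_smul]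
  refine Finset.sum_congr rfl fun j hj => ?_
  rw [Finset.mem_range] at hj
  rw [mul_smul _ (hopfPair _ _ _ _), ← clasp_mul_shift_jw hA hn (by omega) hb
    fun i hi => hc i (by omega)]
  rfl

/-! ### Values at a root of unity -/

theorem mul_delta (hA : A ≠ 0) {n : ℕ} (hΔ : ∀ i < n, delta A i ≠ 0) :
    (A ^ 2 - A⁻¹ ^ 2) * delta A n = (-1) ^ n * (A ^ (2 * (n + 1)) - A⁻¹ ^ (2 * (n + 1))) := by
  have h2 : A ^ (-2 : ℤ) = A⁻¹ ^ 2 := by rw [zpow_neg, inv_pow]; norm_cast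
  induction n using Nat.strong_induction_on with
  | _ n ih =>
    match n with
    | 0 => simp [delta_zero hA]
    | 1 => rw [delta_one hA, loopValue, h2]; ring
    | n + 2 =>
      have h0 := ih n (by omega) fun i hi => hΔ i (by omega)
      have h1 := ih (n + 1) (by omega) fun i hi => hΔ i (by omega)
      have h : A * A⁻¹ = 1 := mul_inv_cancel₀ hA
      rw [delta_succ_succ hA fun i hi => hΔ i (by omega), mul_sub, mul_left_comm, h1, h0,
        loopValue, h2]
      have e (k : ℕ) : A ^ (2 * (k + 1)) = (A ^ 2) ^ (k + 1) := by rw [pow_mul]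
      have e' (k : ℕ) : A⁻¹ ^ (2 * (k + 1)) = (A⁻¹ ^ 2) ^ (k + 1) := by rw [pow_mul]
      have h3 : A ^ 2 * A⁻¹ ^ 2 = 1 := by rw [← mul_pow, h, one_pow]
      simp only [e, e']
      generalize A ^ 2 = x at *
      generalize A⁻¹ ^ 2 = y at *
      linear_combination (-1) ^ n * (x ^ (n + 1) - y ^ (n + 1)) * h3

theorem mul_encircleFactor (hA : A ≠ 0) (b c : ℕ) :
    (A ^ (2 * (c + 1)) - A⁻¹ ^ (2 * (c + 1))) * encircleFactor A c b =
      (-1) ^ b * (A ^ (2 * (c + 1) * (b + 1)) - A⁻¹ ^ (2 * (c + 1) * (b + 1))) := by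
  have h : A ^ (2 * (c + 1)) * A⁻¹ ^ (2 * (c + 1)) = 1 := by
    rw [← mul_pow, mul_inv_cancel₀ hA, one_pow]
  induction b using Nat.strong_induction_on with
  | _ b ih =>
    simp only [pow_mul _ (2 * (c + 1))] at ih ⊢
    match b with
    | 0 => simp [encircleFactor]
    | 1 => simp only [encircleFactor, circleFactor]; ring
    | b + 2 =>
      have h0 := ih b (by omega)
      have h1 := ih (b + 1) (by omega)
      rw [encircleFactor, mul_sub, mul_left_comm, h1, h0, circleFactor]
      generalize A ^ (2 * (c + 1)) = x at *
      generalize A⁻¹ ^ (2 * (c + 1)) = y at *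
      linear_combination (-1) ^ b * (x ^ (b + 1) - y ^ (b + 1)) * h

theorem sum_pow_add_inv_pow {w : ℂ} (hw : w ≠ 0) (n : ℕ) :
    (w - 1) * ∑ m ∈ Finset.range n, (w ^ (m + 1) + w⁻¹ ^ (m + 1)) =
      w ^ (n + 1) - w + 1 - w⁻¹ ^ n := by
  induction n with
  | zero => simp
  | succ n ih =>
    rw [Finset.sum_range_succ, mul_add, ih]
    linear_combination w⁻¹ ^ n * mul_inv_cancel₀ hw

/-- The exponents `±1, …, ±n` together with `0` form a complete residue system modulo `2n + 1`. -/
theorem sum_root_of_unity {w : ℂ} {n : ℕ} (h : w ^ (2 * n + 1) = 1) :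
    ∑ m ∈ Finset.range n, (w ^ (m + 1) + w⁻¹ ^ (m + 1)) =
      (if w = 1 then (2 * n + 1 : ℂ) else 0) - 1 := by
  split_ifs with h1
  · simp [h1]; ring
  have hw : w ≠ 0 := by rintro rfl; simp at h
  have h2 : w⁻¹ ^ n = w ^ (n + 1) := by
    rw [inv_pow]; refine inv_eq_of_mul_eq_one_right ?_; rw [← h]; ring
  refine mul_left_cancel₀ (sub_ne_zero.2 h1) ?_
  rw [sum_pow_add_inv_pow hw, h2]; ring

/-- `A_r` is a primitive root of unity of order `2 r`. -/
theorem rootA_isPrimitiveRoot {r : ℕ} (hr : r ≠ 0) : IsPrimitiveRoot (rootA r) (2 * r) := by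
  have := Complex.isPrimitiveRoot_exp (2 * r) (by omega)
  convert this using 1
  rw [rootA]; congr 1
  have : (r : ℂ) ≠ 0 := by exact_mod_cast hr
  push_cast; field_simp

variable {h : ℕ}

/-- Vanishing would mean `A ^ (4n) = 1`, hence `r ∣ 2n`, and `r ∣ n` because `r = 2h + 3` is odd. -/
theorem pow_sub_inv_pow_ne_zero (hA : IsPrimitiveRoot A (2 * (2 * h + 3))) {n : ℕ} (hn : n ≠ 0)
    (hn' : n < 2 * h + 3) : A ^ (2 * n) - A⁻¹ ^ (2 * n) ≠ 0 := by
  have h0 : A ≠ 0 := hA.ne_zero (by omega)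
  intro h1
  have h2 : A ^ (4 * n) = 1 := by
    rw [show 4 * n = 2 * n + 2 * n by ring, pow_add]
    nth_rw 1 [sub_eq_zero.1 h1]
    rw [← mul_pow, inv_mul_cancel₀ h0, one_pow]
  have h3 := (hA.pow_eq_one_iff_dvd _).1 h2
  rw [show 4 * n = 2 * (2 * n) by ring, Nat.mul_dvd_mul_iff_left (by omega)] at h3
  have h4 : Nat.Coprime (2 * h + 3) 2 := by
    rw [Nat.coprime_two_right]; exact ⟨h + 1, by ring⟩
  exact absurd (Nat.le_of_dvd (by omega) (h4.dvd_of_dvd_mul_left h3)) (by omega)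

theorem delta_ne_zero (hA : IsPrimitiveRoot A (2 * (2 * h + 3))) {n : ℕ} (hn : n < 2 * h + 2) :
    delta A n ≠ 0 := by
  have h0 : A ≠ 0 := hA.ne_zero (by omega)
  induction n using Nat.strong_induction_on with
  | _ n ih =>
    have h1 := mul_delta h0 (n := n) fun i hi => ih i hi (by omega)
    intro h2
    rw [h2, mul_zero] at h1
    exact mul_ne_zero (by simp) (pow_sub_inv_pow_ne_zero hA (n := n + 1) (by omega) (by omega))
      h1.symm

theorem pow_eq_one_iff (hA : IsPrimitiveRoot A (2 * (2 * h + 3))) (n : ℕ) :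
    (A ^ 2) ^ n = 1 ↔ 2 * h + 3 ∣ n := by
  rw [← pow_mul, hA.pow_eq_one_iff_dvd, Nat.mul_dvd_mul_iff_left (by omega)]

/-- The value of the Hopf link whose first component is labelled by the sum of the idempotents. -/
theorem sum_delta_mul_hopf (hA : IsPrimitiveRoot A (2 * (2 * h + 3))) {c : ℕ}
    (hc : c < 2 * h + 3) :
    (A ^ 2 - A⁻¹ ^ 2) ^ 2 * ∑ b ∈ Finset.range (h + 1), delta A b * hopf A b c =
      if c = 0 ∨ c = 2 * h + 1 then -(2 * h + 3 : ℂ) else 0 := by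
  have h0 : A ≠ 0 := hA.ne_zero (by omega)
  have hq (k : ℕ) : ((A ^ 2) ^ k) ^ (2 * (h + 1) + 1) = 1 := by
    rw [← pow_mul, pow_eq_one_iff hA]; exact Dvd.intro_left _ rfl
  -- A product of two quantum sines is a difference of two cosines, of frequencies `c + 2` and `c`.
  -- Each sums over `b` to half of a complete character sum, so the total vanishes unless `r`
  -- divides `c + 2` or `c`.
  have h1 (b : ℕ) (hb : b ∈ Finset.range (h + 1)) :
      (A ^ 2 - A⁻¹ ^ 2) ^ 2 * (delta A b * hopf A b c) = (-1) ^ c *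
        ((((A ^ 2) ^ (c + 2)) ^ (b + 1) + ((A ^ 2) ^ (c + 2))⁻¹ ^ (b + 1)) -
          (((A ^ 2) ^ c) ^ (b + 1) + ((A ^ 2) ^ c)⁻¹ ^ (b + 1))) := by
    rw [Finset.mem_range] at hb
    have e1 := mul_delta h0 (n := b) fun i hi => delta_ne_zero hA (by omega)
    have e2 := mul_delta h0 (n := c) fun i hi => delta_ne_zero hA (by omega)
    have e3 := mul_encircleFactor h0 b c
    have e4 : ((-1 : ℂ) ^ b) ^ 2 = 1 := by rw [← pow_mul, mul_comm, pow_mul]; simp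
    have e5 : A ^ (2 * (b + 1)) * A⁻¹ ^ (2 * (b + 1)) = 1 := by
      rw [← mul_pow, mul_inv_cancel₀ h0, one_pow]
    have e6 : A ^ (2 * (c + 1) * (b + 1)) = ((A ^ 2) ^ c) ^ (b + 1) * A ^ (2 * (b + 1)) := by
      simp only [← pow_mul, ← pow_add]; congr 1; ring
    have e7 : A⁻¹ ^ (2 * (c + 1) * (b + 1)) = ((A ^ 2) ^ c)⁻¹ ^ (b + 1) * A⁻¹ ^ (2 * (b + 1)) := by
      simp only [← inv_pow, ← pow_mul, ← pow_add]; congr 1; ring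
    have e8 : ((A ^ 2) ^ (c + 2)) ^ (b + 1) = ((A ^ 2) ^ c) ^ (b + 1) * (A ^ (2 * (b + 1))) ^ 2 := by
      simp only [← pow_mul, ← pow_add]; congr 1; ring
    have e9 : ((A ^ 2) ^ (c + 2))⁻¹ ^ (b + 1) =
        ((A ^ 2) ^ c)⁻¹ ^ (b + 1) * (A⁻¹ ^ (2 * (b + 1))) ^ 2 := by
      simp only [← inv_pow, ← pow_mul, ← pow_add]; congr 1; ring
    calc _ = ((A ^ 2 - A⁻¹ ^ 2) * delta A b) *
          (encircleFactor A c b * ((A ^ 2 - A⁻¹ ^ 2) * delta A c)) := by rw [hopf]; ring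
      _ = (-1) ^ b * (A ^ (2 * (b + 1)) - A⁻¹ ^ (2 * (b + 1))) * ((-1) ^ c *
          ((A ^ (2 * (c + 1)) - A⁻¹ ^ (2 * (c + 1))) * encircleFactor A c b)) := by
          rw [e1, e2]; ring
      _ = _ := by
          rw [e3, e6, e7, e8, e9]
          generalize A ^ (2 * (b + 1)) = x at *
          generalize A⁻¹ ^ (2 * (b + 1)) = y at *
          generalize ((A ^ 2) ^ c) ^ (b + 1) = u
          generalize ((A ^ 2) ^ c)⁻¹ ^ (b + 1) = v
          generalize (-1 : ℂ) ^ b = s at *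
          linear_combination (-1) ^ c * (x - y) * (u * x - v * y) * e4 - (-1) ^ c * (u + v) * e5
  rw [Finset.mul_sum, Finset.sum_congr rfl h1, ← Finset.mul_sum, Finset.sum_sub_distrib,
    sum_root_of_unity (hq _), sum_root_of_unity (hq _)]
  have d1 : 2 * h + 3 ∣ c ↔ c = 0 :=
    ⟨fun hd => Nat.eq_zero_of_dvd_of_lt hd hc, by rintro rfl; exact dvd_zero _⟩
  have d2 : 2 * h + 3 ∣ c + 2 ↔ c = 2 * h + 1 := by
    refine ⟨fun hd => ?_, by rintro rfl; exact dvd_rfl⟩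
    obtain ⟨k, hk⟩ := hd
    have : k < 2 := by by_contra; nlinarith
    interval_cases k <;> omega
  simp only [pow_eq_one_iff hA, d1, d2]
  rcases eq_or_ne c 0 with rfl | h2
  · simp; ring
  · rcases eq_or_ne c (2 * h + 1) with rfl | h3
    · simp [pow_add, pow_mul]; ring
    · simp [h2, h3]

/-! ### The surgery formula for the quaternionic manifold -/

theorem sum_piFinset_fin_two {M : Type*} [AddCommMonoid M] (s : Finset ℕ) (f : ℕ → ℕ → M) :
    ∑ n ∈ Fintype.piFinset fun _ : Fin 2 => s, f (n 0) (n 1) = ∑ a ∈ s, ∑ b ∈ s, f a b := by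
  rw [← Finset.sum_product']
  refine Finset.sum_nbij' (fun n => (n 0, n 1)) (fun p => ![p.1, p.2]) ?_ ?_ ?_ ?_ ?_
  · intro n hn; simp only [Fintype.mem_piFinset] at hn; simp [hn]
  · intro p hp; simpa [Fintype.mem_piFinset, Fin.forall_fin_two] using hp
  · intro n _; ext i; fin_cases i <;> rfl
  · intro p _; rfl
  · intro n _; rfl

theorem signedCrossings_quaternionic : signedCrossings quaternionic =
    [(.inl 0, .inl 0, -1), (.inl 0, .inl 0, 1), (.inl 1, .inl 0, 1), (.inl 1, .inl 0, 1),
      (.inl 0, .inl 1, 1), (.inl 0, .inl 1, 1)] := by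
  simp [signedCrossings, quaternionic, history, step]

theorem signedCrossings_quaternionicLoop : signedCrossings quaternionicLoop =
    [(.inl 0, .inl 0, -1), (.inl 0, .inl 0, 1), (.inl 1, .inl 0, 1), (.inl 1, .inl 0, 1),
      (.inl 1, .inr 0, 1), (.inr 0, .inl 1, 1), (.inl 0, .inl 1, 1), (.inl 0, .inl 1, 1)] := by
  simp [signedCrossings, quaternionicLoop, history, step]

theorem linkingMatrix_quaternionic : linkingMatrix quaternionic = !![0, 2; 2, 0] := by
  ext i j
  rw [linkingMatrix, signedCrossings_quaternionic]
  fin_cases i <;> fin_cases j <;> norm_num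

theorem linkingMatrix_quaternionicLoop : linkingMatrix quaternionicLoop = !![0, 2; 2, 0] := by
  ext i j
  rw [linkingMatrix, signedCrossings_quaternionicLoop]
  fin_cases i <;> fin_cases j <;> norm_num [Sum.inr_ne_inl]

theorem roots_charpoly_antidiagonal :
    (!![0, 2; 2, 0] : Matrix (Fin 2) (Fin 2) ℝ).charpoly.roots = {2, -2} := by
  have h : (!![0, 2; 2, 0] : Matrix (Fin 2) (Fin 2) ℝ).charpoly =
      (Polynomial.X - Polynomial.C 2) * (Polynomial.X - Polynomial.C (-2)) := by
    rw [Matrix.charpoly_fin_two]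
    simp [Matrix.trace_fin_two, Matrix.det_fin_two]
    rw [← Polynomial.C_mul, show (2 : ℝ) * 2 = 4 by norm_num]
    have : (Polynomial.C 4 : Polynomial ℝ) = 4 := rfl
    have h2 : (Polynomial.C 2 : Polynomial ℝ) = 2 := rfl
    rw [this, h2]
    ring
  rw [h, Polynomial.roots_mul (mul_ne_zero (Polynomial.X_sub_C_ne_zero _)
    (Polynomial.X_sub_C_ne_zero _)), Polynomial.roots_X_sub_C, Polynomial.roots_X_sub_C]
  rfl

theorem bNeg_sub_bPos_eq_zero {κ : Type} [Fintype κ] [DecidableEq κ]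
    {D : LinkDiagram (Fin 2 ⊕ κ)} (h : linkingMatrix D = !![0, 2; 2, 0]) :
    (bNeg D : ℤ) - bPos D = 0 := by
  rw [bNeg, bPos, h, roots_charpoly_antidiagonal]
  norm_num [Multiset.insert_eq_cons, Multiset.countP_cons, ← Multiset.cons_zero]

theorem invMLoop_eq (r : ℕ) (η k : ℂ) (c : ℕ) :
    invMLoop r η k c = η ^ 2 * ∑ a ∈ labels r, delta (rootA r) a *
      ∑ b ∈ labels r, delta (rootA r) b * bracket (rootA r) (loopWord (rootA r) a b c) := by
  rw [invMLoop, quantumInvariant, bNeg_sub_bPos_eq_zero linkingMatrix_quaternionicLoop]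
  simp only [labelledBracket_quaternionicLoop, Sum.elim_inl, Sum.elim_inr, Fin.prod_univ_two]
  rw [sum_piFinset_fin_two (labels r) fun a b => η * delta (rootA r) a * (η * delta (rootA r) b) *
    bracket (rootA r) (loopWord (rootA r) a b c), mul_zero, zpow_zero, one_mul, Finset.mul_sum]
  refine Finset.sum_congr rfl fun a _ => ?_
  rw [Finset.mul_sum, Finset.mul_sum]
  exact Finset.sum_congr rfl fun b _ => by ring

theorem invM_eq (r : ℕ) (η k : ℂ) : invM r η k = invMLoop r η k 0 := by
  rw [invMLoop_eq, invM, quantumInvariant, bNeg_sub_bPos_eq_zero linkingMatrix_quaternionic]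
  simp only [labelledBracket_quaternionic, Sum.elim_inl, Fin.prod_univ_two]
  rw [sum_piFinset_fin_two (labels r) fun a b => η * delta (rootA r) a * (η * delta (rootA r) b) *
    bracket (rootA r) (loopWord (rootA r) a b 0), mul_zero, zpow_zero, one_mul, Finset.mul_sum]
  refine Finset.sum_congr rfl fun a _ => ?_
  rw [Finset.mul_sum, Finset.mul_sum]
  exact Finset.sum_congr rfl fun b _ => by ring

theorem labels_odd (h : ℕ) : labels (2 * h + 3) = Finset.range (h + 1) := by
  rw [labels]; congr 2; omega

/-- A Hopf link with one component of colour `0` is an unknot; this identifies the normalization of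
`η` with the case `c = 0` of the Hopf sums. -/
theorem omegaValue_eq (h : ℕ) : omegaValue (2 * h + 3) = ∑ b ∈ Finset.range (h + 1),
    delta (rootA (2 * h + 3)) b * hopf (rootA (2 * h + 3)) b 0 := by
  have hA := rootA_isPrimitiveRoot (r := 2 * h + 3) (by omega)
  have h0 : rootA (2 * h + 3) ≠ 0 := hA.ne_zero (by omega)
  rw [omegaValue, labels_odd]
  refine Finset.sum_congr rfl fun b hb => ?_
  rw [Finset.mem_range] at hb
  congr 1
  have h1 := pow_sub_inv_pow_ne_zero hA one_ne_zero (by omega)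
  have h2 := mul_delta h0 (n := b) fun i hi => delta_ne_zero hA (by omega)
  have h3 := mul_encircleFactor h0 b 0
  refine mul_left_cancel₀ h1 ?_
  rw [hopf, delta_zero h0, mul_one, h2]
  simpa using h3.symm

theorem eta_sum_hopf {η : ℂ} (hη : η ^ 2 * omegaValue (2 * h + 3) = 1) {c : ℕ}
    (hc : c < 2 * h + 3) : η ^ 2 * ∑ b ∈ Finset.range (h + 1),
      delta (rootA (2 * h + 3)) b * hopf (rootA (2 * h + 3)) b c =
        if c = 0 ∨ c = 2 * h + 1 then 1 else 0 := by
  have hA := rootA_isPrimitiveRoot (r := 2 * h + 3) (by omega)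
  have h1 := pow_sub_inv_pow_ne_zero hA one_ne_zero (by omega)
  rw [mul_one] at h1
  have h2 := sum_delta_mul_hopf hA hc
  have h3 := sum_delta_mul_hopf hA (c := 0) (by omega)
  rw [if_pos (Or.inl rfl), ← omegaValue_eq] at h3
  refine mul_left_cancel₀ (pow_ne_zero 2 h1) ?_
  rw [mul_left_comm, h2]
  split_ifs
  · rw [← h3, mul_left_comm, hη]
  · simp

/-- Parity decides: for even `n` the fused colours are even and can only be `0`, reached from `2i =
n`; for `n = 1` they are odd and can only be `r - 2 = 2h + 1`, reached from `2i = 2h`. -/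
theorem eta_sum_hopfPair {η : ℂ} (hη : η ^ 2 * omegaValue (2 * h + 3) = 1) {n j i : ℕ}
    (hn : n = 0 ∧ j = 0 ∨ n = 1 ∧ j = h ∨ n = 2 ∧ j = 1) (hi : i ≤ h) :
    η ^ 2 * ∑ b ∈ Finset.range (h + 1),
      delta (rootA (2 * h + 3)) b * hopfPair (rootA (2 * h + 3)) b (2 * i) n =
        if i = j then 1 else 0 := by
  have H := fun c hc => eta_sum_hopf hη (c := c) hc
  obtain ⟨rfl, rfl⟩ | ⟨rfl, rfl⟩ | ⟨rfl, rfl⟩ := hn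
  · simp only [hopfPair]
    rw [H _ (by omega)]
    exact if_congr (by omega) rfl rfl
  · simp only [hopfPair, mul_add, Finset.sum_add_distrib]
    rw [H _ (by omega)]
    have : η ^ 2 * ∑ b ∈ Finset.range (j + 1), delta (rootA (2 * j + 3)) b *
        (if 2 * i = 0 then 0 else hopf (rootA (2 * j + 3)) b (2 * i - 1)) = 0 := by
      split_ifs with h1
      · simp
      · rw [H _ (by omega), if_neg (by omega)]
    rw [this, add_zero]
    exact if_congr (by omega) rfl rfl
  · simp only [hopfPair, mul_add, Finset.sum_add_distrib]
    rw [H _ (by omega), if_neg (by omega), zero_add]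
    by_cases h1 : 2 * i < 2
    · simp only [if_pos h1, if_neg (show i ≠ 1 by omega), mul_zero, Finset.sum_const_zero]
    · simp only [if_neg h1, mul_add, Finset.sum_add_distrib]
      rw [H _ (by omega), H _ (by omega), if_neg (by omega), zero_add]
      exact if_congr (by omega) rfl rfl

/-- The invariants of a loop in the quaternionic manifold, labelled by `n ≤ 2`. -/
theorem invMLoop_eq_sum {η : ℂ} (hη : η ^ 2 * omegaValue (2 * h + 3) = 1) (k : ℂ) {n j : ℕ}
    (hn : n = 0 ∧ j = 0 ∨ n = 1 ∧ j = h ∨ n = 2 ∧ j = 1) :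
    invMLoop (2 * h + 3) η k n = ∑ a ∈ Finset.range (h + 1),
      if j ≤ a then delta (rootA (2 * h + 3)) a *
        (twistFactor (rootA (2 * h + 3)) 0 a * twistFactor (rootA (2 * h + 3)) j (a - j))
      else 0 := by
  have hA := rootA_isPrimitiveRoot (r := 2 * h + 3) (by omega)
  have h0 : rootA (2 * h + 3) ≠ 0 := hA.ne_zero (by omega)
  have hS := fun i (hi : i ≤ h) => eta_sum_hopfPair hη hn hi
  rw [invMLoop_eq, labels_odd, Finset.mul_sum]
  refine Finset.sum_congr rfl fun a ha => ?_
  rw [Finset.mem_range] at ha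
  generalize rootA (2 * h + 3) = A at *
  have hΔ : ∀ i < 2 * h + 2, delta A i ≠ 0 := fun i hi => delta_ne_zero hA hi
  obtain ⟨μ, hμ, hb⟩ := exists_bracket_loopWord h0 (a := a) fun i hi => hΔ i (by omega)
  have h1 : ∀ b ∈ Finset.range (h + 1), delta A b * bracket A (loopWord A a b n) =
      twistFactor A 0 a * ∑ i ∈ Finset.range (a + 1), twistFactor A i (a - i) * μ i *
        (delta A b * hopfPair A b (2 * i) n) := by
    intro b hbm
    rw [Finset.mem_range] at hbm
    rw [hb b n (by omega) (fun i hi => hΔ i (by omega)) fun i hi => hΔ i (by omega), mul_left_comm,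
      Finset.mul_sum]
    congr 1
    exact Finset.sum_congr rfl fun i _ => by ring
  rw [Finset.sum_congr rfl h1, ← Finset.mul_sum, Finset.sum_comm]
  have h2 : ∀ i ∈ Finset.range (a + 1), η ^ 2 * ∑ b ∈ Finset.range (h + 1),
      twistFactor A i (a - i) * μ i * (delta A b * hopfPair A b (2 * i) n) =
        if j = i then twistFactor A i (a - i) else 0 := by
    intro i hi
    rw [Finset.mem_range] at hi
    rw [← Finset.mul_sum, mul_left_comm, hS i (by omega)]
    simp only [eq_comm (a := j)]
    split_ifs with hij
    -- Only the surviving channel needs a nonzero vertex. For `n = 1` it is `i = h`, which forces `a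
    -- = h` and leaves no maxima between the two idempotents.
    · have hv : vertex A i (a - i) ≠ 0 := by
        rw [hij]
        obtain ⟨-, rfl⟩ | ⟨-, rfl⟩ | ⟨-, rfl⟩ := hn
        · exact vertex_zero_ne_zero h0 fun k hk => hΔ k (by omega)
        · obtain rfl : a = j := by omega
          rw [Nat.sub_self, vertex_right_zero h0 fun k hk => hΔ k (by omega)]
          exact jw_ne_zero h0 (hΔ _ (by omega))
        · exact vertex_one_ne_zero h0 fun k hk => hΔ k (by omega)
      rw [hμ i (a - i) (by omega) hv]; ring
    · simp
  rw [mul_left_comm, mul_left_comm (η ^ 2), Finset.mul_sum, Finset.sum_congr rfl h2,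
    Finset.sum_ite_eq]
  simp only [Finset.mem_range, Nat.lt_succ_iff]
  split_ifs <;> simp

/-! ### Products of twist factors and the Gaussian sum -/

theorem twistFactor_mul_zero (a : ℕ) :
    twistFactor A 0 a * twistFactor A 0 a = A ^ (2 * a ^ 2 + 4 * a) := by
  have : ((-1 : ℂ) ^ a) ^ 2 = 1 := by rw [← pow_mul, mul_comm, pow_mul]; simp
  simp only [twistFactor, mul_zero, add_zero, zero_pow two_ne_zero, pow_zero, mul_one]
  linear_combination (A ^ (a ^ 2 + 2 * a)) ^ 2 * this

theorem mul_twistFactor_one (a : ℕ) :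
    A ^ 4 * (twistFactor A 0 (a + 1) * twistFactor A 1 a) =
      -A ^ (2 * (a + 1) ^ 2 + 4 * (a + 1)) := by
  have : ((-1 : ℂ) ^ a) ^ 2 = 1 := by rw [← pow_mul, mul_comm, pow_mul]; simp
  simp only [twistFactor, mul_zero, add_zero, zero_pow two_ne_zero, pow_zero, mul_one, one_pow,
    pow_one]
  field_simp
  linear_combination -A ^ (2 * (a + 1) ^ 2 + 4 * (a + 1)) * this

theorem twistFactor_mul_self (hA : A ≠ 0) (a : ℕ) :
    twistFactor A 0 a * twistFactor A a 0 = (-1) ^ a * A ^ (2 * a) := by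
  simp only [twistFactor, mul_zero, zero_mul, add_zero, zero_pow two_ne_zero, pow_zero, mul_one,
    one_mul]
  rw [pow_add, inv_pow]
  field_simp

/-- Since `1 - A ^ 4 = -A ^ 2 * (A ^ 2 - A⁻¹ ^ 2)`, this factor clears the denominator of `Δ_a`, and
each summand becomes two terms of the Gaussian sum, with the indices `a + 1` and `a`. -/
theorem mul_sum_delta (hA : IsPrimitiveRoot A (2 * (2 * h + 3))) :
    (1 - A ^ 4) * ∑ a ∈ Finset.range (h + 1), delta A a * A ^ (2 * a ^ 2 + 4 * a) =
      ∑ j ∈ Finset.Icc 1 (2 * h + 2), (-1) ^ j * A ^ (2 * j ^ 2 + 2 * j) := by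
  have h0 : A ≠ 0 := hA.ne_zero (by omega)
  have e1 : ∀ a ∈ Finset.range (h + 1), (1 - A ^ 4) * (delta A a * A ^ (2 * a ^ 2 + 4 * a)) =
      (-1) ^ (a + 1) * A ^ (2 * (a + 1) ^ 2 + 2 * (a + 1)) + (-1) ^ a * A ^ (2 * a ^ 2 + 2 * a) := by
    intro a ha
    rw [Finset.mem_range] at ha
    have h1 := mul_delta h0 (n := a) fun i hi => delta_ne_zero hA (by omega)
    have h2 : 1 - A ^ 4 = -A ^ 2 * (A ^ 2 - A⁻¹ ^ 2) := by field_simp; ring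
    rw [h2, mul_assoc, ← mul_assoc (A ^ 2 - _), h1]
    have h3 : A ^ (2 * (a + 1)) * A⁻¹ ^ (2 * (a + 1)) = 1 := by
      rw [← mul_pow, mul_inv_cancel₀ h0, one_pow]
    have h4 : A ^ (2 * a ^ 2 + 4 * a) * A ^ 2 = A ^ (2 * a ^ 2 + 2 * a) * A ^ (2 * (a + 1)) := by
      rw [← pow_add, ← pow_add]; congr 1; ring
    have h5 : A ^ (2 * (a + 1) ^ 2 + 2 * (a + 1)) =
        A ^ (2 * a ^ 2 + 2 * a) * A ^ (2 * (a + 1)) * A ^ (2 * (a + 1)) := by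
      rw [← pow_add, ← pow_add]; congr 1; ring
    rw [h5]
    linear_combination (-(-1) ^ a * (A ^ (2 * (a + 1)) - A⁻¹ ^ (2 * (a + 1)))) * h4 +
      (-1) ^ a * A ^ (2 * a ^ 2 + 2 * a) * h3
  -- The Gaussian term is invariant under `a ↦ r - 1 - a`, because `r - 1` is even and `A ^ (2r) =
  -- 1`. This sends `0, …, h` to `h + 2, …, 2h + 2`, the part of the range that the indices `a + 1`
  -- miss.
  have e2 : ∀ a ∈ Finset.range (h + 1), (-1) ^ a * A ^ (2 * a ^ 2 + 2 * a) =
      (-1) ^ (2 * h + 2 - a) * A ^ (2 * (2 * h + 2 - a) ^ 2 + 2 * (2 * h + 2 - a)) := by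
    intro a ha
    rw [Finset.mem_range] at ha
    obtain ⟨b, hb⟩ : ∃ b, 2 * h + 2 = a + b := ⟨2 * h + 2 - a, by omega⟩
    rw [hb, Nat.add_sub_cancel_left]
    have h1 : ((-1 : ℂ)) ^ (a + b) = 1 := by rw [← hb, show 2 * h + 2 = 2 * (h + 1) by ring, pow_mul]; simp
    have h2 : ((-1 : ℂ) ^ a) ^ 2 = 1 := by rw [← pow_mul, mul_comm, pow_mul]; simp
    have h3 : (-1 : ℂ) ^ a = (-1) ^ b := by
      rw [pow_add] at h1
      linear_combination (-1) ^ b * h2 - (-1) ^ a * h1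
    have hr : A ^ (2 * (a + b + 1)) = 1 := by
      rw [← hb]; exact hA.pow_eq_one
    rw [h3]
    congr 1
    have h4 : A ^ (2 * a ^ 2 + 2 * a) * (A ^ (2 * (a + b + 1))) ^ b =
        A ^ (2 * b ^ 2 + 2 * b) * (A ^ (2 * (a + b + 1))) ^ a := by
      rw [← pow_mul, ← pow_mul, ← pow_add, ← pow_add]; congr 1; ring
    simpa [hr] using h4
  rw [Finset.mul_sum, Finset.sum_congr rfl e1, Finset.sum_add_distrib, Finset.sum_congr rfl e2,
    Finset.range_eq_Ico, Finset.sum_Ico_add' (fun j => (-1 : ℂ) ^ j * A ^ (2 * j ^ 2 + 2 * j)),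
    Finset.sum_Ico_reflect (fun j => (-1 : ℂ) ^ j * A ^ (2 * j ^ 2 + 2 * j)) _ (by omega)]
  rw [show 2 * h + 2 + 1 - (h + 1) = h + 1 + 1 by omega, zero_add,
    Finset.sum_Ico_consecutive _ (by omega) (by omega)]
  rfl

end KauffmanSkein

end

/-! ### Evaluation of the three invariants -/

theorem mainTheorem7 (r : ℕ) (hr : Odd r) (hr1 : 1 < r) (η k : ℂ)
    (hη : η ^ 2 * KauffmanSkein.omegaValue r = 1)
    (hk : k ^ 6 = KauffmanSkein.rootA r ^ (-6 - (r : ℤ) * (r + 1) / 2)) :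
    (1 - KauffmanSkein.rootA r ^ 4) * KauffmanSkein.invM r η k =
        ∑ j ∈ Finset.Icc 1 (r - 1), (-1) ^ j * KauffmanSkein.rootA r ^ (2 * j ^ 2 + 2 * j) ∧
      KauffmanSkein.invMLoop r η k 1 =
        -(KauffmanSkein.rootA r ^ (-2 : ℤ) / (KauffmanSkein.rootA r ^ 2 + 1)) ∧
      KauffmanSkein.rootA r ^ 4 * KauffmanSkein.invMLoop r η k 2 =
        1 - KauffmanSkein.invM r η k := by
  obtain ⟨h, rfl⟩ : ∃ h, r = 2 * h + 3 := by
    obtain ⟨m, rfl⟩ := hr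
    exact ⟨m - 1, by omega⟩
  have hA := KauffmanSkein.rootA_isPrimitiveRoot (r := 2 * h + 3) (by omega)
  have h0 : KauffmanSkein.rootA (2 * h + 3) ≠ 0 := hA.ne_zero (by omega)
  have hM : KauffmanSkein.invM (2 * h + 3) η k = ∑ a ∈ Finset.range (h + 1),
      KauffmanSkein.delta (KauffmanSkein.rootA (2 * h + 3)) a *
        KauffmanSkein.rootA (2 * h + 3) ^ (2 * a ^ 2 + 4 * a) := by
    rw [KauffmanSkein.invM_eq, KauffmanSkein.invMLoop_eq_sum hη k (j := 0) (by omega)]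
    simp [KauffmanSkein.twistFactor_mul_zero]
  have h1 := KauffmanSkein.invMLoop_eq_sum hη k (n := 1) (j := h) (by omega)
  have h2 := KauffmanSkein.invMLoop_eq_sum hη k (n := 2) (j := 1) (by omega)
  rw [hM]
  generalize KauffmanSkein.rootA (2 * h + 3) = A at *
  refine ⟨KauffmanSkein.mul_sum_delta hA, ?_, ?_⟩
  · rw [h1, Finset.sum_range_succ, Finset.sum_eq_zero, zero_add, if_pos le_rfl, Nat.sub_self,
      KauffmanSkein.twistFactor_mul_self h0]
    · have h3 := KauffmanSkein.mul_delta h0 (n := h) fun i hi =>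
        KauffmanSkein.delta_ne_zero hA (by omega)
      have h4 : ((-1 : ℂ) ^ h) ^ 2 = 1 := by rw [← pow_mul, mul_comm, pow_mul]; simp
      have h5 := KauffmanSkein.pow_sub_inv_pow_ne_zero hA one_ne_zero (by omega)
      -- The square of `A ^ r` is `1`, and `A ^ r ≠ 1` by primitivity. All powers with exponent
      -- close to `r` thereby reduce to small powers of `A`.
      have h6 : A ^ (2 * h + 3) = -1 := by
        have := hA.pow_eq_one
        rw [mul_comm, pow_mul] at this
        exact (mul_self_eq_one_iff.1 (by rwa [← sq])).resolve_left
          (hA.pow_ne_one_of_pos_of_lt (by omega) (by omega))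
      have h7 : A * A⁻¹ = 1 := mul_inv_cancel₀ h0
      have h8 : A ^ (2 * h) = -A⁻¹ ^ 3 := by
        refine mul_right_cancel₀ (pow_ne_zero 3 h0) ?_
        rw [← pow_add, h6, neg_mul, ← mul_pow, inv_mul_cancel₀ h0, one_pow]
      have h9 : A ^ (2 * (h + 1)) = -A⁻¹ := by
        rw [mul_add, pow_add, h8]; linear_combination -A⁻¹ * (A * A⁻¹ + 1) * h7
      have h10 : A⁻¹ ^ (2 * (h + 1)) = -A := by
        rw [inv_pow, h9, ← neg_inv, inv_inv]
      have h11 : A ^ 2 + 1 ≠ 0 := by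
        intro h12
        refine h5 ?_
        rw [mul_one]
        have : (A * A⁻¹) ^ 2 = 1 := by rw [h7, one_pow]
        linear_combination (1 - A⁻¹ ^ 2) * h12 + this
      have h13 : A ^ (-2 : ℤ) = A⁻¹ ^ 2 := by rw [zpow_neg, inv_pow]; norm_cast
      rw [mul_one] at h5
      refine mul_left_cancel₀ h5 ?_
      rw [h9, h10] at h3
      rw [← mul_assoc, h3, h8, h13]
      field_simp
      linear_combination (1 - A ^ 4) * h4
    · intro a ha
      rw [Finset.mem_range] at ha
      exact if_neg (by omega)
  -- The term `a = 0` is split off on both sides: it vanishes in the sum for the loop, since `j =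
  -- 1`, and equals `Δ_0 = 1` in the invariant of the manifold.
  · rw [h2, Finset.sum_range_succ', Finset.sum_range_succ', if_neg (by omega), add_zero,
      Finset.mul_sum]
    have h3 : ∀ a, A ^ 4 * (KauffmanSkein.delta A (a + 1) * (KauffmanSkein.twistFactor A 0 (a + 1) *
        KauffmanSkein.twistFactor A 1 a)) = -(KauffmanSkein.delta A (a + 1) *
          A ^ (2 * (a + 1) ^ 2 + 4 * (a + 1))) := by
      intro a
      rw [mul_left_comm, KauffmanSkein.mul_twistFactor_one]; ring
    simp [h3, KauffmanSkein.delta_zero h0]
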